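/- For a finite graph $H$ let $\rho(H)$ be its fractional edge-cover number, i.e. the minimum of $\sum_{e\in E(H)}x_e$ over $x\in[0,1]^{E(H)}$ with $\sum_{e\ni a}x_e\ge 1$ for every vertex $a$ of $H$, and let $\#H$ be the number of subgraphs of a graph $G$ that are isomorphic to $H$. An algorithm is a program for a randomized word RAM (unit cost per step, words of $w$ bits, uniform random choice from $\{0,\dots,r-1\}$ for a word $r$) that has access to a graph $G$ on $n$ vertices $0,\dots,n-1$ only through the queries: degree of $v$; $i$-th neighbor of $v$ (in an arbitrary fixed order of the adjacency list of $v$); is $\{u,v\}$ an edge?; and a uniformly random edge. Each query takes one step. **Theorem.** For every constant $a\in\mathbb N$ there is an algorithm with the following property. For every nonempty finite graph $H$ without isolated vertices there is a constant $C$ (depending only on $a$ and $H$) such that for every simple graph $G$ with $n$ vertices and $m$ edges, every rational $\varepsilon\in(0,1)$, every integer $h$ with $1\le h\le \#H$, and every word size $w\ge C\log_2(n q)$, where $q$ is the denominator of $\varepsilon$: given $\varepsilon$, (the adjacency matrix of) $H$, $n$, $m$, $h$ and query access to $G$, the algorithm outputs with probability at least $1-n^{-a}$ a number in $[(1-\varepsilon)\,\#H,\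 (1+\varepsilon)\,\#H]$. In the worst case, that is, for all outcomes of the randomness, it halts within $$C\cdot\frac{m^{\rho(H)}}{h}\cdot\frac{\log n}{\varepsilon^2}$$ steps and makes at most $$C\cdot\min\Big\{n+m,\ \frac{m^{\rho(H)}}{h}\cdot\frac{\log n}{\varepsilon^2}\Big\}$$ queries; if $G$ has no isolated vertex, then it makes at most $$C\cdot\min\Big\{m,\ \frac{m^{\rho(H)}}{h}\cdot\frac{\log n}{\varepsilon^2}\Big\}$$ queries. -/

import Mathlib

namespace SubgraphCount

/-- The fractional edge-cover number `ρ(H)`: the optimum of the linear program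
`minimize ∑ₑ xₑ` over `x ∈ [0,1]^E(H)` subject to `∑_{e ∋ v} xₑ ≥ 1` for every vertex `v`
(feasible exactly when `H` has no isolated vertex). -/
noncomputable def fracEdgeCover {V : Type*} [Fintype V] [DecidableEq V] (H : SimpleGraph V)
    [DecidableRel H.Adj] : ℝ :=
  sInf {r : ℝ | ∃ x : Sym2 V → ℝ,
    (∀ e ∈ H.edgeFinset, 0 ≤ x e ∧ x e ≤ 1) ∧
    (∀ v : V, 1 ≤ ∑ e ∈ H.incidenceFinset v, x e) ∧
    r = ∑ e ∈ H.edgeFinset, x e}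

/-- The quantity `(m ^ ρ / h) * (log n / ε ^ 2)`. -/
noncomputable def sampleBound (m n h : ℕ) (ρ ε : ℝ) : ℝ :=
  (m : ℝ) ^ ρ / h * (Real.log n / ε ^ 2)

/-! ### A randomized word RAM with query access to a graph

The machine has registers and a memory of words. A program is built from the instructions below
with sequencing, branching and loops; every step costs one unit of time. It learns about the graph
`G` only through the four kinds of queries. Vertices of `G` are `0, …, n - 1`. -/

/-- Arithmetic and comparison of two words. -/
inductive Op where
  | add | sub | mul | div | mod | lt | eq

/-- The value of an operation before reduction to a word (`sub` truncates at `0`, comparisons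
return `1` or `0`). -/
def Op.eval : Op → ℕ → ℕ → ℕ
  | .add, a, b => a + b
  | .sub, a, b => a - b
  | .mul, a, b => a * b
  | .div, a, b => a / b
  | .mod, a, b => a % b
  | .lt, a, b => if a < b then 1 else 0
  | .eq, a, b => if a = b then 1 else 0

/-- Instructions. All arguments are names of registers, except the literal in `const`. -/
inductive Instr where
  /-- `dst := c` -/
  | const (dst c : ℕ)
  /-- `dst := a o b` -/
  | op (o : Op) (dst a b : ℕ)
  /-- `dst := mem[addr]` -/
  | load (dst addr : ℕ)
  /-- `mem[addr] := src` -/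
  | store (addr src : ℕ)
  /-- `dst :=` a uniformly random element of `{0, …, a - 1}` (and `0` if `a = 0`) -/
  | rand (dst a : ℕ)
  /-- degree query: `dst := d_v` -/
  | degree (dst v : ℕ)
  /-- neighbor query: `dst :=` the `i`-th neighbor of `v`, counted from `0` -/
  | neighbor (dst v i : ℕ)
  /-- pair query: `dst := 1` if `{u, v}` is an edge, and `dst := 0` otherwise -/
  | pair (dst u v : ℕ)
  /-- edge-sample query: `dst₁, dst₂ :=` the smaller and the larger endpoint of a uniformly
  random edge -/
  | edgeSample (dst₁ dst₂ : ℕ)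

/-- Programs; `ite r` and `loop r` test whether register `r` is nonzero. -/
inductive Prog where
  | skip
  | instr (I : Instr)
  | seq (p q : Prog)
  | ite (r : ℕ) (p q : Prog)
  | loop (r : ℕ) (p : Prog)

/-- The contents of the machine, with a counter for the queries made so far. -/
structure State where
  reg : ℕ → ℕ
  mem : ℕ → ℕ
  queries : ℕ

/-- Write a value, reduced to a word of `w` bits, to a register. -/
def State.set (w : ℕ) (s : State) (dst v : ℕ) : State :=
  { s with reg := Function.update s.reg dst (v % 2 ^ w) }

/-- Count one query. -/
def State.tick (s : State) : State := { s with queries := s.queries + 1 }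

section Oracle

variable {n : ℕ} (G : SimpleGraph (Fin n)) [DecidableRel G.Adj]

/-- Answer to a degree query (`0` if `v` is not a vertex). -/
def degreeAnswer (v : ℕ) : ℕ :=
  if hv : v < n then G.degree ⟨v, hv⟩ else 0

/-- Answer to a neighbor query with respect to given adjacency lists (`0` if the query is not
legal). -/
def neighborAnswer (nbr : ∀ v : Fin n, Fin (G.degree v) ≃ G.neighborSet v) (v i : ℕ) : ℕ :=
  if hv : v < n then
    if hi : i < G.degree ⟨v, hv⟩ then ((nbr ⟨v, hv⟩ ⟨i, hi⟩ : Fin n) : ℕ) else 0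
  else 0

/-- Answer to a pair query. -/
def pairAnswer (u v : ℕ) : ℕ :=
  if h : u < n ∧ v < n then
    if G.Adj ⟨u, h.1⟩ ⟨v, h.2⟩ then 1 else 0
  else 0

/-- The effect of one instruction on a machine with words of `w` bits. -/
noncomputable def exec (nbr : ∀ v : Fin n, Fin (G.degree v) ≃ G.neighborSet v) (w : ℕ)
    (s : State) : Instr → PMF State
  | .const dst c => PMF.pure (s.set w dst c)
  | .op o dst a b => PMF.pure (s.set w dst (o.eval (s.reg a) (s.reg b)))
  | .load dst addr => PMF.pure (s.set w dst (s.mem (s.reg addr)))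
  | .store addr src =>
      PMF.pure { s with mem := Function.update s.mem (s.reg addr) (s.reg src) }
  | .rand dst a =>
      if h : (Finset.range (s.reg a)).Nonempty then
        (PMF.uniformOfFinset (Finset.range (s.reg a)) h).map (fun x => s.set w dst x)
      else PMF.pure (s.set w dst 0)
  | .degree dst v => PMF.pure (s.tick.set w dst (degreeAnswer G (s.reg v)))
  | .neighbor dst v i =>
      PMF.pure (s.tick.set w dst (neighborAnswer G nbr (s.reg v) (s.reg i)))
  | .pair dst u v => PMF.pure (s.tick.set w dst (pairAnswer G (s.reg u) (s.reg v)))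
  | .edgeSample dst₁ dst₂ =>
      if h : G.edgeFinset.Nonempty then
        (PMF.uniformOfFinset G.edgeFinset h).map
          (fun e => (s.tick.set w dst₁ (e.inf : Fin n)).set w dst₂ (e.sup : Fin n))
      else PMF.pure s.tick

/-- A configuration: the commands still to be carried out, and the contents of the machine. The
machine has halted when nothing is left to do. -/
structure Config where
  todo : List Prog
  state : State

/-- One step of the machine (one unit of time). -/
noncomputable def step (nbr : ∀ v : Fin n, Fin (G.degree v) ≃ G.neighborSet v) (w : ℕ) :
    Config → PMF Config
  | ⟨[], s⟩ => PMF.pure ⟨[], s⟩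
  | ⟨.skip :: K, s⟩ => PMF.pure ⟨K, s⟩
  | ⟨.instr I :: K, s⟩ => (exec G nbr w s I).map (fun s' => ⟨K, s'⟩)
  | ⟨.seq p q :: K, s⟩ => PMF.pure ⟨p :: q :: K, s⟩
  | ⟨.ite r p q :: K, s⟩ => PMF.pure ⟨(if s.reg r ≠ 0 then p else q) :: K, s⟩
  | ⟨.loop r p :: K, s⟩ =>
      PMF.pure ⟨if s.reg r ≠ 0 then p :: .loop r p :: K else K, s⟩

/-- The distribution of the configuration after `T` steps. -/
noncomputable def run (nbr : ∀ v : Fin n, Fin (G.degree v) ≃ G.neighborSet v) (w : ℕ) :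
    ℕ → Config → PMF Config
  | 0, c => PMF.pure c
  | T + 1, c => (step G nbr w c).bind (run nbr w T)

end Oracle

/-- The contents of the machine at the start: registers `0, …, 5` hold `n`, `m`, `h`, the numerator
and the denominator of `ε`, and the number `k` of vertices of `H`; memory cells `0, …, k ^ 2 - 1`
hold the adjacency matrix of `H`, row by row; everything else is `0`. -/
def initState {k : ℕ} (H : SimpleGraph (Fin k)) [DecidableRel H.Adj] (n m h : ℕ) (ε : ℚ) :
    State where
  reg i := match i with
    | 0 => n
    | 1 => m
    | 2 => h
    | 3 => ε.num.natAbs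
    | 4 => ε.den
    | 5 => k
    | _ => 0
  mem x := if x < k * k then pairAnswer H (x / k) (x % k) else 0
  queries := 0

/-- The output: the quotient of the contents of registers `0` and `1`. -/
noncomputable def Config.output (c : Config) : ℝ :=
  (c.state.reg 0 : ℝ) / (c.state.reg 1 : ℝ)

end SubgraphCount

namespace SubgraphCount

/-! One trial draws a random map from the vertices of `H` to those of `G`, vertex by vertex. For
vertex `i` a uniform index `j < k` is drawn. If `j < i` and `j` is a neighbor of `i` in `H`, the
image of `i` is a uniform neighbor of the image of `j`; otherwise it is a random endpoint of a
random edge, hence a vertex with probability proportional to its degree. An embedding `φ` is thus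
produced with probability `∏ Q i / k ^ k`, where the sum `Q i` contains `d(φ i) / 2m`, and also `1 /
d(φ j)` for each neighbor `j < i` of `i`. So `2m * Q i ≥ 1` for every vertex, and `2m * Q i * Q j ≥
1` for every edge of `H`. A matching argument based on Hall's theorem turns this into `∏ Q i ≥ (2m)
^ (-R / 2)` with `R = coverNum H` (`one_le_prod_sq_mul_pow_coverNum`), and `R / 2 ≤ ρ(H)` by linear
programming duality (`coverNum_div_two_le`).

Rejection sampling makes the trial uniform: for an integer `s` with `2m ≤ s ^ 2 ≤ 8m`, a sampled
embedding is accepted with probability `1 / (s ^ R * ∏ Q i)`, which is at most 1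
(`acceptance_bound`). Every embedding is then found with the same probability `1 / W`, where `W = k
^ k * s ^ R` is of order at most `m ^ ρ(H)` (`trialDist_apply_true`, `weight_le`). There are `#H *
|Aut H|` embeddings (`card_embeddings`), so a trial succeeds with probability `p = #H * |Aut H| / W
≥ h / W`. By a Chernoff bound (`one_sub_le_toOuterMeasure_successes`), about `4 (a + 1) W log₂(2n) /
(h ε²)` trials suffice, and the output is the number of successes times `W`, divided by the number
of trials and by `|Aut H|`. The acceptance probabilities are rational numbers with an explicit
denominator, so the machine realizes them exactly.

A trial takes a number of steps and queries that depends on `H` only. If the number `N` of trials is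
at least `n + m`, the machine first reads all of `G` into memory with `n + 2m` queries and answers
all later accesses from there; the time for reading is then dominated by the time for the trials.

The machine is tied to these distributions by a program logic. `Tri` states that a program
implements an abstract distribution, witnessed by a coupling of abstract results and final machine
contents; it is phrased with an arbitrary continuation so that programs compose. Expressions are
compiled to instructions (`Expr.code_spec`) under a no-overflow condition, and `R` and `|Aut H|` are
computed by brute force. `exists_sizeGood` shows that all numbers involved are polynomial in `n`
times the denominator of `ε`, hence fit into words. -/

/-- Registers below `numVars` are program variables, the others are scratch space. -/
abbrev numVars : ℕ := 40

/-! ### Couplings of machine runs with abstract distributions -/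

section Triples

variable {n : ℕ} (G : SimpleGraph (Fin n)) [DecidableRel G.Adj]
  (nbr : ∀ v : Fin n, Fin (G.degree v) ≃ G.neighborSet v) (w : ℕ)

/-- From commands `K` and contents `s` the machine halts within `t` steps, and its final contents
are coupled to the abstract distribution `ν` by the relation `R`. -/
def HaltsWith (K : List Prog) (s : State) (t : ℕ) {β : Type} (ν : PMF β)
    (R : β → State → Prop) : Prop :=
  ∀ T, t ≤ T → ∃ κ : PMF (β × State), κ.map Prod.fst = ν ∧
    κ.map (fun x => (⟨[], x.2⟩ : Config)) = run G nbr w T ⟨K, s⟩ ∧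
    ∀ x ∈ κ.support, R x.1 x.2

/-- The machine contents `s` agree with `σ` up to scratch registers, and all are words. -/
structure Sim (s σ : State) : Prop where
  reg : ∀ r < numVars, s.reg r = σ.reg r
  mem : s.mem = σ.mem
  queries : s.queries = σ.queries
  reg_lt : ∀ r, s.reg r < 2 ^ w
  mem_lt : ∀ x, s.mem x < 2 ^ w

/-- Started in `σ`, the program `p` takes at most `t` steps, and it implements the abstract
distribution `ν` with the relation `Q` between abstract results and final contents. -/
def Tri (p : Prog) (t : ℕ) (σ : State) {α : Type} (ν : PMF α) (Q : α → State → Prop) : Prop :=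
  ∀ s, Sim w s σ → ∀ (K : List Prog) (u : ℕ) (β : Type) (ν₂ : α → PMF β) (R : β → State → Prop),
    (∀ a s' σ', Sim w s' σ' → Q a σ' → HaltsWith G nbr w K s' u (ν₂ a) R) →
    HaltsWith G nbr w (p :: K) s (t + u) (ν.bind ν₂) R

variable {G nbr w}

theorem HaltsWith.mono {K : List Prog} {s : State} {t t' : ℕ} {β : Type} {ν : PMF β}
    {R : β → State → Prop} (h : HaltsWith G nbr w K s t ν R) (ht : t ≤ t') :
    HaltsWith G nbr w K s t' ν R := fun T hT => h T (ht.trans hT)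

theorem HaltsWith.nil {s : State} {β : Type} {b : β} {R : β → State → Prop} (h : R b s) :
    HaltsWith G nbr w [] s 0 (PMF.pure b) R := by
  have hrun : ∀ T, run G nbr w T ⟨[], s⟩ = PMF.pure ⟨[], s⟩ := by
    intro T
    induction T with
    | zero => rfl
    | succ T ih => simp [run, step, ih]
  intro T _
  refine ⟨PMF.pure (b, s), ?_, ?_, ?_⟩
  · simp [PMF.pure_map]
  · simp [PMF.pure_map, hrun]
  · intro x hx
    simp only [PMF.support_pure, Set.mem_singleton_iff] at hx
    subst hx
    exact h

theorem HaltsWith.of_step {K K' : List Prog} {s s' : State} {u : ℕ} {β : Type} {ν : PMF β}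
    {R : β → State → Prop} (hs : step G nbr w ⟨K, s⟩ = PMF.pure ⟨K', s'⟩)
    (h : HaltsWith G nbr w K' s' u ν R) : HaltsWith G nbr w K s (1 + u) ν R := by
  intro T hT
  obtain ⟨T', rfl⟩ : ∃ T', T = T' + 1 := ⟨T - 1, by omega⟩
  obtain ⟨κ, h1, h2, h3⟩ := h T' (by omega)
  refine ⟨κ, h1, ?_, h3⟩
  rw [h2, run, hs, PMF.pure_bind]

/-- The couplings that belong to the individual outcomes are glued along the distribution `U` of the
outcome. -/
theorem HaltsWith.of_random {X : Type} {K : List Prog} {s : State} {I : Instr} {u : ℕ}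
    {β : Type} (U : PMF X) (f : X → State) (hI : exec G nbr w s I = U.map f) (ν : X → PMF β)
    {R : β → State → Prop}
    (h : ∀ x ∈ U.support, HaltsWith G nbr w K (f x) u (ν x) R) :
    HaltsWith G nbr w (.instr I :: K) s (1 + u) (U.bind ν) R := by
  intro T hT
  obtain ⟨T', rfl⟩ : ∃ T', T = T' + 1 := ⟨T - 1, by omega⟩
  -- Nothing is known about outcomes outside the support of `U`; the coupling `κ₀` of some outcome
  -- in the support serves as a default value there.
  obtain ⟨x₀, hx₀⟩ := U.support_nonempty
  obtain ⟨κ₀, -⟩ := h x₀ hx₀ T' (by omega)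
  have : Nonempty (PMF (β × State)) := ⟨κ₀⟩
  have h' : ∀ x, ∃ κ : PMF (β × State), x ∈ U.support → (κ.map Prod.fst = ν x ∧
      κ.map (fun x => (⟨[], x.2⟩ : Config)) = run G nbr w T' ⟨K, f x⟩ ∧
      ∀ y ∈ κ.support, R y.1 y.2) := by
    intro x
    by_cases hx : x ∈ U.support
    · obtain ⟨κ, hκ⟩ := h x hx T' (by omega)
      exact ⟨κ, fun _ => hκ⟩
    · exact ⟨κ₀, fun h => absurd h hx⟩
  choose κ hκ using h'
  have bind_congr : ∀ {γ : Type} (g g' : X → PMF γ), (∀ x ∈ U.support, g x = g' x) →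
      U.bind g = U.bind g' := by
    intro γ g g' hg
    ext y
    simp only [PMF.bind_apply]
    refine tsum_congr fun x => ?_
    by_cases hx : x ∈ U.support
    · rw [hg x hx]
    · rw [(PMF.apply_eq_zero_iff U x).2 hx, zero_mul, zero_mul]
  refine ⟨U.bind κ, ?_, ?_, ?_⟩
  · rw [PMF.map_bind]
    exact bind_congr _ _ fun x hx => (hκ x hx).1
  · rw [PMF.map_bind, run, step, hI, PMF.map_comp, PMF.bind_map]
    exact bind_congr _ _ fun x hx => (hκ x hx).2.1
  · intro y hy
    obtain ⟨x, hx, hy⟩ := (PMF.mem_support_bind_iff _ _ _).1 hy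
    exact (hκ x hx).2.2 y hy

namespace Tri

variable {p q : Prog} {t u : ℕ} {σ : State} {α β : Type} {ν : PMF α} {Q : α → State → Prop}

theorem mono (h : Tri G nbr w p t σ ν Q) {t' : ℕ} (ht : t ≤ t') : Tri G nbr w p t' σ ν Q :=
  fun s hs K u β ν₂ R hK => (h s hs K u β ν₂ R hK).mono (by omega)

theorem conseq (h : Tri G nbr w p t σ ν Q) {Q' : α → State → Prop}
    (hQ : ∀ a σ', Q a σ' → Q' a σ') : Tri G nbr w p t σ ν Q' :=
  fun s hs K u β ν₂ R hK => h s hs K u β ν₂ R fun a s' σ' h1 h2 => hK a s' σ' h1 (hQ a σ' h2)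

theorem map (h : Tri G nbr w p t σ ν Q) (f : α → β) {Q' : β → State → Prop}
    (hQ : ∀ a σ', Q a σ' → Q' (f a) σ') : Tri G nbr w p t σ (ν.map f) Q' := by
  intro s hs K u γ ν₂ R hK
  rw [PMF.bind_map]
  exact h s hs K u γ _ R fun a s' σ' h1 h2 => hK (f a) s' σ' h1 (hQ a σ' h2)

/-- As the continuation is arbitrary, `q` can be made part of the continuation of `p`; what remains
is associativity of `bind`. -/
theorem seq {κ : α → PMF β} {R : β → State → Prop} (hp : Tri G nbr w p t σ ν Q)
    (hq : ∀ a σ', Q a σ' → Tri G nbr w q u σ' (κ a) R) :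
    Tri G nbr w (.seq p q) (1 + t + u) σ (ν.bind κ) R := by
  intro s hs K v γ ν₂ S hK
  have := hp s hs (q :: K) (u + v) γ (fun a => (κ a).bind ν₂) S
    fun a s' σ' h1 h2 => hq a σ' h2 s' h1 K v γ ν₂ S hK
  rw [← PMF.bind_bind] at this
  refine (HaltsWith.of_step (K' := p :: q :: K) (s' := s) rfl this).mono (by omega)

theorem seq_det {R : β → State → Prop} {ν : PMF β} {Q : Unit → State → Prop}
    (hp : Tri G nbr w p t σ (PMF.pure ()) Q)
    (hq : ∀ σ', Q () σ' → Tri G nbr w q u σ' ν R) :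
    Tri G nbr w (.seq p q) (1 + t + u) σ ν R := by
  have := hp.seq (κ := fun _ => ν) (R := R) (q := q) (u := u) fun _ => hq
  rwa [PMF.pure_bind] at this

/-- The random result `a` of `p` is carried along unchanged while `q` does deterministic
bookkeeping. -/
theorem then_det {R : α → State → Prop} (hp : Tri G nbr w p t σ ν Q)
    (hq : ∀ a σ', Q a σ' → Tri G nbr w q u σ' (PMF.pure ()) fun _ => R a) :
    Tri G nbr w (.seq p q) (1 + t + u) σ ν R := by
  have := hp.seq (κ := fun a => PMF.pure a) (R := R) (q := q) (u := u) fun a σ' h => by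
    have := (hq a σ' h).map (fun _ => a) (Q' := R) fun _ _ h => h
    rwa [PMF.pure_map] at this
  rwa [PMF.bind_pure] at this

theorem of_eq {ν' : PMF α} (h : Tri G nbr w p t σ ν Q) (e : ν = ν') : Tri G nbr w p t σ ν' Q :=
  e ▸ h

theorem skip {a : α} (h : Q a σ) : Tri G nbr w .skip 1 σ (PMF.pure a) Q := by
  intro s hs K u β ν₂ R hK
  rw [PMF.pure_bind]
  exact HaltsWith.of_step rfl (hK a s σ hs h)

end Tri
end Triples

/-! ### Arithmetic expressions and their compilation -/

/-- A bound for the running time when every loop makes at most `X` iterations. -/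
def Prog.tb (X : ℕ) : Prog → ℕ
  | .skip => 1
  | .instr _ => 1
  | .seq p q => 1 + p.tb X + q.tb X
  | .ite _ p q => 1 + p.tb X + q.tb X
  | .loop _ p => X * (1 + p.tb X) + 1

/-- `iterate f z N` folds `f` over `0, …, N - 1` from the initial value `z`. -/
def iterate (f : ℕ → ℕ → ℕ) (z : ℕ) : ℕ → ℕ
  | 0 => z
  | i + 1 => f i (iterate f z i)

/-- Expressions: `loc` refers to the variables bound by `iter`, innermost first, where `iter N z b`
folds `b` (with the accumulator as `loc 0` and the index as `loc 1`) over `0, …, N - 1`. -/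
inductive Expr where
  | lit (c : ℕ)
  | var (x : ℕ)
  | loc (j : ℕ)
  | mem (e : Expr)
  | bin (o : Op) (a b : Expr)
  | iter (N z b : Expr)

namespace Expr

/-- The value of an expression, given the values of the bound variables. -/
def eval (σ : State) : Expr → List ℕ → ℕ
  | lit c, _ => c
  | var x, _ => σ.reg x
  | loc j, l => l.getD j 0
  | mem e, l => σ.mem (e.eval σ l)
  | bin o a b, l => o.eval (a.eval σ l) (b.eval σ l)
  | iter N z b, l => iterate (fun i acc => b.eval σ (acc :: i :: l)) (z.eval σ l) (N.eval σ l)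

/-- An operation does not overflow. -/
def _root_.SubgraphCount.Op.Fits (W : ℕ) : Op → ℕ → ℕ → Prop
  | .add, a, b => a + b < W
  | .mul, a, b => a * b < W
  | _, _, _ => True

/-- The evaluation of an expression does not overflow, and each `iter` has at most `X` rounds. -/
def Ok (W X : ℕ) (σ : State) : Expr → List ℕ → Prop
  | lit c, _ => c < W
  | var x, _ => x < numVars
  | loc j, l => j < l.length
  | mem e, l => e.Ok W X σ l
  | bin o a b, l => a.Ok W X σ l ∧ b.Ok W X σ l ∧ o.Fits W (a.eval σ l) (b.eval σ l)
  | iter N z b, l => N.Ok W X σ l ∧ z.Ok W X σ l ∧ N.eval σ l ≤ X ∧ ∀ i < N.eval σ l,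
      b.Ok W X σ (iterate (fun i acc => b.eval σ (acc :: i :: l)) (z.eval σ l) i :: i :: l)

/-- `dst := src` (for different registers). -/
def _root_.SubgraphCount.Prog.move (dst src : ℕ) : Prog :=
  .seq (.instr (.const dst 0)) (.instr (.op .add dst dst src))

/-- Code that puts the value of an expression into register `d`, without changing lower registers;
`ρ` lists the registers that hold the bound variables. -/
def code : Expr → ℕ → List ℕ → Prog
  | lit c, d, _ => .instr (.const d c)
  | var x, d, _ => .move d x
  | loc j, d, ρ => .move d (ρ.getD j 0)
  | mem e, d, ρ => .seq (e.code d ρ) (.instr (.load d d))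
  | bin o a b, d, ρ =>
      .seq (a.code d ρ) (.seq (b.code (d + 1) ρ) (.instr (.op o d d (d + 1))))
  -- Register `d` holds the accumulator, `d + 1` the index and `d + 2` the bound; `d + 3` alternates
  -- between the loop condition and the value of the body.
  | iter N z b, d, ρ =>
      .seq (z.code d ρ) (.seq (N.code (d + 2) ρ) (.seq (.instr (.const (d + 1) 0))
        (.seq (.instr (.op .lt (d + 3) (d + 1) (d + 2))) (.loop (d + 3)
          (.seq (b.code (d + 3) (d :: (d + 1) :: ρ)) (.seq (.move d (d + 3))
            (.seq (.instr (.const (d + 3) 1)) (.seq (.instr (.op .add (d + 1) (d + 1) (d + 3)))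
              (.instr (.op .lt (d + 3) (d + 1) (d + 2)))))))))))

end Expr

section Raw

variable {n : ℕ} (G : SimpleGraph (Fin n)) [DecidableRel G.Adj]
  (nbr : ∀ v : Fin n, Fin (G.degree v) ≃ G.neighborSet v) (w : ℕ)

/-- `p` deterministically leads from `s` to `s'` within `t` steps. -/
def Raw (p : Prog) (t : ℕ) (s s' : State) : Prop :=
  ∀ (K : List Prog) (u : ℕ) (β : Type) (ν : PMF β) (R : β → State → Prop),
    HaltsWith G nbr w K s' u ν R → HaltsWith G nbr w (p :: K) s (t + u) ν R

variable {G nbr w}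

namespace Raw

theorem mono {p : Prog} {t t' : ℕ} {s s' : State} (h : Raw G nbr w p t s s') (ht : t ≤ t') :
    Raw G nbr w p t' s s' := fun K u β ν R hK => (h K u β ν R hK).mono (by omega)

theorem instr {I : Instr} {s s' : State} (h : exec G nbr w s I = PMF.pure s') :
    Raw G nbr w (.instr I) 1 s s' := fun K u β ν R hK =>
  HaltsWith.of_step (by simp [step, h, PMF.pure_map]) hK

theorem seq {p q : Prog} {t u : ℕ} {s s' s'' : State} (hp : Raw G nbr w p t s s')
    (hq : Raw G nbr w q u s' s'') : Raw G nbr w (.seq p q) (1 + t + u) s s'' :=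
  fun K v β ν R hK => by
    have := hp _ _ _ _ _ (hq K v β ν R hK)
    exact (HaltsWith.of_step (K' := p :: q :: K) (s' := s) rfl this).mono (by omega)

theorem loop_done {r : ℕ} {p : Prog} {s : State} (h : s.reg r = 0) :
    Raw G nbr w (.loop r p) 1 s s := fun K u β ν R hK =>
  HaltsWith.of_step (by simp [step, h]) hK

theorem loop_step {r : ℕ} {p : Prog} {t u : ℕ} {s s' s'' : State} (h : s.reg r ≠ 0)
    (hp : Raw G nbr w p t s s') (hq : Raw G nbr w (.loop r p) u s' s'') :
    Raw G nbr w (.loop r p) (1 + t + u) s s'' := fun K v β ν R hK => by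
  have := hp _ _ _ _ _ (hq K v β ν R hK)
  exact (HaltsWith.of_step (K' := p :: .loop r p :: K) (s' := s) (by simp [step, h])
    this).mono (by omega)

end Raw

/-- Registers below `d`, memory and query counter agree, and `s'` consists of words. -/
structure Keeps (w d : ℕ) (s s' : State) : Prop where
  reg : ∀ r < d, s'.reg r = s.reg r
  mem : s'.mem = s.mem
  queries : s'.queries = s.queries
  reg_lt : ∀ r, s'.reg r < 2 ^ w
  mem_lt : ∀ x, s'.mem x < 2 ^ w

theorem Keeps.trans {d d' : ℕ} {s s' s'' : State} (h : Keeps w d s s') (h' : Keeps w d' s' s'')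
    (hd : d ≤ d') : Keeps w d s s'' :=
  ⟨fun r hr => (h'.reg r (by omega)).trans (h.reg r hr), h'.mem.trans h.mem,
    h'.queries.trans h.queries, h'.reg_lt, h'.mem_lt⟩

theorem Keeps.set {d x : ℕ} {s s' : State} (h : Keeps w d s s') (hx : d ≤ x) (v : ℕ) :
    Keeps w d s (s'.set w x v) := by
  refine ⟨fun r hr => ?_, h.mem, h.queries, fun r => ?_, h.mem_lt⟩
  · simp only [State.set]
    rw [Function.update_of_ne (by omega)]
    exact h.reg r hr
  · simp only [State.set, Function.update_apply]
    split
    · exact Nat.mod_lt _ (by positivity)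
    · exact h.reg_lt r

theorem State.set_reg_self (s : State) (x : ℕ) {v : ℕ} (hv : v < 2 ^ w) :
    (s.set w x v).reg x = v := by
  simp [State.set, Nat.mod_eq_of_lt hv]

theorem State.set_reg_of_ne (s : State) {x y : ℕ} (v : ℕ) (h : y ≠ x) :
    (s.set w x v).reg y = s.reg y := by
  simp [State.set, h]

/-- The situation in which an expression can be evaluated at stack height `d`. -/
structure Fit (w : ℕ) (σ : State) (l ρ : List ℕ) (d : ℕ) (s : State) : Prop where
  le : numVars ≤ d
  reg : ∀ r < numVars, s.reg r = σ.reg r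
  mem : s.mem = σ.mem
  loc : ∀ j < l.length, ρ.getD j 0 < d ∧ s.reg (ρ.getD j 0) = l.getD j 0
  reg_lt : ∀ r, s.reg r < 2 ^ w
  mem_lt : ∀ x, s.mem x < 2 ^ w

theorem Fit.keeps {σ : State} {l ρ : List ℕ} {d d' : ℕ} {s s' : State} (h : Fit w σ l ρ d s)
    (hk : Keeps w d s s') (hd : d ≤ d') : Fit w σ l ρ d' s' :=
  ⟨h.le.trans hd, fun r hr => (hk.reg r (hr.trans_le h.le)).trans (h.reg r hr),
    hk.mem.trans h.mem, fun j hj => ⟨(h.loc j hj).1.trans_le hd,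
      (hk.reg _ (h.loc j hj).1).trans (h.loc j hj).2⟩, hk.reg_lt, hk.mem_lt⟩

theorem Fit.keeps_self {σ : State} {l ρ : List ℕ} {d : ℕ} {s : State} (h : Fit w σ l ρ d s) :
    Keeps w d s s := ⟨fun _ _ => rfl, rfl, rfl, h.reg_lt, h.mem_lt⟩

theorem raw_move {d x : ℕ} {s : State} (hx : x < d) (hs : ∀ r, s.reg r < 2 ^ w)
    (hm : ∀ r, s.mem r < 2 ^ w) (X : ℕ) :
    ∃ s', Raw G nbr w (.move d x) ((Prog.move d x).tb X) s s' ∧ s'.reg d = s.reg x ∧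
      Keeps w d s s' := by
  refine ⟨_, (Raw.instr rfl).seq (Raw.instr rfl), ?_, ?_⟩
  · have h0 : (0 : ℕ) < 2 ^ w := by positivity
    have : Op.add.eval ((s.set w d 0).reg d) ((s.set w d 0).reg x) = s.reg x := by
      rw [State.set_reg_self _ _ h0, State.set_reg_of_ne _ _ (by omega)]
      simp [Op.eval]
    rw [this, State.set_reg_self _ _ (hs x)]
  · exact (Keeps.set (Keeps.set ⟨fun _ _ => rfl, rfl, rfl, hs, hm⟩ le_rfl _) le_rfl _)

theorem Op.eval_lt {W a b : ℕ} (o : Op) (ha : a < W) (h : o.Fits W a b) (hW : 1 < W) :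
    o.eval a b < W := by
  cases o with
  | add => exact h
  | sub => exact (Nat.sub_le a b).trans_lt ha
  | mul => exact h
  | div => exact (Nat.div_le_self a b).trans_lt ha
  | mod => exact (Nat.mod_le a b).trans_lt ha
  | lt => simp only [Op.eval]; split <;> omega
  | eq => simp only [Op.eval]; split <;> omega

/-- Code at stack height `d` writes only to registers from `d` on, so operands that were evaluated
earlier survive below. That a value is a word need not be assumed for subexpressions: it has been
found in a register. -/
theorem Expr.code_spec (hW : 1 < 2 ^ w) (X : ℕ) (σ : State) (e : Expr) :
    ∀ (l ρ : List ℕ) (d : ℕ) (s : State), e.Ok (2 ^ w) X σ l → Fit w σ l ρ d s →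
      ∃ s', Raw G nbr w (e.code d ρ) ((e.code d ρ).tb X) s s' ∧ s'.reg d = e.eval σ l ∧
        Keeps w d s s' := by
  induction e with
  | lit c =>
    intro l ρ d s h hF
    exact ⟨_, Raw.instr rfl, State.set_reg_self _ _ h, hF.keeps_self.set le_rfl _⟩
  | var x =>
    intro l ρ d s h hF
    obtain ⟨s', h1, h2, h3⟩ := raw_move (G := G) (nbr := nbr)
      (lt_of_lt_of_le h hF.le) hF.reg_lt hF.mem_lt X
    exact ⟨s', h1, h2.trans (hF.reg x h), h3⟩
  | loc j =>
    intro l ρ d s h hF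
    obtain ⟨s', h1, h2, h3⟩ := raw_move (G := G) (nbr := nbr)
      (hF.loc j h).1 hF.reg_lt hF.mem_lt X
    exact ⟨s', h1, h2.trans (hF.loc j h).2, h3⟩
  | mem e ih =>
    intro l ρ d s h hF
    obtain ⟨s', h1, h2, h3⟩ := ih l ρ d s h hF
    refine ⟨_, h1.seq (Raw.instr rfl), ?_, h3.set le_rfl _⟩
    rw [State.set_reg_self _ _ (h3.mem_lt _), h2, h3.mem, hF.mem]
    rfl
  | bin o a b iha ihb =>
    intro l ρ d s h hF
    obtain ⟨ha, hb, ho⟩ := h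
    obtain ⟨s₁, h1, h2, h3⟩ := iha l ρ d s ha hF
    have hF₁ := hF.keeps h3 (Nat.le_succ d)
    obtain ⟨s₂, g1, g2, g3⟩ := ihb l ρ (d + 1) s₁ hb hF₁
    refine ⟨_, h1.seq (g1.seq (Raw.instr rfl)), ?_, (h3.trans g3 (Nat.le_succ d)).set le_rfl _⟩
    have e1 : s₂.reg d = a.eval σ l := (g3.reg d (Nat.lt_succ_self d)).trans h2
    rw [e1, g2, State.set_reg_self _ _]
    · rfl
    · refine Op.eval_lt o ?_ ho hW
      rw [← e1]
      exact g3.reg_lt d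
  | iter N z b ihN ihz ihb =>
    intro l ρ d s h hF
    obtain ⟨hN, hz, hX, hb⟩ := h
    obtain ⟨s₁, h1, h2, h3⟩ := ihz l ρ d s hz hF
    have hF₁ := hF.keeps h3 (show d ≤ d + 2 by omega)
    obtain ⟨s₂, g1, g2, g3⟩ := ihN l ρ (d + 2) s₁ hN hF₁
    have k2 : Keeps w d s s₂ := h3.trans g3 (by omega)
    have hNw : N.eval σ l < 2 ^ w := g2 ▸ g3.reg_lt _
    set M := N.eval σ l with hM
    set f : ℕ → ℕ := iterate (fun i acc => b.eval σ (acc :: i :: l)) (z.eval σ l) with hf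
    set body : Prog := (.seq (b.code (d + 3) (d :: (d + 1) :: ρ)) (.seq (.move d (d + 3))
            (.seq (.instr (.const (d + 3) 1)) (.seq (.instr (.op .add (d + 1) (d + 1) (d + 3)))
              (.instr (.op .lt (d + 3) (d + 1) (d + 2))))))) with hbody
    have hlt : ∀ i j, Op.lt.eval i j < 2 ^ w := by
      intro i j; simp only [Op.eval]; split <;> omega
    -- Induction on the number `j` of remaining rounds; `i` is the index of the next round.
    have loop : ∀ j i s', i + j = M → Keeps w d s s' → s'.reg d = f i → s'.reg (d + 1) = i →
        s'.reg (d + 2) = M → s'.reg (d + 3) = Op.lt.eval i M →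
        ∃ s'', Raw G nbr w (.loop (d + 3) body) (j * (1 + body.tb X) + 1) s' s'' ∧
          s''.reg d = f M ∧ Keeps w d s s'' := by
      intro j
      induction j with
      | zero =>
        intro i s' hij hk e0 e1 e2 e3
        obtain rfl : i = M := by omega
        refine ⟨s', (Raw.loop_done ?_).mono (by omega), e0, hk⟩
        simp [e3, Op.eval]
      | succ j ih =>
        intro i s' hij hk e0 e1 e2 e3
        have hiM : i < M := by omega
        have hFb : Fit w σ (f i :: i :: l) (d :: (d + 1) :: ρ) (d + 3) s' := by
          have := hF.keeps hk (show d ≤ d + 3 by omega)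
          refine ⟨this.le, this.reg, this.mem, ?_, this.reg_lt, this.mem_lt⟩
          rintro (_ | _ | j) hj
          · simp [e0]
          · simp [e1]
          · simpa using this.loc j (by simpa using hj)
        obtain ⟨s₃, a1, a2, a3⟩ := ihb _ _ _ _ (hb i hiM) hFb
        have mv : Raw G nbr w (.move d (d + 3)) ((Prog.move d (d + 3)).tb X) s₃
            ((s₃.set w d 0).set w d (Op.add.eval ((s₃.set w d 0).reg d)
              ((s₃.set w d 0).reg (d + 3)))) := (Raw.instr rfl).seq (Raw.instr rfl)
        have hv : Op.add.eval ((s₃.set w d 0).reg d) ((s₃.set w d 0).reg (d + 3)) = f (i + 1) := by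
          rw [State.set_reg_self _ _ (by omega), State.set_reg_of_ne _ _ (by omega), a2]
          simp [Op.eval, hf, iterate]
        have hfw : f (i + 1) < 2 ^ w := by
          have := a3.reg_lt (d + 3)
          rw [a2] at this
          exact this
        rw [hv] at mv
        set s₄ := (s₃.set w d 0).set w d (f (i + 1)) with hs₄
        have r4 : ∀ r ≠ d, s₄.reg r = s₃.reg r := fun r hr => by
          rw [hs₄, State.set_reg_of_ne _ _ hr, State.set_reg_of_ne _ _ hr]
        have r3 : ∀ r < d + 3, s₃.reg r = s'.reg r := a3.reg
        have k4 : Keeps w d s s₄ := ((hk.trans a3 (by omega)).set le_rfl _).set le_rfl _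
        set s₅ := s₄.set w (d + 3) 1 with hs₅
        set s₆ := s₅.set w (d + 1) (i + 1) with hs₆
        set s₇ := s₆.set w (d + 3) (Op.lt.eval (i + 1) M) with hs₇
        have k7 : Keeps w d s s₇ := ((k4.set (by omega) _).set (by omega) _).set (by omega) _
        have x5 : Raw G nbr w (.instr (.const (d + 3) 1)) 1 s₄ s₅ := Raw.instr rfl
        have x6 : Raw G nbr w (.instr (.op .add (d + 1) (d + 1) (d + 3))) 1 s₅ s₆ := by
          refine Raw.instr ?_
          have : Op.add.eval (s₅.reg (d + 1)) (s₅.reg (d + 3)) = i + 1 := by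
            rw [hs₅, State.set_reg_of_ne _ _ (by omega), State.set_reg_self _ _ hW,
              r4 _ (by omega), r3 _ (by omega), e1]
            rfl
          rw [exec, this]
        have m6 : s₆.reg (d + 2) = M := by
          rw [hs₆, State.set_reg_of_ne _ _ (by omega), hs₅, State.set_reg_of_ne _ _ (by omega),
            r4 _ (by omega), r3 _ (by omega), e2]
        have i6 : s₆.reg (d + 1) = i + 1 := by
          rw [hs₆, State.set_reg_self _ _ (by omega)]
        have x7 : Raw G nbr w (.instr (.op .lt (d + 3) (d + 1) (d + 2))) 1 s₆ s₇ := by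
          refine Raw.instr ?_
          rw [exec, m6, i6]
        have hbd : Raw G nbr w body (body.tb X) s' s₇ :=
          a1.seq (mv.seq (x5.seq (x6.seq x7)))
        obtain ⟨s'', c1, c2, c3⟩ := ih (i + 1) s₇ (by omega) k7
          (by rw [hs₇, State.set_reg_of_ne _ _ (by omega), hs₆, State.set_reg_of_ne _ _ (by omega),
              hs₅, State.set_reg_of_ne _ _ (by omega), hs₄, State.set_reg_self _ _ hfw])
          (by rw [hs₇, State.set_reg_of_ne _ _ (by omega), i6])
          (by rw [hs₇, State.set_reg_of_ne _ _ (by omega), m6])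
          (by rw [hs₇, State.set_reg_self _ _ (hlt _ _)])
        refine ⟨s'', (Raw.loop_step ?_ hbd c1).mono (by rw [Nat.succ_mul]; omega), c2, c3⟩
        simp [e3, Op.eval, hiM]
    set s₃ := s₂.set w (d + 1) 0 with hs₃
    set s₄ := s₃.set w (d + 3) (Op.lt.eval 0 M) with hs₄
    have x3 : Raw G nbr w (.instr (.const (d + 1) 0)) 1 s₂ s₃ := Raw.instr rfl
    have m3 : s₃.reg (d + 2) = M := by rw [hs₃, State.set_reg_of_ne _ _ (by omega), g2]
    have i3 : s₃.reg (d + 1) = 0 := by rw [hs₃, State.set_reg_self _ _ (by omega)]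
    have x4 : Raw G nbr w (.instr (.op .lt (d + 3) (d + 1) (d + 2))) 1 s₃ s₄ := by
      refine Raw.instr ?_
      rw [exec, m3, i3]
    obtain ⟨s'', c1, c2, c3⟩ := loop M 0 s₄ (by omega)
      ((k2.set (by omega) _).set (by omega) _)
      (by rw [hs₄, State.set_reg_of_ne _ _ (by omega), hs₃, State.set_reg_of_ne _ _ (by omega),
            g3.reg _ (by omega), h2]; rfl)
      (by rw [hs₄, State.set_reg_of_ne _ _ (by omega), i3])
      (by rw [hs₄, State.set_reg_of_ne _ _ (by omega), m3])
      (by rw [hs₄, State.set_reg_self _ _ (hlt _ _)])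
    refine ⟨s'', (h1.seq (g1.seq (x3.seq (x4.seq c1)))).mono ?_, c2, c3⟩
    -- The actual number `M` of rounds is replaced by its bound `X`, which is what `tb` charges for
    -- every loop.
    have : M * (1 + body.tb X) ≤ X * (1 + body.tb X) := Nat.mul_le_mul_right _ hX
    simp only [Expr.code, Prog.tb]
    simp only [hbody, Prog.tb] at this ⊢
    omega

end Raw

/-! ### Structured programs and their proof rules -/

namespace State

/-- Write a value to a register. -/
def upd (σ : State) (x v : ℕ) : State := { σ with reg := Function.update σ.reg x v }

/-- Write a value to memory. -/
def put (σ : State) (x v : ℕ) : State := { σ with mem := Function.update σ.mem x v }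

/-- Count `c` further queries. -/
def addq (σ : State) (c : ℕ) : State := { σ with queries := σ.queries + c }

@[simp] theorem upd_reg (σ : State) (x v y : ℕ) :
    (σ.upd x v).reg y = if y = x then v else σ.reg y := by
  simp [upd, Function.update_apply]
@[simp] theorem upd_mem (σ : State) (x v : ℕ) : (σ.upd x v).mem = σ.mem := rfl
@[simp] theorem upd_queries (σ : State) (x v : ℕ) : (σ.upd x v).queries = σ.queries := rfl
@[simp] theorem put_reg (σ : State) (x v : ℕ) : (σ.put x v).reg = σ.reg := rfl
@[simp] theorem put_mem (σ : State) (x v y : ℕ) :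
    (σ.put x v).mem y = if y = x then v else σ.mem y := by
  simp [put, Function.update_apply]
@[simp] theorem put_queries (σ : State) (x v : ℕ) : (σ.put x v).queries = σ.queries := rfl
@[simp] theorem addq_reg (σ : State) (c : ℕ) : (σ.addq c).reg = σ.reg := rfl
@[simp] theorem addq_mem (σ : State) (c : ℕ) : (σ.addq c).mem = σ.mem := rfl
@[simp] theorem addq_queries (σ : State) (c : ℕ) : (σ.addq c).queries = σ.queries + c := rfl

end State

namespace Prog

/-- `x := e` -/
def asg (x : ℕ) (e : Expr) : Prog := .seq (e.code numVars []) (.move x numVars)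

/-- `mem[e₁] := e₂` -/
def sto (e₁ e₂ : Expr) : Prog :=
  .seq (e₁.code numVars []) (.seq (e₂.code (numVars + 1) []) (.instr (.store numVars (numVars + 1))))

/-- `x :=` a random element of `{0, …, e - 1}` -/
def rnd (x : ℕ) (e : Expr) : Prog := .seq (e.code numVars []) (.instr (.rand x numVars))

/-- Branch on whether `e` is nonzero. -/
def ifc (e : Expr) (p q : Prog) : Prog := .seq (e.code numVars []) (.ite numVars p q)

/-- Loop while `e` is nonzero. -/
def whl (e : Expr) (p : Prog) : Prog :=
  .seq (e.code numVars []) (.loop numVars (.seq p (e.code numVars [])))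

/-- `for x = 0, …, e - 1` -/
def forc (x : ℕ) (e : Expr) (p : Prog) : Prog :=
  .seq (asg x (.lit 0)) (whl (.bin .lt (.var x) e) (.seq p (asg x (.bin .add (.var x) (.lit 1)))))

end Prog

/-- Run the `j` random stages `κ i, …, κ (i + j - 1)`, starting from `a`. -/
noncomputable def chain {α : Type} (κ : ℕ → α → PMF α) : ℕ → ℕ → α → PMF α
  | _, 0, a => PMF.pure a
  | i, j + 1, a => (κ i a).bind (chain κ (i + 1) j)

/-- `chain` is defined by splitting off the first stage; inductions that append to a list need the
last one. -/
theorem chain_succ {α : Type} (κ : ℕ → α → PMF α) (i j : ℕ) (a : α) :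
    chain κ i (j + 1) a = (chain κ i j a).bind (κ (i + j)) := by
  induction j generalizing i a with
  | zero => simp [chain, PMF.bind_pure]
  | succ j ih =>
    rw [chain, chain, PMF.bind_bind]
    congr 1
    funext b
    rw [ih, show i + 1 + j = i + (j + 1) by omega]

/-- There is only one distribution on `Unit`, so deterministic loops are the case `α = Unit` of the
rule for random loops. -/
theorem chain_pure (κ : ℕ → Unit → PMF Unit) (i j : ℕ) (a : Unit) :
    chain κ i j a = PMF.pure () := by
  ext
  have : ∀ p : PMF Unit, p () = 1 := fun p => by simpa using p.tsum_coe
  simp [this]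

section Rules

variable {n : ℕ} {G : SimpleGraph (Fin n)} [DecidableRel G.Adj]
  {nbr : ∀ v : Fin n, Fin (G.degree v) ≃ G.neighborSet v} {w : ℕ}

theorem Sim.refl {s : State} (h : ∀ r, s.reg r < 2 ^ w) (h' : ∀ x, s.mem x < 2 ^ w) :
    Sim w s s := ⟨fun _ _ => rfl, rfl, rfl, h, h'⟩

theorem Sim.fit {s σ : State} (h : Sim w s σ) : Fit w σ [] [] numVars s :=
  ⟨le_rfl, h.reg, h.mem, by simp, h.reg_lt, h.mem_lt⟩

theorem Sim.keeps {s s' σ : State} (h : Sim w s σ) {d : ℕ} (hd : numVars ≤ d)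
    (hk : Keeps w d s s') : Sim w s' σ :=
  ⟨fun r hr => (hk.reg r (hr.trans_le hd)).trans (h.reg r hr), hk.mem.trans h.mem,
    hk.queries.trans h.queries, hk.reg_lt, hk.mem_lt⟩

theorem Sim.set {s σ : State} (h : Sim w s σ) (x : ℕ) {v : ℕ} (hv : v < 2 ^ w) :
    Sim w (s.set w x v) (σ.upd x v) := by
  refine ⟨fun r hr => ?_, h.mem, h.queries, fun r => ?_, h.mem_lt⟩
  · rw [State.upd_reg]
    split
    next e => rw [e, State.set_reg_self _ _ hv]
    next e => rw [State.set_reg_of_ne _ _ e, h.reg r hr]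
  · by_cases e : r = x
    · rw [e, State.set_reg_self _ _ hv]; exact hv
    · rw [State.set_reg_of_ne _ _ e]; exact h.reg_lt r

theorem Sim.tick {s σ : State} (h : Sim w s σ) : Sim w s.tick (σ.addq 1) :=
  ⟨h.reg, h.mem, by simp [State.tick, h.queries], h.reg_lt, h.mem_lt⟩

namespace Tri

variable {α β : Type} {σ : State} {X : ℕ}

theorem of_raw {p : Prog} {t : ℕ} {a : α} {Q : α → State → Prop}
    (h : ∀ s, Sim w s σ → ∃ s' σ', Raw G nbr w p t s s' ∧ Sim w s' σ' ∧ Q a σ') :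
    Tri G nbr w p t σ (PMF.pure a) Q := by
  intro s hs K u β ν₂ R hK
  obtain ⟨s', σ', h1, h2, h3⟩ := h s hs
  rw [PMF.pure_bind]
  exact h1 K u β _ R (hK a s' σ' h2 h3)

theorem asg (hW : 1 < 2 ^ w) {x : ℕ} {e : Expr} {a : α} {Q : α → State → Prop}
    (hx : x < numVars) (he : e.Ok (2 ^ w) X σ []) (hQ : Q a (σ.upd x (e.eval σ []))) :
    Tri G nbr w (.asg x e) ((Prog.asg x e).tb X) σ (PMF.pure a) Q := by
  refine of_raw fun s hs => ?_
  obtain ⟨s₁, h1, h2, h3⟩ := e.code_spec (G := G) (nbr := nbr) hW X σ [] [] numVars s he hs.fit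
  have hs₁ := hs.keeps le_rfl h3
  have hv : e.eval σ [] < 2 ^ w := h2 ▸ h3.reg_lt _
  refine ⟨_, _, h1.seq ((Raw.instr rfl).seq (Raw.instr rfl)), ?_, hQ⟩
  have : Op.add.eval ((s₁.set w x 0).reg x) ((s₁.set w x 0).reg numVars) = e.eval σ [] := by
    rw [State.set_reg_self _ _ (by omega), State.set_reg_of_ne _ _ (by omega), h2]
    simp [Op.eval]
  rw [this]
  have := (hs₁.set x (v := 0) (by omega)).set x hv
  convert this using 1
  simp [State.upd]

theorem sto (hW : 1 < 2 ^ w) {e₁ e₂ : Expr} {a : α} {Q : α → State → Prop}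
    (h₁ : e₁.Ok (2 ^ w) X σ []) (h₂ : e₂.Ok (2 ^ w) X σ [])
    (hQ : Q a (σ.put (e₁.eval σ []) (e₂.eval σ []))) :
    Tri G nbr w (.sto e₁ e₂) ((Prog.sto e₁ e₂).tb X) σ (PMF.pure a) Q := by
  refine of_raw fun s hs => ?_
  obtain ⟨s₁, a1, a2, a3⟩ := e₁.code_spec (G := G) (nbr := nbr) hW X σ [] [] numVars s h₁ hs.fit
  obtain ⟨s₂, b1, b2, b3⟩ := e₂.code_spec (G := G) (nbr := nbr) hW X σ [] [] (numVars + 1) s₁ h₂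
    (hs.fit.keeps a3 (Nat.le_succ _))
  have hs₂ := hs.keeps le_rfl (a3.trans b3 (Nat.le_succ _))
  refine ⟨_, _, a1.seq (b1.seq (Raw.instr rfl)), ?_, hQ⟩
  have e1 : s₂.reg numVars = e₁.eval σ [] := (b3.reg _ (Nat.lt_succ_self _)).trans a2
  rw [e1, b2]
  refine ⟨hs₂.reg, ?_, hs₂.queries, hs₂.reg_lt, fun y => ?_⟩
  · simp [State.put, hs₂.mem]
  · simp only [Function.update_apply]
    split
    · rw [← b2]; exact b3.reg_lt _
    · exact hs₂.mem_lt y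

theorem rnd (hW : 1 < 2 ^ w) {x : ℕ} {e : Expr} {Q : ℕ → State → Prop}
    (he : e.Ok (2 ^ w) X σ [])
    (hne : (Finset.range (e.eval σ [])).Nonempty) (hQ : ∀ i < e.eval σ [], Q i (σ.upd x i)) :
    Tri G nbr w (.rnd x e) ((Prog.rnd x e).tb X) σ
      (PMF.uniformOfFinset (Finset.range (e.eval σ [])) hne) Q := by
  intro s hs K u β ν₂ R hK
  obtain ⟨s₁, h1, h2, h3⟩ := e.code_spec (G := G) (nbr := nbr) hW X σ [] [] numVars s he hs.fit
  have hs₁ := hs.keeps le_rfl h3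
  have hv : e.eval σ [] < 2 ^ w := h2 ▸ h3.reg_lt _
  have hI : exec G nbr w s₁ (.rand x numVars) =
      (PMF.uniformOfFinset (Finset.range (e.eval σ [])) hne).map (fun i => s₁.set w x i) := by
    simp only [exec, h2, hne, dite_true]
  have := HaltsWith.of_random (K := K) (u := u) (R := R) _ _ hI ν₂ fun i hi => by
    have hi' : i < e.eval σ [] := by simpa using hi
    exact hK i _ _ (hs₁.set x (hi'.trans hv)) (hQ i hi')
  have := h1 _ _ _ _ _ this
  exact (HaltsWith.of_step (K' := e.code numVars [] :: .instr (.rand x numVars) :: K) (s' := s) rfl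
    this).mono (by simp only [Prog.rnd, Prog.tb]; omega)

theorem ifc (hW : 1 < 2 ^ w) {e : Expr} {p q : Prog} {t u : ℕ} {ν : PMF α}
    {Q : α → State → Prop} (he : e.Ok (2 ^ w) X σ [])
    (hp : e.eval σ [] ≠ 0 → Tri G nbr w p t σ ν Q) (hq : e.eval σ [] = 0 → Tri G nbr w q u σ ν Q) :
    Tri G nbr w (.ifc e p q) (1 + (e.code numVars []).tb X + (1 + t + u)) σ ν Q := by
  intro s hs K v β ν₂ R hK
  obtain ⟨s₁, h1, h2, h3⟩ := e.code_spec (G := G) (nbr := nbr) hW X σ [] [] numVars s he hs.fit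
  have hs₁ := hs.keeps le_rfl h3
  have key : HaltsWith G nbr w (.ite numVars p q :: K) s₁ (1 + t + u + v) (ν.bind ν₂) R := by
    by_cases h0 : e.eval σ [] = 0
    · exact (HaltsWith.of_step (K' := q :: K) (s' := s₁) (by simp [step, h2, h0])
        (hq h0 s₁ hs₁ K v β ν₂ R hK)).mono (by omega)
    · exact (HaltsWith.of_step (K' := p :: K) (s' := s₁) (by simp [step, h2, h0])
        (hp h0 s₁ hs₁ K v β ν₂ R hK)).mono (by omega)
  have := h1 _ _ _ _ _ key
  exact (HaltsWith.of_step (K' := e.code numVars [] :: .ite numVars p q :: K) (s' := s) rfl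
    this).mono (by omega)

/-- The number `N` of rounds is fixed in advance even though the rounds are random: the invariant
has to decide the condition. This is why the result is a `chain` of length `N`. -/
theorem whl (hW : 1 < 2 ^ w) {e : Expr} {p : Prog} (N : ℕ) (t : ℕ → ℕ) (κ : ℕ → α → PMF α)
    (Inv : ℕ → α → State → Prop)
    (hstep : ∀ i < N, ∀ a σ, Inv i a σ → e.Ok (2 ^ w) X σ [] ∧ e.eval σ [] ≠ 0 ∧
      Tri G nbr w p (t i) σ (κ i a) (Inv (i + 1)))
    (hend : ∀ a σ, Inv N a σ → e.Ok (2 ^ w) X σ [] ∧ e.eval σ [] = 0) {a : α} (h0 : Inv 0 a σ) :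
    Tri G nbr w (.whl e p) (2 + (e.code numVars []).tb X +
      ∑ i ∈ Finset.range N, (2 + t i + (e.code numVars []).tb X)) σ (chain κ 0 N a) (Inv N) := by
  set c := (e.code numVars []).tb X with hc
  have hOk : ∀ i ≤ N, ∀ a σ, Inv i a σ → e.Ok (2 ^ w) X σ [] := by
    intro i hi a σ h
    rcases hi.lt_or_eq with h' | rfl
    · exact (hstep i h' a σ h).1
    · exact (hend a σ h).1
  -- At the head of the loop the condition has already been evaluated into register `numVars`,
  -- before the loop or at the end of the previous round.
  have loop : ∀ j i, i + j = N → ∀ a σ, Inv i a σ → ∀ s, Sim w s σ →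
      s.reg numVars = e.eval σ [] → ∀ (K : List Prog) (u : ℕ) (β : Type) (ν₂ : α → PMF β)
        (R : β → State → Prop),
        (∀ a s' σ', Sim w s' σ' → Inv N a σ' → HaltsWith G nbr w K s' u (ν₂ a) R) →
        HaltsWith G nbr w (.loop numVars (.seq p (e.code numVars [])) :: K) s
          (1 + ∑ i ∈ Finset.Ico i N, (2 + t i + c) + u) ((chain κ i j a).bind ν₂) R := by
    intro j
    induction j with
    | zero =>
      intro i hi a σ hI s hs hr K u β ν₂ R hK
      obtain rfl : i = N := by omega
      have h0 := (hend a σ hI).2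
      rw [chain, PMF.pure_bind]
      exact (HaltsWith.of_step (K' := K) (s' := s) (by simp [step, hr, h0])
        (hK a s σ hs hI)).mono (by simp)
    | succ j ih =>
      intro i hi a σ hI s hs hr K u β ν₂ R hK
      have hiN : i < N := by omega
      obtain ⟨-, h1, h2⟩ := hstep i hiN a σ hI
      rw [chain, PMF.bind_bind]
      have := h2 s hs (e.code numVars [] :: .loop numVars (.seq p (e.code numVars [])) :: K)
        (c + (1 + ∑ i ∈ Finset.Ico (i + 1) N, (2 + t i + c) + u)) β
        (fun b => (chain κ (i + 1) j b).bind ν₂) R (by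
          intro b s' σ' hs' hI'
          obtain ⟨s₁, g1, g2, g3⟩ := e.code_spec (G := G) (nbr := nbr) hW X σ' [] [] numVars s'
            (hOk (i + 1) (by omega) b σ' hI') hs'.fit
          exact g1 _ _ _ _ _ (ih (i + 1) (by omega) b σ' hI' s₁ (hs'.keeps le_rfl g3) g2
            K u β ν₂ R hK))
      have := HaltsWith.of_step (K := .seq p (e.code numVars []) ::
        .loop numVars (.seq p (e.code numVars [])) :: K) (s := s) rfl this
      have := HaltsWith.of_step (K := .loop numVars (.seq p (e.code numVars [])) :: K) (s := s)
        (by simp [step, hr, h1]) this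
      refine this.mono ?_
      rw [Finset.sum_eq_sum_Ico_succ_bot hiN]
      omega
  intro s hs K u β ν₂ R hK
  obtain ⟨s₁, g1, g2, g3⟩ := e.code_spec (G := G) (nbr := nbr) hW X σ [] [] numVars s
    (hOk 0 (Nat.zero_le _) a σ h0) hs.fit
  have := g1 _ _ _ _ _ (loop N 0 (by omega) a σ h0 s₁ (hs.keeps le_rfl g3) g2 K u β ν₂ R hK)
  refine (HaltsWith.of_step (K' := e.code numVars [] ::
    .loop numVars (.seq p (e.code numVars [])) :: K) (s' := s) rfl this).mono ?_
  rw [Finset.range_eq_Ico]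
  omega

/-- The rule for `for` loops with running time `t i` of the `i`-th round. -/
theorem forc (hW : 1 < 2 ^ w) {x : ℕ} {e : Expr} {p : Prog} (N : ℕ) (t : ℕ → ℕ)
    (κ : ℕ → α → PMF α) (Inv : ℕ → α → State → Prop) (hx : x < numVars) (hN : N < 2 ^ w)
    (hinv : ∀ i ≤ N, ∀ a σ, Inv i a σ → σ.reg x = i ∧ e.Ok (2 ^ w) X σ [] ∧ e.eval σ [] = N)
    (hstep : ∀ i < N, ∀ a σ, Inv i a σ → Tri G nbr w p (t i) σ (κ i a)
      fun b σ' => σ'.reg x = i ∧ Inv (i + 1) b (σ'.upd x (i + 1)))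
    {a : α} (h0 : Inv 0 a (σ.upd x 0)) :
    Tri G nbr w (.forc x e p) (1 + (Prog.asg x (.lit 0)).tb X +
      (2 + ((Expr.bin .lt (.var x) e).code numVars []).tb X +
      ∑ i ∈ Finset.range N, (2 + (1 + t i + (Prog.asg x (.bin .add (.var x) (.lit 1))).tb X) +
        ((Expr.bin .lt (.var x) e).code numVars []).tb X))) σ (chain κ 0 N a) (Inv N) := by
  refine Tri.seq_det (Q := fun _ σ' => Inv 0 a σ') (Tri.asg hW hx (show 0 < 2 ^ w by omega) h0) ?_
  intro σ' h0
  refine Tri.whl hW N _ κ Inv ?_ ?_ h0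
  · intro i hi a σ hI
    obtain ⟨h1, h2, h3⟩ := hinv i hi.le a σ hI
    refine ⟨⟨hx, h2, trivial⟩, ?_, ?_⟩
    · simp [Expr.eval, Op.eval, h1, h3, hi]
    · refine Tri.then_det (hstep i hi a σ hI) ?_
      rintro b σ' ⟨h4, h5⟩
      refine Tri.asg hW hx ⟨hx, ?_, ?_⟩ ?_
      · exact hW
      · simp only [Expr.eval, Op.Fits, h4]; omega
      · simpa [Expr.eval, Op.eval, h4] using h5
  · intro a σ hI
    obtain ⟨h1, h2, h3⟩ := hinv N le_rfl a σ hI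
    exact ⟨⟨hx, h2, trivial⟩, by simp [Expr.eval, Op.eval, h1, h3]⟩

/-- The rule for `for` loops with at most `X` rounds of constant time. -/
theorem forc_tb (hW : 1 < 2 ^ w) {x : ℕ} {e : Expr} {p : Prog} (N : ℕ)
    (κ : ℕ → α → PMF α) (Inv : ℕ → α → State → Prop) (hx : x < numVars) (hN : N < 2 ^ w)
    (hX : N ≤ X)
    (hinv : ∀ i ≤ N, ∀ a σ, Inv i a σ → σ.reg x = i ∧ e.Ok (2 ^ w) X σ [] ∧ e.eval σ [] = N)
    (hstep : ∀ i < N, ∀ a σ, Inv i a σ → Tri G nbr w p (p.tb X) σ (κ i a)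
      fun b σ' => σ'.reg x = i ∧ Inv (i + 1) b (σ'.upd x (i + 1)))
    {a : α} (h0 : Inv 0 a (σ.upd x 0)) :
    Tri G nbr w (.forc x e p) ((Prog.forc x e p).tb X) σ (chain κ 0 N a) (Inv N) := by
  refine (Tri.forc hW N (fun _ => p.tb X) κ Inv hx hN hinv hstep h0).mono ?_
  simp only [Finset.sum_const, Finset.card_range, smul_eq_mul, Prog.forc, Prog.whl, Prog.tb]
  refine (Nat.add_le_add_left (Nat.add_le_add_left (Nat.mul_le_mul_right _ hX) _) _).trans ?_
  have : ∀ a b : ℕ, a = b → X * a = X * b := fun a b h => by rw [h]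
  rw [this (2 + _ + _) (1 + (1 + (1 + p.tb X + (Prog.asg x (.bin .add (.var x) (.lit 1))).tb X) +
    ((Expr.bin .lt (.var x) e).code numVars []).tb X)) (by omega)]
  omega

/-- The rule for deterministic `for` loops with at most `X` rounds of constant time. -/
theorem forc_det (hW : 1 < 2 ^ w) {x : ℕ} {e : Expr} {p : Prog} (N : ℕ)
    (Inv : ℕ → State → Prop) (hx : x < numVars) (hN : N < 2 ^ w) (hX : N ≤ X)
    (hinv : ∀ i ≤ N, ∀ σ, Inv i σ → σ.reg x = i ∧ e.Ok (2 ^ w) X σ [] ∧ e.eval σ [] = N)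
    (hstep : ∀ i < N, ∀ σ, Inv i σ → Tri G nbr w p (p.tb X) σ (PMF.pure ())
      fun _ σ' => σ'.reg x = i ∧ Inv (i + 1) (σ'.upd x (i + 1)))
    (h0 : Inv 0 (σ.upd x 0)) :
    Tri G nbr w (.forc x e p) ((Prog.forc x e p).tb X) σ (PMF.pure ()) (fun _ => Inv N) := by
  have := Tri.forc_tb (G := G) (nbr := nbr) (α := Unit) hW N (fun _ _ => PMF.pure ())
    (fun i _ => Inv i) hx hN hX (fun i hi _ => hinv i hi) (fun i hi _ => hstep i hi) (a := ()) h0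
  rwa [chain_pure] at this

theorem degree {x y : ℕ} (hy : y < numVars) {a : α} {Q : α → State → Prop}
    (hv : degreeAnswer G (σ.reg y) < 2 ^ w)
    (hQ : Q a ((σ.addq 1).upd x (degreeAnswer G (σ.reg y)))) :
    Tri G nbr w (.instr (.degree x y)) 1 σ (PMF.pure a) Q := by
  refine of_raw fun s hs => ⟨_, _, Raw.instr rfl, ?_, hQ⟩
  rw [hs.reg y hy]
  exact hs.tick.set x hv

theorem neighbor {x y z : ℕ} (hy : y < numVars) (hz : z < numVars) {a : α}
    {Q : α → State → Prop} (hv : neighborAnswer G nbr (σ.reg y) (σ.reg z) < 2 ^ w)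
    (hQ : Q a ((σ.addq 1).upd x (neighborAnswer G nbr (σ.reg y) (σ.reg z)))) :
    Tri G nbr w (.instr (.neighbor x y z)) 1 σ (PMF.pure a) Q := by
  refine of_raw fun s hs => ⟨_, _, Raw.instr rfl, ?_, hQ⟩
  rw [hs.reg y hy, hs.reg z hz]
  exact hs.tick.set x hv

theorem pair {x y z : ℕ} (hy : y < numVars) (hz : z < numVars) {a : α}
    {Q : α → State → Prop} (hv : pairAnswer G (σ.reg y) (σ.reg z) < 2 ^ w)
    (hQ : Q a ((σ.addq 1).upd x (pairAnswer G (σ.reg y) (σ.reg z)))) :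
    Tri G nbr w (.instr (.pair x y z)) 1 σ (PMF.pure a) Q := by
  refine of_raw fun s hs => ⟨_, _, Raw.instr rfl, ?_, hQ⟩
  rw [hs.reg y hy, hs.reg z hz]
  exact hs.tick.set x hv

theorem edgeSample {x y : ℕ} (hn : n ≤ 2 ^ w) (hne : G.edgeFinset.Nonempty)
    {Q : Sym2 (Fin n) → State → Prop}
    (hQ : ∀ e ∈ G.edgeFinset, Q e (((σ.addq 1).upd x (e.inf : Fin n)).upd y (e.sup : Fin n))) :
    Tri G nbr w (.instr (.edgeSample x y)) 1 σ (PMF.uniformOfFinset G.edgeFinset hne) Q := by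
  intro s hs K u β ν₂ R hK
  have hI : exec G nbr w s (.edgeSample x y) = (PMF.uniformOfFinset G.edgeFinset hne).map
      (fun e => (s.tick.set w x (e.inf : Fin n)).set w y (e.sup : Fin n)) := by
    simp only [exec, hne, dite_true]
  exact HaltsWith.of_random (K := K) (u := u) (R := R) _ _ hI ν₂ fun e he =>
    hK e _ _ ((hs.tick.set x (e.inf.isLt.trans_le hn)).set y (e.sup.isLt.trans_le hn))
      (hQ e (by simpa using he))

end Tri
end Rules

/-! ### Fractional edge covers, duality and matchings -/

section EdgeCover

variable {V : Type*} [Fintype V] [DecidableEq V] (H : SimpleGraph V) [DecidableRel H.Adj]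

/-- `|V| + |S| - |N(S)|`, where `N(S)` is the set of vertices with a neighbor in `S`. -/
def excess (S : Finset V) : ℕ :=
  ∑ v, (1 + (if v ∈ S then 1 else 0) - (if ∃ u ∈ S, H.Adj v u then 1 else 0))

/-- The maximum of `|V| + |S| - |N(S)|` over all sets of vertices, which is twice the fractional
edge-cover number. -/
def coverNum : ℕ := (Finset.univ : Finset (Finset V)).sup (excess H)

theorem excess_le_coverNum (S : Finset V) : excess H S ≤ coverNum H :=
  Finset.le_sup (f := excess H) (Finset.mem_univ S)

/-- In each summand of `excess` at most 1 is subtracted from at least 1, so the subtraction is never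
truncated. -/
theorem excess_add_card (S : Finset V) :
    excess H S + (Finset.univ.filter fun v => ∃ u ∈ S, H.Adj v u).card
      = Fintype.card V + S.card := by
  have h : ∀ v : V, (1 + (if v ∈ S then 1 else 0) - (if ∃ u ∈ S, H.Adj v u then 1 else 0)) +
      (if ∃ u ∈ S, H.Adj v u then 1 else 0) = 1 + (if v ∈ S then 1 else 0) := by
    intro v
    split_ifs <;> omega
  rw [excess, Finset.card_filter, ← Finset.sum_add_distrib, Finset.sum_congr rfl fun v _ => h v,
    Finset.sum_add_distrib]
  simp

/-- The empty set has excess `|V|`. Hence the difference `coverNum H - |V|` used below is a true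
one. -/
theorem card_le_coverNum : Fintype.card V ≤ coverNum H := by
  have h := excess_add_card H ∅
  have h' := excess_le_coverNum H ∅
  simp at h
  omega

/-- Weak duality. For a set `S` of maximum excess, the weights `y v = (1 + [v ∈ S] - [v ∈ N(S)]) /
2` are nonnegative and sum to at most 1 on each edge, since a neighbor of a vertex in `S` lies in
`N(S)`. Pairing `y` with a fractional cover `x` bounds `∑ y` by `∑ x`. The opposite inequality is
not needed. -/
theorem coverNum_div_two_le (hH : ∀ v, 0 < H.degree v) :
    (coverNum H : ℝ) / 2 ≤ fracEdgeCover H := by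
  obtain ⟨S, -, hS⟩ := Finset.exists_mem_eq_sup (Finset.univ : Finset (Finset V))
    Finset.univ_nonempty (excess H)
  -- The constant weight 1 is a cover because no vertex is isolated, so the infimum is taken over a
  -- nonempty set.
  refine le_csInf ⟨_, fun _ => 1, fun _ _ => by norm_num, fun v => ?_, rfl⟩ ?_
  · simp only [Finset.sum_const, nsmul_eq_mul, mul_one, SimpleGraph.card_incidenceFinset_eq_degree]
    exact_mod_cast hH v
  rintro r ⟨x, hx, hcov, rfl⟩
  set y : V → ℝ := fun v =>
    (1 + (if v ∈ S then 1 else 0) - (if ∃ u ∈ S, H.Adj v u then 1 else 0)) / 2 with hy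
  have hy0 : ∀ v, 0 ≤ y v := by
    intro v
    simp only [hy]
    split_ifs <;> norm_num
  have hedge : ∀ u v, H.Adj u v → y u + y v ≤ 1 := by
    intro u v huv
    have h1 : (if v ∈ S then (1 : ℝ) else 0) ≤ if ∃ z ∈ S, H.Adj u z then 1 else 0 := by
      by_cases hv : v ∈ S
      · rw [if_pos hv, if_pos ⟨v, hv, huv⟩]
      · rw [if_neg hv]; split_ifs <;> norm_num
    have h2 : (if u ∈ S then (1 : ℝ) else 0) ≤ if ∃ z ∈ S, H.Adj v z then 1 else 0 := by
      by_cases hv : u ∈ S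
      · rw [if_pos hv, if_pos ⟨u, hv, huv.symm⟩]
      · rw [if_neg hv]; split_ifs <;> norm_num
    simp only [hy]
    linarith
  have hsum : (coverNum H : ℝ) / 2 = ∑ v, y v := by
    rw [coverNum, hS, excess, ← Finset.sum_div]
    push_cast
    congr 1
    refine Finset.sum_congr rfl fun v _ => ?_
    split_ifs <;> norm_num
  rw [hsum]
  calc ∑ v, y v ≤ ∑ v, y v * ∑ e ∈ H.incidenceFinset v, x e :=
        Finset.sum_le_sum fun v _ => le_mul_of_one_le_right (hy0 v) (hcov v)
    _ = ∑ v, ∑ e ∈ H.incidenceFinset v, y v * x e := by simp_rw [Finset.mul_sum]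
    _ = ∑ e ∈ H.edgeFinset, ∑ v with v ∈ e, y v * x e := by
        refine Finset.sum_comm' fun v e => ?_
        simp [SimpleGraph.incidenceFinset_eq_filter, and_comm]
    _ ≤ ∑ e ∈ H.edgeFinset, x e := by
        refine Finset.sum_le_sum fun e he => ?_
        have h0 := (hx e he).1
        induction e with
        | _ u v =>
          have huv : H.Adj u v := by simpa using he
          have : (Finset.univ.filter fun z => z ∈ s(u, v)) = {u, v} := by
            ext z; simp
          rw [this, Finset.sum_pair huv.ne, ← add_mul]
          exact mul_le_of_le_one_left h0 (hedge u v huv)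

/-- Weights that are large on edges have a large product. -/
theorem one_le_prod_sq_mul_pow_coverNum {Z : ℝ} (hZ : 1 ≤ Z) (Q : V → ℝ)
    (hQ : ∀ v, 1 ≤ Z * Q v) (hadj : ∀ u v, H.Adj u v → 1 ≤ Z * (Q u * Q v)) :
    1 ≤ (∏ v, Q v) ^ 2 * Z ^ coverNum H := by
  have hk := card_le_coverNum H
  have hZ0 : 0 < Z := by linarith
  -- `r` dummy partners are added to the neighborhood of every vertex. As `r ≥ |S| - |N(S)|` for all
  -- `S`, Hall's condition holds, and at most `r` vertices are matched to dummies.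
  set r := coverNum H - Fintype.card V with hr
  let t : V → Finset (V ⊕ Fin r) := fun v =>
    (Finset.univ.filter fun u => H.Adj v u).disjSum Finset.univ
  have hall : ∀ S : Finset V, S.card ≤ (S.biUnion t).card := by
    intro S
    rcases S.eq_empty_or_nonempty with rfl | ⟨v₀, hv₀⟩
    · simp
    have hsub : (Finset.univ.filter fun v => ∃ u ∈ S, H.Adj v u).disjSum
        (Finset.univ : Finset (Fin r)) ⊆ S.biUnion t := by
      intro y hy
      rw [Finset.mem_biUnion]
      rcases y with v | i
      · obtain ⟨u, hu, huv⟩ : ∃ u ∈ S, H.Adj v u := by simpa using hy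
        exact ⟨u, hu, by simpa [t] using huv.symm⟩
      · exact ⟨v₀, hv₀, by simp [t]⟩
    refine le_trans ?_ (Finset.card_le_card hsub)
    rw [Finset.card_disjSum, Finset.card_univ, Fintype.card_fin]
    have h1 := excess_add_card H S
    have h2 := excess_le_coverNum H S
    omega
  obtain ⟨f, hf, hft⟩ := (Finset.all_card_le_biUnion_card_iff_exists_injective t).1 hall
  set A : Finset V := Finset.univ.filter fun v => ∃ u, f v = Sum.inl u with hA
  have hcard : Fintype.card V ≤ A.card + r := by
    have h1 : (Finset.univ.filter fun v => ¬ ∃ u, f v = Sum.inl u).card ≤ r := by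
      have : ∀ v ∈ Finset.univ.filter fun v => ¬ ∃ u, f v = Sum.inl u,
          f v ∈ (Finset.univ : Finset (Fin r)).map ⟨Sum.inr, Sum.inr_injective⟩ := by
        intro v hv
        rcases hfv : f v with u | i
        · simp [hfv] at hv
        · simp
      have := Finset.card_le_card_of_injOn f this hf.injOn
      simpa using this
    have h2 := Finset.card_filter_add_card_filter_not (s := (Finset.univ : Finset V))
      (fun v => ∃ u, f v = Sum.inl u)
    rw [Finset.card_univ] at h2
    rw [hA]
    omega
  let g : V → V := fun v => Sum.elim id (fun _ => v) (f v)
  have hg : ∀ v ∈ A, f v = Sum.inl (g v) := by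
    intro v hv
    obtain ⟨u, hu⟩ := (Finset.mem_filter.1 hv).2
    simp [g, hu]
  have hginj : Set.InjOn g A := by
    intro v hv v' hv' h
    exact hf ((hg v hv).trans ((congrArg Sum.inl h).trans (hg v' hv').symm))
  have hgadj : ∀ v ∈ A, H.Adj v (g v) := by
    intro v hv
    have := hft v
    rw [hg v hv] at this
    simpa [t] using this
  -- For a matched vertex `v` with partner `g v`, the product of `Z * Q v` and `Z * Q (g v)` is at
  -- least `Z`. Both `A` and `g(A)` are sets without repetition, and all factors outside of them are
  -- at least 1, so each of the two products can be extended to all vertices.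
  have hpair : Z ^ A.card ≤ (∏ v, Z * Q v) ^ 2 := by
    calc Z ^ A.card = ∏ _v ∈ A, Z := by simp
      _ ≤ ∏ v ∈ A, (Z * Q v) * (Z * Q (g v)) := by
          refine Finset.prod_le_prod (fun _ _ => hZ0.le) fun v hv => ?_
          have := hadj v (g v) (hgadj v hv)
          nlinarith
      _ = (∏ v ∈ A, Z * Q v) * ∏ v ∈ A.image g, Z * Q v := by
          rw [Finset.prod_mul_distrib, Finset.prod_image hginj]
      _ ≤ (∏ v, Z * Q v) * ∏ v, Z * Q v := by
          have h : ∀ B : Finset V, 0 ≤ ∏ v ∈ B, Z * Q v := fun B =>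
            Finset.prod_nonneg fun v _ => by linarith [hQ v]
          refine mul_le_mul ?_ ?_ (h _) (h _)
          · exact Finset.prod_le_prod_of_subset_of_one_le (Finset.subset_univ _)
              (fun v _ => by linarith [hQ v]) fun v _ _ => hQ v
          · exact Finset.prod_le_prod_of_subset_of_one_le (Finset.subset_univ _)
              (fun v _ => by linarith [hQ v]) fun v _ _ => hQ v
      _ = _ := by ring
  -- At least `|V| - r` vertices are matched to true neighbors, and `r = coverNum H - |V|`.
  have hexp : Z ^ (2 * Fintype.card V) ≤ Z ^ (A.card + coverNum H) :=
    pow_le_pow_right₀ hZ (by omega)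
  rw [Finset.prod_mul_distrib, Finset.prod_const, Finset.card_univ] at hpair
  have hpos : 0 < Z ^ (2 * Fintype.card V) := by positivity
  have : Z ^ (2 * Fintype.card V) * 1 ≤
      Z ^ (2 * Fintype.card V) * ((∏ v, Q v) ^ 2 * Z ^ coverNum H) := by
    calc _ ≤ Z ^ A.card * Z ^ coverNum H := by rw [mul_one, ← pow_add]; exact hexp
      _ ≤ (Z ^ Fintype.card V * ∏ v, Q v) ^ 2 * Z ^ coverNum H :=
          mul_le_mul_of_nonneg_right hpair (by positivity)
      _ = _ := by ring
  exact le_of_mul_le_mul_left this hpos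

end EdgeCover

/-! ### Labelled copies and automorphisms -/

section Copies

variable {V W : Type*} [Fintype V] [Fintype W] [DecidableEq V] [DecidableEq W]

/-- The labelled copies of `H` in `G`, as functions. -/
def embeddings (H : SimpleGraph W) (G : SimpleGraph V) [DecidableRel H.Adj] [DecidableRel G.Adj] :
    Finset (W → V) :=
  Finset.univ.filter fun f => Function.Injective f ∧ ∀ a b, H.Adj a b → G.Adj (f a) (f b)

/-- The automorphisms of `H`, as functions. -/
def automorphisms (H : SimpleGraph W) [DecidableRel H.Adj] : Finset (W → W) :=
  Finset.univ.filter fun f => Function.Injective f ∧ ∀ a b, H.Adj a b ↔ H.Adj (f a) (f b)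

/-- Two embeddings with the same image subgraph differ by a unique automorphism of `H`, so every
fibre of the map from embeddings to subgraphs has `|Aut H|` elements. -/
theorem card_embeddings (H : SimpleGraph W) (G : SimpleGraph V) [DecidableRel H.Adj]
    [DecidableRel G.Adj] :
    (embeddings H G).card = G.copyCount H * (automorphisms H).card := by
  classical
  have hcopy : (embeddings H G).card = (Finset.univ : Finset (H.Copy G)).card := by
    symm
    refine Finset.card_bij (fun f _ => f) (fun f _ => ?_) (fun f _ g _ h => ?_) fun f hf => ?_
    · simp only [embeddings, Finset.mem_filter, Finset.mem_univ, true_and]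
      exact ⟨f.injective, fun a b h => f.toHom.map_adj h⟩
    · exact DFunLike.coe_injective h
    · simp only [embeddings, Finset.mem_filter, Finset.mem_univ, true_and] at hf
      exact ⟨⟨⟨f, fun {a b} h => hf.2 a b h⟩, hf.1⟩, Finset.mem_univ _, rfl⟩
  rw [hcopy, SimpleGraph.copyCount_eq_card_image_copyToSubgraph,
    Finset.card_eq_sum_card_image SimpleGraph.Copy.toSubgraph, ← smul_eq_mul, ← Finset.sum_const]
  refine Finset.sum_congr rfl fun G' hG' => ?_
  obtain ⟨f₀, -, rfl⟩ := Finset.mem_image.1 hG'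
  have hinj₀ : Function.Injective f₀ := f₀.injective
  have hadj : ∀ f : H.Copy G, ∀ a b, f.toSubgraph.Adj (f a) (f b) ↔ H.Adj a b := by
    intro f a b
    have hinj : Function.Injective f := f.injective
    simp [SimpleGraph.Copy.toSubgraph, Relation.Map, hinj.eq_iff]
  have hverts : ∀ f : H.Copy G, f.toSubgraph.verts = Set.range f := by
    intro f
    simp [SimpleGraph.Copy.toSubgraph]
  symm
  -- The fibre of `f₀` is parametrized by `σ ↦ f₀ ∘ σ`.
  refine Finset.card_bij (fun σ hσ => (⟨⟨f₀ ∘ σ, fun {a b} h => ?_⟩, ?_⟩ : H.Copy G)) ?_ ?_ ?_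
  · simp only [automorphisms, Finset.mem_filter, Finset.mem_univ, true_and] at hσ
    exact f₀.toHom.map_adj ((hσ.2 a b).1 h)
  · simp only [automorphisms, Finset.mem_filter, Finset.mem_univ, true_and] at hσ
    exact hinj₀.comp hσ.1
  · intro σ hσ
    simp only [automorphisms, Finset.mem_filter, Finset.mem_univ, true_and] at hσ
    have hsurj : Function.Surjective σ := Finite.surjective_of_injective hσ.1
    simp only [Finset.mem_filter, Finset.mem_univ, true_and]
    refine SimpleGraph.Subgraph.ext ?_ ?_
    · rw [hverts, hverts]
      exact hsurj.range_comp f₀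
    · funext x y
      simp only [SimpleGraph.Copy.toSubgraph, SimpleGraph.Subgraph.map_adj,
        SimpleGraph.Subgraph.top_adj, Relation.Map, eq_iff_iff]
      constructor
      · rintro ⟨a, b, h, rfl, rfl⟩
        exact ⟨σ a, σ b, (hσ.2 a b).1 h, rfl, rfl⟩
      · rintro ⟨a, b, h, rfl, rfl⟩
        obtain ⟨a, rfl⟩ := hsurj a
        obtain ⟨b, rfl⟩ := hsurj b
        exact ⟨a, b, (hσ.2 a b).2 h, rfl, rfl⟩
  · intro σ _ τ _ h
    have : f₀ ∘ σ = f₀ ∘ τ := congrArg (fun f : H.Copy G => (f : W → V)) h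
    exact hinj₀.comp_left this
  · intro f hf
    simp only [Finset.mem_filter, Finset.mem_univ, true_and] at hf
    -- Both copies have the same vertex set, so `f` factors through `f₀`; the factor `σ` is an
    -- automorphism because both also have the same edges.
    have hex : ∀ a, ∃ b, f₀ b = f a := by
      intro a
      have : f a ∈ f.toSubgraph.verts := by rw [hverts]; exact ⟨a, rfl⟩
      rw [hf, hverts] at this
      exact this
    choose σ hσ using hex
    refine ⟨σ, ?_, ?_⟩
    · simp only [automorphisms, Finset.mem_filter, Finset.mem_univ, true_and]
      refine ⟨fun a b h => ?_, fun a b => ?_⟩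
      · have : f a = f b := by rw [← hσ a, ← hσ b, h]
        exact f.injective this
      · rw [← hadj f, ← hadj f₀, hf, hσ, hσ]
    · ext a
      exact hσ a

end Copies

/-! ### Expectations and a Chernoff bound -/

open scoped ENNReal

/-- The law of total expectation, where the expectation of `g` is written as a sum over all
outcomes. -/
theorem tsum_bind_mul {α β : Type} (p : PMF α) (f : α → PMF β) (g : β → ℝ≥0∞) :
    ∑' b, p.bind f b * g b = ∑' a, p a * ∑' b, f a b * g b := by
  simp_rw [PMF.bind_apply, ← ENNReal.tsum_mul_right, ← ENNReal.tsum_mul_left]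
  rw [ENNReal.tsum_comm]
  simp_rw [mul_assoc]

theorem tsum_pure_mul {α : Type} (a : α) (g : α → ℝ≥0∞) : ∑' b, PMF.pure a b * g b = g a := by
  rw [tsum_eq_single a fun b hb => by simp [PMF.pure_apply, hb]]
  simp

theorem tsum_map_mul {α β : Type} (p : PMF α) (f : α → β) (g : β → ℝ≥0∞) :
    ∑' b, p.map f b * g b = ∑' a, p a * g (f a) := by
  rw [PMF.map, tsum_bind_mul]
  simp_rw [Function.comp_apply, tsum_pure_mul]

/-- The number of successes in `N` independent trials. -/
noncomputable def successes (τ : PMF Bool) (N : ℕ) : PMF ℕ :=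
  chain (fun _ c => τ.map fun b => c + b.toNat) 0 N 0

theorem apply_false_add_apply_true (τ : PMF Bool) : τ false + τ true = 1 := by
  have := τ.tsum_coe
  rwa [tsum_bool] at this

/-- The moment generating function of a binomial variable. The start values `i` and `a` are general
for the sake of the induction over the first stage. -/
theorem tsum_successes_mul_exp (τ : PMF Bool) (l : ℝ) (N i a : ℕ) :
    ∑' c, chain (fun _ c => τ.map fun b => c + b.toNat) i N a c * ENNReal.ofReal (Real.exp (l * c))
      = ENNReal.ofReal (Real.exp (l * a) *
          (1 + (τ true).toReal * (Real.exp l - 1)) ^ N) := by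
  have h1 : τ true ≤ 1 := τ.coe_le_one _
  have ht : τ true ≠ ∞ := ne_top_of_le_ne_top ENNReal.one_ne_top h1
  have hf : τ false ≠ ∞ := ne_top_of_le_ne_top ENNReal.one_ne_top (τ.coe_le_one _)
  have hsum : (τ false).toReal = 1 - (τ true).toReal := by
    have := congrArg ENNReal.toReal (apply_false_add_apply_true τ)
    rw [ENNReal.toReal_add hf ht, ENNReal.toReal_one] at this
    linarith
  have hB : 0 ≤ 1 + (τ true).toReal * (Real.exp l - 1) := by
    have : (0 : ℝ) ≤ (τ false).toReal := ENNReal.toReal_nonneg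
    have := mul_nonneg (ENNReal.toReal_nonneg (a := τ true)) (Real.exp_nonneg l)
    linarith
  induction N generalizing i a with
  | zero => simp [chain]
  | succ N ih =>
    rw [chain, tsum_bind_mul]
    simp_rw [ih]
    rw [tsum_map_mul, tsum_bool]
    rw [← ENNReal.ofReal_toReal hf, ← ENNReal.ofReal_toReal ht, hsum,
      ← ENNReal.ofReal_mul (by rw [← hsum]; exact ENNReal.toReal_nonneg),
      ← ENNReal.ofReal_mul ENNReal.toReal_nonneg, ← ENNReal.ofReal_add]
    · rw [ENNReal.toReal_ofReal ENNReal.toReal_nonneg]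
      congr 1
      simp only [Bool.toNat_false, Bool.toNat_true, Nat.cast_add, Nat.cast_one, Nat.add_zero,
        mul_add, mul_one, Real.exp_add]
      ring
    · exact mul_nonneg (by rw [← hsum]; exact ENNReal.toReal_nonneg)
        (mul_nonneg (Real.exp_nonneg _)
          (pow_nonneg (by rwa [ENNReal.toReal_ofReal ENNReal.toReal_nonneg]) _))
    · exact mul_nonneg ENNReal.toReal_nonneg (mul_nonneg (Real.exp_nonneg _)
          (pow_nonneg (by rwa [ENNReal.toReal_ofReal ENNReal.toReal_nonneg]) _))

/-- Markov's inequality for `exp (l * c - θ)`, together with `exp l - 1 ≤ l + l ^ 2` for `|l| ≤ 1`.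
Positive `l` serves for the upper tail and negative `l` for the lower one. -/
theorem toOuterMeasure_successes_le (τ : PMF Bool) (N : ℕ) {l θ : ℝ} (hl : |l| ≤ 1) (S : Set ℕ)
    (hS : ∀ c ∈ S, θ ≤ l * c) :
    (successes τ N).toOuterMeasure S ≤
      ENNReal.ofReal (Real.exp (N * (τ true).toReal * (l + l ^ 2) - θ)) := by
  set p := (τ true).toReal with hp
  have hp0 : 0 ≤ p := ENNReal.toReal_nonneg
  have hp1 : p ≤ 1 := by
    have := ENNReal.toReal_mono ENNReal.one_ne_top (τ.coe_le_one true)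
    simpa using this
  have hB : (1 + p * (Real.exp l - 1)) ^ N ≤ Real.exp (N * p * (l + l ^ 2)) := by
    have h1 : Real.exp l - 1 ≤ l + l ^ 2 := by
      have := (abs_le.1 (Real.abs_exp_sub_one_sub_id_le hl)).2
      linarith
    have h2 : 1 + p * (Real.exp l - 1) ≤ Real.exp (p * (l + l ^ 2)) := by
      have := Real.add_one_le_exp (p * (l + l ^ 2))
      nlinarith
    have h0 : 0 ≤ 1 + p * (Real.exp l - 1) := by
      nlinarith [Real.exp_nonneg l]
    calc _ ≤ Real.exp (p * (l + l ^ 2)) ^ N := pow_le_pow_left₀ h0 h2 N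
      _ = _ := by rw [← Real.exp_nat_mul]; ring_nf
  rw [PMF.toOuterMeasure_apply]
  calc ∑' c, S.indicator (⇑(successes τ N)) c
      ≤ ∑' c, successes τ N c * (ENNReal.ofReal (Real.exp (l * c)) *
          ENNReal.ofReal (Real.exp (-θ))) := by
        refine ENNReal.tsum_le_tsum fun c => ?_
        by_cases hc : c ∈ S
        · rw [Set.indicator_of_mem hc, ← ENNReal.ofReal_mul (Real.exp_nonneg _), ← Real.exp_add]
          refine le_mul_of_one_le_right zero_le ?_
          rw [ENNReal.one_le_ofReal, Real.one_le_exp_iff]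
          linarith [hS c hc]
        · rw [Set.indicator_of_notMem hc]; exact zero_le
    _ = ENNReal.ofReal ((1 + p * (Real.exp l - 1)) ^ N) * ENNReal.ofReal (Real.exp (-θ)) := by
        simp_rw [← mul_assoc]
        rw [ENNReal.tsum_mul_right, successes, tsum_successes_mul_exp]
        simp [hp]
    _ ≤ _ := by
        rw [sub_eq_add_neg _ θ, Real.exp_add, ENNReal.ofReal_mul (Real.exp_nonneg _)]
        gcongr

/-- A Chernoff bound. -/
theorem one_sub_le_toOuterMeasure_successes (τ : PMF Bool) (N : ℕ) {ε : ℝ} (h0 : 0 < ε)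
    (h1 : ε < 1) :
    1 - 2 * Real.exp (-(N * (τ true).toReal * ε ^ 2 / 4)) ≤
      ((successes τ N).toOuterMeasure {c | (1 - ε) * (N * (τ true).toReal) ≤ c ∧
        (c : ℝ) ≤ (1 + ε) * (N * (τ true).toReal)}).toReal := by
  set μ := N * (τ true).toReal with hμ
  set A : Set ℕ := {c | (1 - ε) * μ ≤ c ∧ (c : ℝ) ≤ (1 + ε) * μ} with hA
  set U : Set ℕ := {c | (1 + ε) * μ < c} with hU
  set L : Set ℕ := {c | (c : ℝ) < (1 - ε) * μ} with hL
  -- With `l = ±ε / 2` the exponents of both tails become `-μ * ε ^ 2 / 4`.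
  have hUb := toOuterMeasure_successes_le τ N (l := ε / 2) (θ := ε / 2 * ((1 + ε) * μ))
    (by rw [abs_of_pos] <;> linarith) U fun c hc => by
      have : (1 + ε) * μ < c := hc
      nlinarith
  have hLb := toOuterMeasure_successes_le τ N (l := -(ε / 2)) (θ := -(ε / 2) * ((1 - ε) * μ))
    (by rw [abs_neg, abs_of_pos] <;> linarith) L fun c hc => by
      have : (c : ℝ) < (1 - ε) * μ := hc
      nlinarith
  rw [← hμ] at hUb hLb
  rw [show μ * (ε / 2 + (ε / 2) ^ 2) - ε / 2 * ((1 + ε) * μ) = -(μ * ε ^ 2 / 4) by ring] at hUb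
  rw [show μ * (-(ε / 2) + (-(ε / 2)) ^ 2) - -(ε / 2) * ((1 - ε) * μ) = -(μ * ε ^ 2 / 4) by ring]
    at hLb
  set P := (successes τ N).toOuterMeasure with hP
  have huniv : P Set.univ = 1 := by
    rw [hP, PMF.toOuterMeasure_apply, Set.indicator_univ]
    exact (successes τ N).tsum_coe
  have hcov : (Set.univ : Set ℕ) ⊆ A ∪ (U ∪ L) := by
    intro c _
    by_cases hc : (1 + ε) * μ < c
    · exact Or.inr (Or.inl hc)
    by_cases hc' : (c : ℝ) < (1 - ε) * μ
    · exact Or.inr (Or.inr hc')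
    · exact Or.inl ⟨not_lt.1 hc', not_lt.1 hc⟩
  have hAtop : P A ≠ ∞ := by
    refine ne_top_of_le_ne_top ENNReal.one_ne_top ?_
    rw [← huniv]
    exact P.mono (Set.subset_univ _)
  have h : (1 : ℝ≥0∞) ≤ P A + (ENNReal.ofReal (Real.exp (-(μ * ε ^ 2 / 4))) +
      ENNReal.ofReal (Real.exp (-(μ * ε ^ 2 / 4)))) := by
    rw [← huniv]
    calc P Set.univ ≤ P (A ∪ (U ∪ L)) := P.mono hcov
      _ ≤ P A + P (U ∪ L) := MeasureTheory.measure_union_le _ _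
      _ ≤ P A + (P U + P L) := by gcongr; exact MeasureTheory.measure_union_le _ _
      _ ≤ _ := by gcongr
  have := ENNReal.toReal_mono (by simp [hAtop]) h
  rw [ENNReal.toReal_add hAtop (by simp), ENNReal.toReal_add (by simp) (by simp),
    ENNReal.toReal_ofReal (Real.exp_nonneg _), ENNReal.toReal_one] at this
  linarith

/-! ### The random map and its distribution -/

open scoped ENNReal

section Sampler

variable {n k : ℕ} (G : SimpleGraph (Fin n)) [DecidableRel G.Adj]
  (nbr : ∀ v : Fin n, Fin (G.degree v) ≃ G.neighborSet v)
  (H : SimpleGraph (Fin k)) [DecidableRel H.Adj]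

/-- A uniformly random endpoint of a uniformly random edge. -/
noncomputable def vertexDist (hE : G.edgeFinset.Nonempty) : PMF ℕ :=
  (PMF.uniformOfFinset G.edgeFinset hE).bind fun e =>
    (PMF.uniformOfFinset (Finset.range 2) (by simp)).map fun b =>
      if b = 0 then ((e.inf : Fin n) : ℕ) else ((e.sup : Fin n) : ℕ)

/-- A uniformly random neighbor of `u`. -/
noncomputable def neighborDist (u : ℕ) : PMF ℕ :=
  if h : (Finset.range (degreeAnswer G u)).Nonempty then
    (PMF.uniformOfFinset _ h).map (neighborAnswer G nbr u)
  else PMF.pure 0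

/-- The choice of the image of vertex `i`, when `l` lists the images of `0, …, i - 1`. -/
noncomputable def stage (hE : G.edgeFinset.Nonempty) (hk : (Finset.range k).Nonempty) (i : ℕ)
    (l : List ℕ) : PMF ℕ :=
  (PMF.uniformOfFinset (Finset.range k) hk).bind fun j =>
    if j < i ∧ pairAnswer H i j ≠ 0 then neighborDist G nbr (l.getD j 0) else vertexDist G hE

/-- A random map from the vertices of `H` to the vertices of `G`, as a list. -/
noncomputable def sampler (hE : G.edgeFinset.Nonempty) (hk : (Finset.range k).Nonempty) :
    PMF (List ℕ) :=
  chain (fun i l => (stage G nbr H hE hk i l).map fun v => l ++ [v]) 0 k []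

/-- Twice the number of edges, times the product of the degrees of the vertices in `l`. -/
def commonDenom (l : List ℕ) : ℕ :=
  2 * G.edgeFinset.card * ∏ j ∈ Finset.range k, degreeAnswer G (l.getD j 0)

/-- `k * commonDenom` times the probability that vertex `i` is mapped to its image in `l`. -/
def stageNum (l : List ℕ) (i : ℕ) : ℕ :=
  ∑ j ∈ Finset.range k, if j < i ∧ pairAnswer H i j ≠ 0 then
    commonDenom (k := k) G l / degreeAnswer G (l.getD j 0)
  else commonDenom (k := k) G l / (2 * G.edgeFinset.card) * degreeAnswer G (l.getD i 0)

/-- The number of reasons why `l` does not describe a labelled copy of `H`. -/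
def violations (l : List ℕ) : ℕ :=
  ∑ t ∈ Finset.range (k * k),
    ((1 - pairAnswer G (l.getD (t / k) 0) (l.getD (t % k) 0)) * pairAnswer H (t / k) (t % k) +
      (1 - if t / k = t % k then 1 else 0) * if l.getD (t / k) 0 = l.getD (t % k) 0 then 1 else 0)

/-- The decision whether the map `l` is accepted. -/
noncomputable def acceptance (A : ℕ) (l : List ℕ) : PMF Bool :=
  if h : (Finset.range (A * ∏ i ∈ Finset.range k, stageNum G H l i)).Nonempty then
    (PMF.uniformOfFinset _ h).map fun x =>
      decide (violations G H l = 0 ∧ x < commonDenom (k := k) G l ^ k)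
  else PMF.pure false

/-- One trial. -/
noncomputable def trialDist (hE : G.edgeFinset.Nonempty) (hk : (Finset.range k).Nonempty)
    (A : ℕ) : PMF Bool :=
  (sampler G nbr H hE hk).bind (acceptance G H A)

variable {G nbr H}

theorem pairAnswer_fin (u v : Fin n) : pairAnswer G u v = if G.Adj u v then 1 else 0 := by
  simp [pairAnswer]

theorem degreeAnswer_fin (v : Fin n) : degreeAnswer G v = G.degree v := by
  simp [degreeAnswer]

theorem pairAnswer_le_one (u v : ℕ) : pairAnswer G u v ≤ 1 := by
  unfold pairAnswer
  split_ifs <;> omega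

theorem lt_of_pairAnswer_ne_zero {u v : ℕ} (h : pairAnswer G u v ≠ 0) : u < n ∧ v < n := by
  by_contra hc
  simp [pairAnswer, hc] at h

theorem degreeAnswer_le (v : ℕ) : degreeAnswer G v ≤ n := by
  unfold degreeAnswer
  split_ifs with h
  · have := G.degree_lt_card_verts ⟨v, h⟩
    simp at this
    omega
  · exact Nat.zero_le _

theorem degreeAnswer_le_two_mul (v : ℕ) : degreeAnswer G v ≤ 2 * G.edgeFinset.card := by
  unfold degreeAnswer
  split_ifs with h
  · rw [← G.sum_degrees_eq_twice_card_edges]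
    exact Finset.single_le_sum (f := fun v => G.degree v) (fun _ _ => Nat.zero_le _)
      (Finset.mem_univ _)
  · exact Nat.zero_le _

theorem tsum_uniformOfFinset_mul {α : Type} (s : Finset α) (hs : s.Nonempty) (f : α → ℝ≥0∞) :
    ∑' a, PMF.uniformOfFinset s hs a * f a = (s.card : ℝ≥0∞)⁻¹ * ∑ a ∈ s, f a := by
  rw [tsum_eq_sum (s := s) fun a ha => by simp [ha], Finset.mul_sum]
  exact Finset.sum_congr rfl fun a ha => by rw [PMF.uniformOfFinset_apply_of_mem _ ha]

theorem map_uniformOfFinset_apply {α β : Type} [DecidableEq β] (s : Finset α) (hs : s.Nonempty)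
    (f : α → β) (b : β) :
    (PMF.uniformOfFinset s hs).map f b = (s.card : ℝ≥0∞)⁻¹ * (s.filter fun a => f a = b).card := by
  classical
  rw [PMF.map_apply]
  have : ∀ a, (if b = f a then PMF.uniformOfFinset s hs a else 0) =
      PMF.uniformOfFinset s hs a * if f a = b then 1 else 0 := by
    intro a
    by_cases h : f a = b
    · simp [h]
    · simp [h, Ne.symm h]
  rw [Finset.card_filter]
  push_cast
  rw [← tsum_uniformOfFinset_mul s hs]
  refine tsum_congr fun a => ?_
  by_cases h : f a = b
  · simp [h]
  · simp [h, Ne.symm h]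

/-- The two endpoints of an edge differ, so among the `2m` pairs of an edge and a bit exactly `d(v)`
lead to `v`. Numbers that are not vertices have degree answer 0, which is consistent. -/
theorem vertexDist_apply (hE : G.edgeFinset.Nonempty) (v : ℕ) :
    vertexDist G hE v = degreeAnswer G v / (2 * G.edgeFinset.card : ℕ) := by
  rw [vertexDist, PMF.bind_apply, tsum_uniformOfFinset_mul]
  simp_rw [map_uniformOfFinset_apply]
  rw [Finset.card_range, ← Finset.mul_sum]
  have hcard : ∀ e ∈ G.edgeFinset, ((Finset.range 2).filter fun b =>
      (if b = 0 then ((e.inf : Fin n) : ℕ) else ((e.sup : Fin n) : ℕ)) = v).card =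
      if ∃ x ∈ e, (x : ℕ) = v then 1 else 0 := by
    intro e he
    induction e with
    | _ a b =>
      have hab : a ≠ b := (show G.Adj a b by simpa using he).ne
      have hab' : (a : ℕ) ≠ b := fun h => hab (Fin.ext h)
      rw [Finset.card_filter]
      simp only [Finset.sum_range_succ, Finset.sum_range_zero, Sym2.inf_mk, Sym2.sup_mk]
      rcases le_total a b with h | h
      · simp only [inf_eq_left.2 h, sup_eq_right.2 h]
        by_cases h1 : (a : ℕ) = v <;> by_cases h2 : (b : ℕ) = v <;> first | omega | simp [h1, h2]
      · simp only [inf_eq_right.2 h, sup_eq_left.2 h]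
        by_cases h1 : (a : ℕ) = v <;> by_cases h2 : (b : ℕ) = v <;> first | omega | simp [h1, h2]
  have hsum : ∑ e ∈ G.edgeFinset, (((Finset.range 2).filter fun b =>
      (if b = 0 then ((e.inf : Fin n) : ℕ) else ((e.sup : Fin n) : ℕ)) = v).card : ℝ≥0∞)
      = degreeAnswer G v := by
    rw [← Nat.cast_sum, Finset.sum_congr rfl hcard, ← Finset.card_filter]
    congr 1
    unfold degreeAnswer
    split_ifs with hv
    · rw [← G.card_incidenceFinset_eq_degree, G.incidenceFinset_eq_filter]
      congr 1
      refine Finset.filter_congr fun e _ => ?_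
      constructor
      · rintro ⟨x, hx, rfl⟩; exact hx
      · exact fun h => ⟨_, h, rfl⟩
    · rw [Finset.card_eq_zero, Finset.filter_eq_empty_iff]
      rintro e - ⟨x, -, rfl⟩
      exact hv x.isLt
  rw [hsum, ← mul_assoc, ENNReal.div_eq_inv_mul]
  congr 1
  push_cast
  rw [ENNReal.mul_inv (by simp) (by simp), mul_comm]

/-- The adjacency list is a bijection, so exactly one index leads to `v`. -/
theorem neighborDist_apply {u v : ℕ} (h : pairAnswer G u v ≠ 0) :
    neighborDist G nbr u v = 1 / degreeAnswer G u := by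
  obtain ⟨hu, hv⟩ := lt_of_pairAnswer_ne_zero h
  have hadj : G.Adj ⟨u, hu⟩ ⟨v, hv⟩ := by
    by_contra hc
    simp [pairAnswer, hc] at h
  have hdeg : degreeAnswer G u = G.degree ⟨u, hu⟩ := by simp [degreeAnswer, hu]
  have hpos : 0 < degreeAnswer G u := by
    rw [hdeg]
    exact (G.degree_pos_iff_exists_adj _).2 ⟨_, hadj⟩
  have hne : (Finset.range (degreeAnswer G u)).Nonempty := by simpa using hpos.ne'
  rw [neighborDist, dif_pos hne, map_uniformOfFinset_apply, Finset.card_range]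
  have : (Finset.range (degreeAnswer G u)).filter (fun a => neighborAnswer G nbr u a = v) =
      {(((nbr ⟨u, hu⟩).symm ⟨⟨v, hv⟩, hadj⟩ : Fin _) : ℕ)} := by
    ext a
    simp only [Finset.mem_filter, Finset.mem_range, Finset.mem_singleton]
    constructor
    · rintro ⟨ha, hav⟩
      rw [hdeg] at ha
      have : nbr ⟨u, hu⟩ ⟨a, ha⟩ = ⟨⟨v, hv⟩, hadj⟩ := by
        apply Subtype.ext
        apply Fin.ext
        simpa [neighborAnswer, hu, ha] using hav
      rw [← this, Equiv.symm_apply_apply]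
    · rintro rfl
      refine ⟨by rw [hdeg]; exact Fin.isLt _, ?_⟩
      simp [neighborAnswer, hu]
  rw [this, Finset.card_singleton]
  simp

/-- The list records all choices made so far, so there is only one way to arrive at a given list,
and the probabilities along it multiply. -/
theorem chain_append_apply (f : ℕ → List ℕ → PMF ℕ) (j : ℕ) (l : List ℕ) :
    chain (fun i l => (f i l).map fun v => l ++ [v]) 0 j [] l =
      if l.length = j then ∏ i ∈ Finset.range j, f i (l.take i) (l.getD i 0) else 0 := by
  classical
  induction j generalizing l with
  | zero =>
    rw [chain, PMF.pure_apply]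
    simp [List.length_eq_zero_iff]
  | succ j ih =>
    rw [chain_succ, PMF.bind_apply, zero_add]
    rcases List.eq_nil_or_concat l with rfl | ⟨l₀, v, rfl⟩
    · simp only [List.length_nil, Nat.right_eq_add, Nat.add_eq_zero_iff, one_ne_zero, and_false,
        if_false, ENNReal.tsum_eq_zero, mul_eq_zero]
      intro l'
      right
      rw [PMF.map_apply]
      simp
    · have hmap : ∀ l', (PMF.map (fun v => l' ++ [v]) (f j l')) (l₀.concat v) =
          if l' = l₀ then f j l₀ v else 0 := by
        intro l'
        rw [PMF.map_apply, List.concat_eq_append]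
        by_cases h : l' = l₀
        · subst h
          rw [if_pos rfl, tsum_eq_single v fun v' hv' => by simp [Ne.symm hv']]
          simp
        · rw [if_neg h, ENNReal.tsum_eq_zero]
          intro v'
          rw [if_neg]
          intro h'
          exact h (List.append_inj_left' h' rfl).symm
      simp_rw [hmap]
      rw [tsum_eq_single l₀ fun l' hl' => by simp [hl'], if_pos rfl, ih]
      simp only [List.concat_eq_append, List.length_append, List.length_singleton,
        Nat.add_right_cancel_iff]
      by_cases hl : l₀.length = j
      · rw [if_pos hl, if_pos hl, Finset.prod_range_succ]
        congr 1
        · refine Finset.prod_congr rfl fun i hi => ?_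
          have hi' : i < l₀.length := by rw [hl]; simpa using hi
          rw [List.take_append_of_le_length hi'.le, List.getD_append _ _ _ _ hi']
        · rw [← hl, List.take_left, List.getD_append_right _ _ _ _ le_rfl]
          simp
      · rw [if_neg hl, if_neg hl, zero_mul]

/-- The index `t = i * k + j` encodes the pair `(i, j)`. Its first summand detects an edge of `H`
that is not preserved, its second one a failure of injectivity. -/
theorem violations_eq_zero_iff (l : List ℕ) : violations G H l = 0 ↔
    ∀ i < k, ∀ j < k, (pairAnswer H i j ≠ 0 → pairAnswer G (l.getD i 0) (l.getD j 0) ≠ 0) ∧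
      (i ≠ j → l.getD i 0 ≠ l.getD j 0) := by
  rw [violations, Finset.sum_eq_zero_iff]
  constructor
  · intro h i hi j hj
    have := h (i * k + j) (by
      rw [Finset.mem_range]
      calc i * k + j < i * k + k := by omega
        _ = (i + 1) * k := by ring
        _ ≤ k * k := Nat.mul_le_mul_right _ hi)
    have e1 : (i * k + j) / k = i := by
      rw [mul_comm, Nat.mul_add_div (by omega), Nat.div_eq_of_lt hj, add_zero]
    have e2 : (i * k + j) % k = j := by
      rw [mul_comm, Nat.mul_add_mod, Nat.mod_eq_of_lt hj]
    rw [e1, e2, Nat.add_eq_zero_iff] at this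
    refine ⟨fun h1 h2 => ?_, fun h1 h2 => ?_⟩
    · have := this.1
      rw [h2, Nat.sub_zero, one_mul] at this
      exact h1 this
    · have := this.2
      rw [if_neg h1, if_pos h2] at this
      exact absurd this (by norm_num)
  · intro h t ht
    rw [Finset.mem_range] at ht
    have hk : 0 < k := Nat.pos_of_ne_zero fun h => by simp [h] at ht
    obtain ⟨h1, h2⟩ := h (t / k) (Nat.div_lt_of_lt_mul ht) (t % k) (Nat.mod_lt _ hk)
    rw [Nat.add_eq_zero_iff]
    constructor
    · by_cases hH : pairAnswer H (t / k) (t % k) = 0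
      · simp [hH]
      · have := h1 hH
        rw [show 1 - pairAnswer G (l.getD (t / k) 0) (l.getD (t % k) 0) = 0 by omega, zero_mul]
    · by_cases hH : t / k = t % k
      · simp [hH]
      · rw [if_neg (h2 hH), mul_zero]

/-- The list of values of an embedding. -/
def imageList (φ : Fin k → Fin n) : List ℕ := List.ofFn fun i => (φ i : ℕ)

theorem imageList_getD (φ : Fin k → Fin n) (i : Fin k) : (imageList φ).getD i 0 = φ i := by
  simp [imageList, List.getD_eq_getElem?_getD]

/-- Every vertex of `H` has a neighbor, and a positive answer to the pair query for this edge
certifies that the entry of `l` is a vertex of `G`. -/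
theorem eq_imageList (hH : ∀ v, 0 < H.degree v) {l : List ℕ} (hl : l.length = k)
    (hv : violations G H l = 0) : ∃ φ ∈ embeddings H G, l = imageList φ := by
  rw [violations_eq_zero_iff] at hv
  have hlt : ∀ i : Fin k, l.getD i 0 < n := by
    intro i
    obtain ⟨j, hj⟩ := (H.degree_pos_iff_exists_adj i).1 (hH i)
    have := (hv i i.isLt j j.isLt).1 (by simp [pairAnswer_fin, hj])
    exact (lt_of_pairAnswer_ne_zero this).1
  refine ⟨fun i => ⟨l.getD i 0, hlt i⟩, ?_, ?_⟩
  · simp only [embeddings, Finset.mem_filter, Finset.mem_univ, true_and]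
    refine ⟨fun i j h => ?_, fun i j h => ?_⟩
    · by_contra hc
      exact (hv i i.isLt j j.isLt).2 (fun h' => hc (Fin.ext h')) (by simpa using h)
    · have := (hv i i.isLt j j.isLt).1 (by simp [pairAnswer_fin, h])
      by_contra hc
      have e := pairAnswer_fin (G := G) ⟨l.getD i 0, hlt i⟩ ⟨l.getD j 0, hlt j⟩
      rw [if_neg hc] at e
      exact this e
  · refine List.ext_getElem (by simp [imageList, hl]) fun i h1 h2 => ?_
    simp [imageList, h1]

theorem violations_imageList {φ : Fin k → Fin n} (hφ : φ ∈ embeddings H G) :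
    violations G H (imageList φ) = 0 := by
  simp only [embeddings, Finset.mem_filter, Finset.mem_univ, true_and] at hφ
  rw [violations_eq_zero_iff]
  intro i hi j hj
  have ei := imageList_getD φ ⟨i, hi⟩
  have ej := imageList_getD φ ⟨j, hj⟩
  simp only at ei ej
  rw [ei, ej]
  refine ⟨fun h => ?_, fun h h' => h ?_⟩
  · have : H.Adj ⟨i, hi⟩ ⟨j, hj⟩ := by
      by_contra hc
      simp [pairAnswer, hc] at h
    simp [pairAnswer_fin, hφ.2 _ _ this]
  · have := hφ.1 (Fin.ext h')
    simpa using this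

end Sampler

/-! ### The success probability of a trial -/

open scoped ENNReal

section SuccessProbability

variable {n k : ℕ} {G : SimpleGraph (Fin n)} [DecidableRel G.Adj]
  {nbr : ∀ v : Fin n, Fin (G.degree v) ≃ G.neighborSet v}
  {H : SimpleGraph (Fin k)} [DecidableRel H.Adj]

theorem natCast_div_natCast (a b : ℕ) (hb : b ≠ 0) :
    (a : ℝ≥0∞) / b = ENNReal.ofReal ((a : ℝ) / b) := by
  rw [ENNReal.ofReal_div_of_pos (by positivity), ENNReal.ofReal_natCast, ENNReal.ofReal_natCast]

theorem embedding_degree_pos (hH : ∀ v, 0 < H.degree v) {φ : Fin k → Fin n}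
    (hφ : φ ∈ embeddings H G) (i : Fin k) : 0 < degreeAnswer G (φ i) := by
  simp only [embeddings, Finset.mem_filter, Finset.mem_univ, true_and] at hφ
  obtain ⟨j, hj⟩ := (H.degree_pos_iff_exists_adj i).1 (hH i)
  rw [degreeAnswer_fin]
  exact (G.degree_pos_iff_exists_adj _).2 ⟨_, hφ.2 _ _ hj⟩

theorem commonDenom_pos (hE : G.edgeFinset.Nonempty) {l : List ℕ}
    (hl : ∀ j < k, 0 < degreeAnswer G (l.getD j 0)) : 0 < commonDenom (k := k) G l :=
  Nat.mul_pos (Nat.mul_pos two_pos hE.card_pos)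
    (Finset.prod_pos fun j hj => hl j (Finset.mem_range.1 hj))

/-- The degree is one of the factors of `commonDenom`, so the integer division of the machine is
exact. -/
theorem commonDenom_div_degree {l : List ℕ} {j : ℕ} (hj : j < k)
    (hl : 0 < degreeAnswer G (l.getD j 0)) :
    ((commonDenom (k := k) G l / degreeAnswer G (l.getD j 0) : ℕ) : ℝ) =
      commonDenom (k := k) G l / degreeAnswer G (l.getD j 0) := by
  refine Nat.cast_div ?_ (by positivity)
  exact Dvd.dvd.mul_left (Finset.dvd_prod_of_mem (fun j => degreeAnswer G (l.getD j 0))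
    (Finset.mem_range.2 hj)) _

theorem commonDenom_div_card (hE : G.edgeFinset.Nonempty) (l : List ℕ) :
    ((commonDenom (k := k) G l / (2 * G.edgeFinset.card) : ℕ) : ℝ) =
      commonDenom (k := k) G l / (2 * G.edgeFinset.card : ℕ) := by
  have := hE.card_pos
  exact Nat.cast_div (Dvd.intro _ rfl) (by positivity)

/-- The probability of the choice `l i` for vertex `i`, given the choice of the index `j`. -/
noncomputable def choiceProb (G : SimpleGraph (Fin n)) [DecidableRel G.Adj]
    (H : SimpleGraph (Fin k)) [DecidableRel H.Adj] (l : List ℕ) (i j : ℕ) : ℝ :=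
  if j < i ∧ pairAnswer H i j ≠ 0 then 1 / (degreeAnswer G (l.getD j 0) : ℝ)
  else degreeAnswer G (l.getD i 0) / (2 * G.edgeFinset.card : ℕ)

theorem choiceProb_nonneg (l : List ℕ) (i j : ℕ) : 0 ≤ choiceProb G H l i j := by
  unfold choiceProb
  split_ifs <;> positivity

theorem stageNum_eq (hE : G.edgeFinset.Nonempty) {l : List ℕ}
    (hl : ∀ j < k, 0 < degreeAnswer G (l.getD j 0)) (i : ℕ) :
    (stageNum G H l i : ℝ) =
      commonDenom (k := k) G l * ∑ j ∈ Finset.range k, choiceProb G H l i j := by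
  rw [stageNum, Nat.cast_sum, Finset.mul_sum]
  refine Finset.sum_congr rfl fun j hj => ?_
  rw [choiceProb]
  split_ifs
  · rw [commonDenom_div_degree (Finset.mem_range.1 hj) (hl j (Finset.mem_range.1 hj))]
    ring
  · rw [Nat.cast_mul, commonDenom_div_card hE]
    ring

/-- Average over the index `j`. In the neighbor case the entry `j < i` is already in the list, and
the edge between `i` and `j` is preserved by `φ`. -/
theorem stage_imageList (hE : G.edgeFinset.Nonempty) (hk : (Finset.range k).Nonempty)
    (hH : ∀ v, 0 < H.degree v) {φ : Fin k → Fin n} (hφ : φ ∈ embeddings H G) {i : ℕ} (hi : i < k) :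
    stage G nbr H hE hk i ((imageList φ).take i) ((imageList φ).getD i 0) =
      ENNReal.ofReal ((∑ j ∈ Finset.range k, choiceProb G H (imageList φ) i j) / k) := by
  have hk0 : 0 < k := by omega
  rw [stage, PMF.bind_apply, tsum_uniformOfFinset_mul, Finset.card_range, ← ENNReal.div_eq_inv_mul,
    ENNReal.ofReal_div_of_pos (by positivity), ENNReal.ofReal_natCast,
    ENNReal.ofReal_sum_of_nonneg fun j _ => choiceProb_nonneg _ _ _]
  congr 1
  refine Finset.sum_congr rfl fun j hj => ?_
  rw [Finset.mem_range] at hj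
  unfold choiceProb
  have hlen : (imageList φ).length = k := by simp [imageList]
  have hgi := imageList_getD φ ⟨i, hi⟩
  have hgj := imageList_getD φ ⟨j, hj⟩
  simp only at hgi hgj
  split_ifs with h
  · have htake : ((imageList φ).take i).getD j 0 = (imageList φ).getD j 0 := by
      simp [List.getD_eq_getElem?_getD, h.1]
    have hadj : H.Adj ⟨i, hi⟩ ⟨j, hj⟩ := by
      by_contra hc
      apply h.2
      simp [pairAnswer, hc]
    have hφ' := hφ
    simp only [embeddings, Finset.mem_filter, Finset.mem_univ, true_and] at hφ'
    rw [htake, hgi, hgj, neighborDist_apply]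
    · rw [← Nat.cast_one, natCast_div_natCast _ _ (embedding_degree_pos hH hφ ⟨j, hj⟩).ne']
      simp
    · simp [pairAnswer_fin, (hφ'.2 _ _ hadj).symm]
  · rw [vertexDist_apply, natCast_div_natCast]
    have := hE.card_pos
    omega

/-- After division by `B ^ k` this reads `1 ≤ s ^ R * ∏ Q i`, which says that the acceptance
probability is at most 1. It follows from the matching argument for the weights `Q` and `Z = 2m`. -/
theorem acceptance_bound (hE : G.edgeFinset.Nonempty) (hH : ∀ v, 0 < H.degree v)
    {φ : Fin k → Fin n} (hφ : φ ∈ embeddings H G) {s : ℕ} (hs : 2 * G.edgeFinset.card ≤ s ^ 2) :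
    commonDenom (k := k) G (imageList φ) ^ k ≤ s ^ coverNum H *
      ∏ i ∈ Finset.range k, stageNum G H (imageList φ) i := by
  set l := imageList φ with hl
  set m := G.edgeFinset.card with hm
  have hm0 : 0 < m := hE.card_pos
  have hdeg : ∀ j < k, 0 < degreeAnswer G (l.getD j 0) := by
    intro j hj
    have := imageList_getD φ ⟨j, hj⟩
    simp only at this
    rw [hl, this]
    exact embedding_degree_pos hH hφ _
  have hB := commonDenom_pos (k := k) hE hdeg
  set B := commonDenom (k := k) G l with hBdef
  set Q : Fin k → ℝ := fun i => ∑ j ∈ Finset.range k, choiceProb G H l i j with hQdef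
  have hle : ∀ (i : Fin k) (j : ℕ), j < k → choiceProb G H l i j ≤ Q i := fun i j hj =>
    Finset.single_le_sum (f := fun j => choiceProb G H l i j)
      (fun j _ => choiceProb_nonneg l i j) (Finset.mem_range.2 hj)
  have hQ0 : ∀ i, 0 ≤ Q i := fun i => Finset.sum_nonneg fun j _ => choiceProb_nonneg _ _ _
  have hZ : (1 : ℝ) ≤ (2 * m : ℕ) := by exact_mod_cast (by omega : 1 ≤ 2 * m)
  have hZ0 : (0 : ℝ) < (2 * m : ℕ) := by linarith
  have hmain := one_le_prod_sq_mul_pow_coverNum H (Z := (2 * m : ℕ)) hZ Q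
    (by
      intro i
      -- The index `j = i` never satisfies `j < i`, so `Q i` contains the term `d / 2m` of the edge
      -- sample.
      have h1 := hle i i i.isLt
      rw [choiceProb, if_neg (by simp)] at h1
      have h2 : (1 : ℝ) ≤ degreeAnswer G (l.getD i 0) := by exact_mod_cast hdeg i i.isLt
      calc (1 : ℝ) ≤ degreeAnswer G (l.getD i 0) := h2
        _ = (2 * m : ℕ) * (degreeAnswer G (l.getD i 0) / (2 * m : ℕ)) := by field_simp
        _ ≤ _ := mul_le_mul_of_nonneg_left h1 hZ0.le)
    (by
      -- For an edge with `u < v`, the index `v` contributes `d(u) / 2m` to `Q u`, and the index `u`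
      -- contributes `1 / d(u)` to `Q v`; the degrees cancel in the product.
      have key : ∀ u v : Fin k, u < v → H.Adj u v → 1 ≤ ((2 * m : ℕ) : ℝ) * (Q u * Q v) := by
        intro u v huv hadj
        have h1 := hle u v v.isLt
        have h2 := hle v u u.isLt
        have huv' : (u : ℕ) < v := huv
        rw [choiceProb, if_neg (by omega)] at h1
        rw [choiceProb, if_pos ⟨huv', by simp [pairAnswer_fin, hadj.symm]⟩] at h2
        have hd : (0 : ℝ) < degreeAnswer G (l.getD u 0) := by exact_mod_cast hdeg u u.isLt
        calc (1 : ℝ) = (2 * m : ℕ) * ((degreeAnswer G (l.getD u 0) / (2 * m : ℕ)) *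
              (1 / degreeAnswer G (l.getD u 0))) := by field_simp
          _ ≤ _ := mul_le_mul_of_nonneg_left (mul_le_mul h1 h2 (by positivity) (hQ0 u)) hZ0.le
      intro u v hadj
      rcases lt_trichotomy u v with h | h | h
      · exact key u v h hadj
      · exact absurd h hadj.ne
      · rw [mul_comm (Q u)]
        exact key v u h hadj.symm)
  have hP0 : 0 ≤ ∏ i, Q i := Finset.prod_nonneg fun i _ => hQ0 i
  -- As `2m ≤ s ^ 2`, the squared inequality holds with `(s ^ R) ^ 2` in place of `(2m) ^ R`, and
  -- the square can be dropped because all factors are nonnegative.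
  have hone : (1 : ℝ) ≤ (∏ i, Q i) * (s : ℝ) ^ coverNum H := by
    have h1 : (((2 * m : ℕ) : ℝ)) ^ coverNum H ≤ ((s : ℝ) ^ 2) ^ coverNum H :=
      pow_le_pow_left₀ hZ0.le (by exact_mod_cast hs) _
    have h2 : (1 : ℝ) ≤ ((∏ i, Q i) * (s : ℝ) ^ coverNum H) ^ 2 := by
      calc (1 : ℝ) ≤ (∏ i, Q i) ^ 2 * ((2 * m : ℕ) : ℝ) ^ coverNum H := hmain
        _ ≤ (∏ i, Q i) ^ 2 * ((s : ℝ) ^ 2) ^ coverNum H :=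
            mul_le_mul_of_nonneg_left h1 (by positivity)
        _ = _ := by rw [← pow_mul, mul_comm 2, pow_mul]; ring
    by_contra hc
    push Not at hc
    have h3 : 0 ≤ (∏ i, Q i) * (s : ℝ) ^ coverNum H := by positivity
    nlinarith
  have hnum : ((∏ i ∈ Finset.range k, stageNum G H l i : ℕ) : ℝ) = (B : ℝ) ^ k * ∏ i, Q i := by
    rw [Nat.cast_prod, Finset.prod_congr rfl fun i _ => stageNum_eq hE hdeg i,
      Finset.prod_mul_distrib, Finset.prod_const, Finset.card_range,
      Finset.prod_range (fun i => ∑ j ∈ Finset.range k, choiceProb G H l i j)]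
  have : ((B ^ k : ℕ) : ℝ) ≤ ((s ^ coverNum H * ∏ i ∈ Finset.range k, stageNum G H l i : ℕ) : ℝ) := by
    rw [Nat.cast_mul, hnum]
    push_cast
    calc (B : ℝ) ^ k = B ^ k * 1 := (mul_one _).symm
      _ ≤ B ^ k * ((∏ i, Q i) * (s : ℝ) ^ coverNum H) :=
          mul_le_mul_of_nonneg_left hone (by positivity)
      _ = _ := by ring
  exact_mod_cast this

theorem acceptance_apply_of_ne {A : ℕ} {l : List ℕ} (hv : violations G H l ≠ 0) :
    acceptance G H A l true = 0 := by
  unfold acceptance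
  split_ifs with h
  · rw [map_uniformOfFinset_apply]
    simp [hv]
  · simp

theorem acceptance_apply {A : ℕ} {l : List ℕ} (hv : violations G H l = 0)
    (hpos : 0 < commonDenom (k := k) G l)
    (hle : commonDenom (k := k) G l ^ k ≤ A * ∏ i ∈ Finset.range k, stageNum G H l i) :
    acceptance G H A l true = ENNReal.ofReal ((commonDenom (k := k) G l : ℝ) ^ k /
      (A * ∏ i ∈ Finset.range k, (stageNum G H l i : ℝ))) := by
  have h0 : 0 < A * ∏ i ∈ Finset.range k, stageNum G H l i := (Nat.pow_pos hpos).trans_le hle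
  have hne : (Finset.range (A * ∏ i ∈ Finset.range k, stageNum G H l i)).Nonempty := by
    simpa using h0.ne'
  rw [acceptance, dif_pos hne, map_uniformOfFinset_apply]
  have : (Finset.range (A * ∏ i ∈ Finset.range k, stageNum G H l i)).filter
      (fun x => decide (violations G H l = 0 ∧ x < commonDenom (k := k) G l ^ k) = true) =
      Finset.range (commonDenom (k := k) G l ^ k) := by
    ext x
    simp only [hv, true_and, decide_eq_true_eq, Finset.mem_filter, Finset.mem_range]
    omega
  rw [this, Finset.card_range, Finset.card_range, ← ENNReal.div_eq_inv_mul,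
    natCast_div_natCast _ _ h0.ne']
  push_cast
  rfl

/-- The success probability of a trial is the same for each labelled copy. -/
theorem trialDist_apply_true (hE : G.edgeFinset.Nonempty) (hk : (Finset.range k).Nonempty)
    (hH : ∀ v, 0 < H.degree v) {s : ℕ} (hs : 2 * G.edgeFinset.card ≤ s ^ 2) :
    (trialDist G nbr H hE hk (s ^ coverNum H) true).toReal =
      (embeddings H G).card / ((k : ℝ) ^ k * (s : ℝ) ^ coverNum H) := by
  classical
  have hk0 : 0 < k := by simpa [Nat.pos_iff_ne_zero] using hk
  have hs0 : 0 < s := by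
    rcases Nat.eq_zero_or_pos s with rfl | h
    · have := hE.card_pos
      rw [zero_pow two_ne_zero] at hs
      omega
    · exact h
  have hinj : Function.Injective (imageList : (Fin k → Fin n) → List ℕ) := by
    intro φ ψ h
    funext i
    have := congrArg (fun l => l.getD i 0) h
    simp only [imageList_getD] at this
    exact Fin.ext this
  -- The factor `∏ Q i` of the sampling probability cancels against the denominator of the
  -- acceptance probability, so that the result does not depend on `φ`.
  have hterm : ∀ φ ∈ embeddings H G, sampler G nbr H hE hk (imageList φ) *
      acceptance G H (s ^ coverNum H) (imageList φ) true =
      ENNReal.ofReal (1 / ((k : ℝ) ^ k * (s : ℝ) ^ coverNum H)) := by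
    intro φ hφ
    set l := imageList φ with hl
    have hdeg : ∀ j < k, 0 < degreeAnswer G (l.getD j 0) := by
      intro j hj
      have := imageList_getD φ ⟨j, hj⟩
      simp only at this
      rw [hl, this]
      exact embedding_degree_pos hH hφ _
    have hB := commonDenom_pos (k := k) hE hdeg
    have hle : commonDenom (k := k) G l ^ k ≤ s ^ coverNum H *
        ∏ i ∈ Finset.range k, stageNum G H l i := acceptance_bound hE hH hφ hs
    rw [acceptance_apply (violations_imageList hφ) hB hle, sampler, chain_append_apply,
      if_pos (by simp [hl, imageList]), Finset.prod_congr rfl fun i hi =>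
        stage_imageList hE hk hH hφ (Finset.mem_range.1 hi),
      ← ENNReal.ofReal_prod_of_nonneg fun i _ =>
        div_nonneg (Finset.sum_nonneg fun j _ => choiceProb_nonneg _ _ _) (Nat.cast_nonneg k),
      ← ENNReal.ofReal_mul (Finset.prod_nonneg fun i _ =>
        div_nonneg (Finset.sum_nonneg fun j _ => choiceProb_nonneg _ _ _) (Nat.cast_nonneg k))]
    congr 1
    rw [Finset.prod_div_distrib, Finset.prod_const, Finset.card_range,
      Finset.prod_congr rfl fun i _ => stageNum_eq (H := H) hE hdeg i,
      Finset.prod_mul_distrib, Finset.prod_const, Finset.card_range]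
    -- If the product vanished, `hle` would bound a positive power by 0.
    have hprod : (∏ i ∈ Finset.range k, ∑ j ∈ Finset.range k, choiceProb G H l i j) ≠ 0 := by
      intro h0
      have h1 : ((∏ i ∈ Finset.range k, stageNum G H l i : ℕ) : ℝ) = 0 := by
        rw [Nat.cast_prod, Finset.prod_congr rfl fun i _ => stageNum_eq (H := H) hE hdeg i,
          Finset.prod_mul_distrib, h0, mul_zero]
      have h2 : ∏ i ∈ Finset.range k, stageNum G H l i = 0 := by exact_mod_cast h1
      rw [h2, mul_zero] at hle
      exact absurd (Nat.pow_pos (n := k) hB) (by omega)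
    have hB' : (commonDenom (k := k) G l : ℝ) ≠ 0 := by exact_mod_cast hB.ne'
    have hk' : (k : ℝ) ≠ 0 := by exact_mod_cast hk0.ne'
    have hs' : (s : ℝ) ≠ 0 := by exact_mod_cast hs0.ne'
    push_cast
    rw [← hl]
    field_simp
  -- Only lists of values of embeddings contribute: other lists have the wrong length, and so
  -- probability 0, or are rejected for a violation.
  rw [trialDist, PMF.bind_apply, tsum_eq_sum (s := (embeddings H G).image imageList)]
  · rw [Finset.sum_image hinj.injOn, Finset.sum_congr rfl hterm, Finset.sum_const, nsmul_eq_mul,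
      ENNReal.toReal_mul, ENNReal.toReal_natCast, ENNReal.toReal_ofReal (by positivity)]
    ring
  · intro l hl
    by_cases hlen : l.length = k
    · rw [acceptance_apply_of_ne, mul_zero]
      intro hv
      obtain ⟨φ, hφ, rfl⟩ := eq_imageList hH hlen hv
      exact hl (Finset.mem_image_of_mem _ hφ)
    · rw [sampler, chain_append_apply, if_neg hlen, zero_mul]

end SuccessProbability

/-! ### Evaluation and overflow rules for expressions -/

namespace Expr

instance : Add Expr := ⟨bin .add⟩
instance : Sub Expr := ⟨bin .sub⟩
instance : Mul Expr := ⟨bin .mul⟩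
instance : Div Expr := ⟨bin .div⟩
instance : Mod Expr := ⟨bin .mod⟩

/-- Comparison. -/
abbrev lt (a b : Expr) : Expr := bin .lt a b

/-- Test for equality. -/
abbrev eq (a b : Expr) : Expr := bin .eq a b

variable (σ : State) (W X : ℕ) (a b c : Expr) (l : List ℕ)

theorem eval_lit (c : ℕ) : (lit c).eval σ l = c := rfl
theorem eval_var (x : ℕ) : (var x).eval σ l = σ.reg x := rfl
theorem eval_loc (j : ℕ) : (loc j).eval σ l = l.getD j 0 := rfl
theorem eval_mem : (mem a).eval σ l = σ.mem (a.eval σ l) := rfl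
theorem eval_add : (a + b).eval σ l = a.eval σ l + b.eval σ l := rfl
theorem eval_sub : (a - b).eval σ l = a.eval σ l - b.eval σ l := rfl
theorem eval_mul : (a * b).eval σ l = a.eval σ l * b.eval σ l := rfl
theorem eval_div : (a / b).eval σ l = a.eval σ l / b.eval σ l := rfl
theorem eval_mod : (a % b).eval σ l = a.eval σ l % b.eval σ l := rfl
theorem eval_lt : (lt a b).eval σ l = if a.eval σ l < b.eval σ l then 1 else 0 := rfl
theorem eval_eq : (eq a b).eval σ l = if a.eval σ l = b.eval σ l then 1 else 0 := rfl
theorem eval_iter : (iter a b c).eval σ l =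
    iterate (fun i acc => c.eval σ (acc :: i :: l)) (b.eval σ l) (a.eval σ l) := rfl

theorem ok_lit (c : ℕ) : (lit c).Ok W X σ l ↔ c < W := Iff.rfl
theorem ok_var (x : ℕ) : (var x).Ok W X σ l ↔ x < numVars := Iff.rfl
theorem ok_loc (j : ℕ) : (loc j).Ok W X σ l ↔ j < l.length := Iff.rfl
theorem ok_mem : (mem a).Ok W X σ l ↔ a.Ok W X σ l := Iff.rfl
theorem ok_add : (a + b).Ok W X σ l ↔ a.Ok W X σ l ∧ b.Ok W X σ l ∧
    a.eval σ l + b.eval σ l < W := Iff.rfl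
theorem ok_mul : (a * b).Ok W X σ l ↔ a.Ok W X σ l ∧ b.Ok W X σ l ∧
    a.eval σ l * b.eval σ l < W := Iff.rfl
theorem ok_sub : (a - b).Ok W X σ l ↔ a.Ok W X σ l ∧ b.Ok W X σ l :=
  and_congr_right fun _ => iff_of_eq (and_true _)
theorem ok_div : (a / b).Ok W X σ l ↔ a.Ok W X σ l ∧ b.Ok W X σ l :=
  and_congr_right fun _ => iff_of_eq (and_true _)
theorem ok_mod : (a % b).Ok W X σ l ↔ a.Ok W X σ l ∧ b.Ok W X σ l :=
  and_congr_right fun _ => iff_of_eq (and_true _)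
theorem ok_lt : (lt a b).Ok W X σ l ↔ a.Ok W X σ l ∧ b.Ok W X σ l :=
  and_congr_right fun _ => iff_of_eq (and_true _)
theorem ok_eq : (eq a b).Ok W X σ l ↔ a.Ok W X σ l ∧ b.Ok W X σ l :=
  and_congr_right fun _ => iff_of_eq (and_true _)
theorem ok_iter : (iter a b c).Ok W X σ l ↔ a.Ok W X σ l ∧ b.Ok W X σ l ∧ a.eval σ l ≤ X ∧
    ∀ i < a.eval σ l, c.Ok W X σ
      (iterate (fun i acc => c.eval σ (acc :: i :: l)) (b.eval σ l) i :: i :: l) := Iff.rfl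

/-- The address of cell `i` of array `a`. -/
def cell (a : ℕ) (i : Expr) : Expr := var 6 + (lit 8 * i + lit a)

end Expr

theorem iterate_add (f : ℕ → ℕ) (z N : ℕ) :
    iterate (fun i acc => acc + f i) z N = z + ∑ i ∈ Finset.range N, f i := by
  induction N with
  | zero => rfl
  | succ N ih => rw [iterate, ih, Finset.sum_range_succ, add_assoc]

theorem iterate_mul (f : ℕ → ℕ) (z N : ℕ) :
    iterate (fun i acc => acc * f i) z N = z * ∏ i ∈ Finset.range N, f i := by
  induction N with
  | zero => simp [iterate]
  | succ N ih => rw [iterate, ih, Finset.prod_range_succ, mul_assoc]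

theorem iterate_congr {f g : ℕ → ℕ → ℕ} {z N : ℕ} (h : ∀ i < N, ∀ acc, f i acc = g i acc) :
    iterate f z N = iterate g z N := by
  induction N with
  | zero => rfl
  | succ N ih =>
    rw [iterate, iterate, ih fun i hi => h i (by omega), h N (by omega)]

section ConstantTime

variable {n : ℕ} {G : SimpleGraph (Fin n)} [DecidableRel G.Adj]
  {nbr : ∀ v : Fin n, Fin (G.degree v) ≃ G.neighborSet v} {w X : ℕ}
  {p q : Prog} {σ : State} {α β : Type} {ν : PMF α} {Q : α → State → Prop}

theorem Tri.seq_tb {κ : α → PMF β} {R : β → State → Prop} (hp : Tri G nbr w p (p.tb X) σ ν Q)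
    (hq : ∀ a σ', Q a σ' → Tri G nbr w q (q.tb X) σ' (κ a) R) :
    Tri G nbr w (.seq p q) ((Prog.seq p q).tb X) σ (ν.bind κ) R := Tri.seq hp hq

theorem Tri.seq_det_tb {R : β → State → Prop} {ν : PMF β} {Q : Unit → State → Prop}
    (hp : Tri G nbr w p (p.tb X) σ (PMF.pure ()) Q)
    (hq : ∀ σ', Q () σ' → Tri G nbr w q (q.tb X) σ' ν R) :
    Tri G nbr w (.seq p q) ((Prog.seq p q).tb X) σ ν R := Tri.seq_det hp hq

theorem Tri.ifc_tb (hW : 1 < 2 ^ w) {e : Expr} (he : e.Ok (2 ^ w) X σ [])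
    (hp : e.eval σ [] ≠ 0 → Tri G nbr w p (p.tb X) σ ν Q)
    (hq : e.eval σ [] = 0 → Tri G nbr w q (q.tb X) σ ν Q) :
    Tri G nbr w (.ifc e p q) ((Prog.ifc e p q).tb X) σ ν Q := Tri.ifc hW he hp hq

/-- An assignment followed by a program. -/
theorem Tri.asg_seq (hW : 1 < 2 ^ w) {x : ℕ} {e : Expr} (hx : x < numVars)
    (he : e.Ok (2 ^ w) X σ [])
    (hq : Tri G nbr w q (q.tb X) (σ.upd x (e.eval σ [])) ν Q) :
    Tri G nbr w (.seq (.asg x e) q) ((Prog.seq (.asg x e) q).tb X) σ ν Q :=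
  Tri.seq_det_tb (Q := fun _ σ' => σ' = σ.upd x (e.eval σ [])) (Tri.asg hW hx he rfl)
    fun _ h => h ▸ hq

/-- A write to memory followed by a program. -/
theorem Tri.sto_seq (hW : 1 < 2 ^ w) {e₁ e₂ : Expr}
    (h₁ : e₁.Ok (2 ^ w) X σ []) (h₂ : e₂.Ok (2 ^ w) X σ [])
    (hq : Tri G nbr w q (q.tb X) (σ.put (e₁.eval σ []) (e₂.eval σ [])) ν Q) :
    Tri G nbr w (.seq (.sto e₁ e₂) q) ((Prog.seq (.sto e₁ e₂) q).tb X) σ ν Q :=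
  Tri.seq_det_tb (Q := fun _ σ' => σ' = σ.put (e₁.eval σ []) (e₂.eval σ []))
    (Tri.sto hW h₁ h₂ rfl) fun _ h => h ▸ hq

end ConstantTime

/-! ### Memory layout and invariants -/

/-- The states `σ` and `σ'` agree up to the registers in `S` and at most `c` queries. -/
structure Frame (S : List ℕ) (c : ℕ) (σ σ' : State) : Prop where
  reg : ∀ r, r ∉ S → σ'.reg r = σ.reg r
  mem : σ'.mem = σ.mem
  queries : σ'.queries ≤ σ.queries + c

/-- Address of cell `i` of array `a` for a graph `H` with `k` vertices. -/
def addr (k a i : ℕ) : ℕ := k * k + (8 * i + a)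

/-- Eight arrays are interleaved modulo 8 behind the pattern, so they cannot overlap, whatever their
lengths. -/
theorem addr_inj {k a b i j : ℕ} (ha : a < 8) (hb : b < 8) :
    addr k a i = addr k b j ↔ a = b ∧ i = j := by
  unfold addr
  omega

section Memory

variable {n k : ℕ} (G : SimpleGraph (Fin n)) [DecidableRel G.Adj]
  (nbr : ∀ v : Fin n, Fin (G.degree v) ≃ G.neighborSet v)
  (H : SimpleGraph (Fin k)) [DecidableRel H.Adj]

/-- The graph `G` is stored in memory. -/
structure Stored (k : ℕ) (mem : ℕ → ℕ) : Prop where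
  degree : ∀ v < n, mem (addr k 2 v) = degreeAnswer G v
  neighbor : ∀ v < n, ∀ i < degreeAnswer G v, mem (addr k 4 (v * n + i)) = neighborAnswer G nbr v i
  pair : ∀ u < n, ∀ v < n, mem (addr k 5 (u * n + v)) = pairAnswer G u v
  source : ∀ v, ((Finset.range (2 * G.edgeFinset.card)).filter
    fun x => mem (addr k 3 x) = v).card = degreeAnswer G v

/-- The graph `H` is stored in memory, and so is `G` if the flag is set. -/
structure MemGood (fl : ℕ) (mem : ℕ → ℕ) : Prop where
  pattern : ∀ x < k * k, mem x = pairAnswer H (x / k) (x % k)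
  stored : fl ≠ 0 → Stored G nbr k mem

/-- The registers that a trial relies on. -/
structure RegGood (k A fl : ℕ) (σ : State) : Prop where
  n_eq : σ.reg 0 = n
  m_eq : σ.reg 1 = G.edgeFinset.card
  k_eq : σ.reg 5 = k
  base_eq : σ.reg 6 = k * k
  acc_eq : σ.reg 11 = A
  flag_eq : σ.reg 13 = fl

/-- Words are large enough for a trial. -/
structure WordGood (k A w : ℕ) : Prop where
  n_pos : 0 < n
  k_le : k ≤ n
  k_pos : 0 < k
  m_pos : 0 < G.edgeFinset.card
  -- Bounds all addresses `k * k + (8 * i + a)` with `k ≤ n`, `i < n * n` and `a < 8`.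
  square : 9 * (n * n) + 9 < 2 ^ w
  -- Bounds the range `A * ∏ stageNum` of the random number in the rejection step.
  power : A * (k * (2 * G.edgeFinset.card * n ^ k)) ^ k < 2 ^ w

variable {G nbr H}

/-- The invariant does not mention arrays 0 and 1, which hold the sampled map and its degrees and
are the only memory that a trial writes to. -/
theorem MemGood.congr {fl : ℕ} {mem mem' : ℕ → ℕ} (h : MemGood G nbr H fl mem)
    (h0 : ∀ x < k * k, mem' x = mem x)
    (h1 : ∀ a i, 2 ≤ a → a < 8 → mem' (addr k a i) = mem (addr k a i)) :
    MemGood G nbr H fl mem' := by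
  refine ⟨fun x hx => (h0 x hx).trans (h.pattern x hx), fun hf => ?_⟩
  obtain ⟨g1, g2, g3, g4⟩ := h.stored hf
  refine ⟨fun v hv => ?_, fun v hv i hi => ?_, fun u hu v hv => ?_, fun v => ?_⟩
  · rw [h1 2 v le_rfl (by omega), g1 v hv]
  · rw [h1 4 _ (by omega) (by omega), g2 v hv i hi]
  · rw [h1 5 _ (by omega) (by omega), g3 u hu v hv]
  · simp_rw [fun x => h1 3 x (by omega) (by omega)]
    exact g4 v

theorem MemGood.put {fl : ℕ} {σ : State} (h : MemGood G nbr H fl σ.mem) {a : ℕ} (ha : a < 2)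
    (i v : ℕ) : MemGood G nbr H fl (σ.put (addr k a i) v).mem := by
  refine h.congr (fun x hx => ?_) fun b j hb hb' => ?_
  · rw [State.put_mem, if_neg]
    unfold addr
    omega
  · rw [State.put_mem, if_neg]
    rw [addr_inj hb' (by omega)]
    omega

theorem MemGood.mem_pattern {fl : ℕ} {mem : ℕ → ℕ} (h : MemGood G nbr H fl mem) {i j : ℕ}
    (hi : i < k) (hj : j < k) : mem (i * k + j) = pairAnswer H i j := by
  rw [h.pattern]
  · congr 1
    · rw [mul_comm, Nat.mul_add_div (by omega), Nat.div_eq_of_lt hj, add_zero]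
    · rw [mul_comm, Nat.mul_add_mod, Nat.mod_eq_of_lt hj]
  · calc i * k + j < i * k + k := by omega
      _ = (i + 1) * k := by ring
      _ ≤ k * k := Nat.mul_le_mul_right _ hi

theorem neighborAnswer_lt (hn : 0 < n) (v i : ℕ) : neighborAnswer G nbr v i < n := by
  unfold neighborAnswer
  split_ifs
  · exact Fin.isLt _
  · exact hn
  · exact hn

theorem pairAnswer_neighborAnswer {u i : ℕ} (hu : u < n) (hi : i < degreeAnswer G u) :
    pairAnswer G u (neighborAnswer G nbr u i) = 1 := by
  have hi' : i < G.degree ⟨u, hu⟩ := by simpa [degreeAnswer, hu] using hi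
  have := (nbr ⟨u, hu⟩ ⟨i, hi'⟩).2
  rw [SimpleGraph.mem_neighborSet] at this
  simp [pairAnswer, neighborAnswer, hu, hi', this]

theorem degreeAnswer_pos_of_pairAnswer {u v : ℕ} (h : pairAnswer G u v ≠ 0) :
    0 < degreeAnswer G v := by
  obtain ⟨hu, hv⟩ := lt_of_pairAnswer_ne_zero h
  have hadj : G.Adj ⟨u, hu⟩ ⟨v, hv⟩ := by
    by_contra hc
    simp [pairAnswer, hc] at h
  simp only [degreeAnswer, hv, dite_true]
  exact (G.degree_pos_iff_exists_adj _).2 ⟨_, hadj.symm⟩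

theorem two_mul_card_edgeFinset_le : 2 * G.edgeFinset.card ≤ n * n := by
  rw [← G.sum_degrees_eq_twice_card_edges]
  refine (Finset.sum_le_card_nsmul Finset.univ _ n fun v _ => ?_).trans ?_
  · have := G.degree_lt_card_verts v
    simp at this
    omega
  · simp

end Memory

/-! ### Access to the graph, by queries or from memory -/

open SubgraphCount.Expr in
/-- `reg 24 :=` a random endpoint of a random edge. -/
def sampleVertex : Prog :=
  .ifc (var 13)
    (.seq (.rnd 26 (var 1 + var 1)) (.asg 24 (mem (cell 3 (var 26)))))
    (.seq (.instr (.edgeSample 24 23)) (.seq (.rnd 26 (lit 2))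
      (.ifc (var 26) (.asg 24 (var 23)) .skip)))

open SubgraphCount.Expr in
/-- `reg 24 :=` a random neighbor of the vertex in register 23, whose degree is in register 25. -/
def sampleNeighbor : Prog :=
  .seq (.rnd 26 (var 25)) (.ifc (var 13)
    (.asg 24 (mem (cell 4 (var 23 * var 0 + var 26)))) (.instr (.neighbor 24 23 26)))

open SubgraphCount.Expr in
/-- `reg 25 :=` the degree of the vertex in register 24. -/
def getDegree : Prog :=
  .ifc (var 13) (.asg 25 (mem (cell 2 (var 24)))) (.instr (.degree 25 24))

open SubgraphCount.Expr in
/-- `reg 26 := 1` if the vertices in registers 23 and 24 are adjacent, and `0` otherwise. -/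
def getPair : Prog :=
  .ifc (var 13) (.asg 26 (mem (cell 5 (var 23 * var 0 + var 24)))) (.instr (.pair 26 23 24))

section Primitives

variable {n k : ℕ} {G : SimpleGraph (Fin n)} [DecidableRel G.Adj]
  {nbr : ∀ v : Fin n, Fin (G.degree v) ≃ G.neighborSet v}
  {H : SimpleGraph (Fin k)} [DecidableRel H.Adj] {w X A fl : ℕ} {σ : State}

theorem eval_cell (hb : σ.reg 6 = k * k) (a : ℕ) (e : Expr) (l : List ℕ) :
    (Expr.cell a e).eval σ l = addr k a (e.eval σ l) := by
  simp only [Expr.cell, Expr.eval_add, Expr.eval_mul, Expr.eval_var, Expr.eval_lit, hb, addr]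

theorem WordGood.one_lt (h : WordGood G k A w) : 1 < 2 ^ w := by
  have := h.square
  omega

theorem WordGood.k_sq_le (h : WordGood G k A w) : k * k ≤ n * n := Nat.mul_le_mul h.k_le h.k_le

theorem ok_cell (hw : WordGood G k A w) (hb : σ.reg 6 = k * k) {a : ℕ} (ha : a < 8) {e : Expr}
    {l : List ℕ} (he : e.Ok (2 ^ w) X σ l) (hlt : e.eval σ l < n * n) :
    (Expr.cell a e).Ok (2 ^ w) X σ l := by
  have h1 := hw.square
  have h2 := hw.k_sq_le
  simp only [Expr.cell, Expr.ok_add, Expr.ok_mul, Expr.ok_var, Expr.ok_lit, Expr.eval_add,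
    Expr.eval_mul, Expr.eval_var, Expr.eval_lit, hb]
  refine ⟨by decide, ⟨⟨by omega, he, by omega⟩, by omega, by omega⟩, by omega⟩

theorem mul_add_lt_sq {i j m : ℕ} (hi : i < m) (hj : j < m) : i * m + j < m * m :=
  calc i * m + j < i * m + m := by omega
    _ = (i + 1) * m := by ring
    _ ≤ m * m := Nat.mul_le_mul_right _ hi

/-- The truncated difference `1 - fl` charges one query if the graph is not stored and none if it
is. -/
theorem tri_getDegree (hw : WordGood G k A w) (hr : RegGood G k A fl σ)
    (hm : MemGood G nbr H fl σ.mem) {v : ℕ} (hv : v < n) (h24 : σ.reg 24 = v) :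
    Tri G nbr w getDegree (getDegree.tb X) σ (PMF.pure ()) fun _ σ' =>
      Frame [25] (1 - fl) σ σ' ∧ σ'.reg 25 = degreeAnswer G v := by
  have hW := hw.one_lt
  have hnn : n ≤ n * n := Nat.le_mul_self n
  refine Tri.ifc_tb hW (by rw [Expr.ok_var]; decide) (fun h => ?_) (fun h => ?_)
  · rw [Expr.eval_var, hr.flag_eq] at h
    refine Tri.asg hW (by decide) ?_ ?_
    · rw [Expr.ok_mem]
      exact ok_cell hw hr.base_eq (by decide) (by rw [Expr.ok_var]; decide)
        (by rw [Expr.eval_var]; omega)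
    · rw [Expr.eval_mem, eval_cell hr.base_eq, Expr.eval_var, h24, (hm.stored h).degree v hv]
      refine ⟨⟨fun r hr => ?_, rfl, by simp⟩, by simp⟩
      simp at hr
      simp [hr]
  · rw [Expr.eval_var, hr.flag_eq] at h
    refine Tri.degree (by decide) ?_ ?_
    · have := degreeAnswer_le (G := G) (σ.reg 24)
      have := hw.square
      omega
    · refine ⟨⟨fun r hr => ?_, rfl, by simp [h]⟩, by simp [h24]⟩
      simp at hr
      simp [hr]

theorem tri_getPair (hw : WordGood G k A w) (hr : RegGood G k A fl σ)
    (hm : MemGood G nbr H fl σ.mem) {u v : ℕ} (hu : u < n) (hv : v < n) (h23 : σ.reg 23 = u)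
    (h24 : σ.reg 24 = v) :
    Tri G nbr w getPair (getPair.tb X) σ (PMF.pure ()) fun _ σ' =>
      Frame [26] (1 - fl) σ σ' ∧ σ'.reg 26 = pairAnswer G u v := by
  have hW := hw.one_lt
  have huv := mul_add_lt_sq hu hv
  have hsq := hw.square
  refine Tri.ifc_tb hW (by rw [Expr.ok_var]; decide) (fun h => ?_) (fun h => ?_)
  · rw [Expr.eval_var, hr.flag_eq] at h
    refine Tri.asg hW (by decide) ?_ ?_
    · rw [Expr.ok_mem]
      refine ok_cell hw hr.base_eq (by decide) ?_ ?_
      · simp only [Expr.ok_add, Expr.ok_mul, Expr.ok_var, Expr.eval_mul, Expr.eval_var, h23, h24,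
          hr.n_eq]
        exact ⟨⟨by decide, by decide, by omega⟩, by decide, by omega⟩
      · simpa only [Expr.eval_add, Expr.eval_mul, Expr.eval_var, h23, h24, hr.n_eq]
    · simp only [Expr.eval_mem, eval_cell hr.base_eq, Expr.eval_add, Expr.eval_mul, Expr.eval_var,
        h23, h24, hr.n_eq, (hm.stored h).pair u hu v hv]
      refine ⟨⟨fun r hr => ?_, rfl, by simp⟩, by simp⟩
      simp at hr
      simp [hr]
  · rw [Expr.eval_var, hr.flag_eq] at h
    refine Tri.pair (by decide) (by decide) ?_ ?_
    · have := pairAnswer_le_one (G := G) (σ.reg 23) (σ.reg 24)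
      omega
    · refine ⟨⟨fun r hr => ?_, rfl, by simp [h]⟩, by simp [h23, h24]⟩
      simp at hr
      simp [hr]

/-- The sampled vertex has a neighbor itself, namely `u`; its positive degree is recorded because
later stages may sample from its list. -/
theorem tri_sampleNeighbor (hw : WordGood G k A w) (hr : RegGood G k A fl σ)
    (hm : MemGood G nbr H fl σ.mem) {u : ℕ} (hu : u < n) (h23 : σ.reg 23 = u)
    (h25 : σ.reg 25 = degreeAnswer G u) (hd : 0 < degreeAnswer G u) :
    Tri G nbr w sampleNeighbor (sampleNeighbor.tb X) σ (neighborDist G nbr u) fun v σ' =>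
      Frame [24, 26] (1 - fl) σ σ' ∧ σ'.reg 24 = v ∧ v < n ∧ 0 < degreeAnswer G v := by
  have hW := hw.one_lt
  have hsq := hw.square
  have hnn : n ≤ n * n := Nat.le_mul_self n
  have hne : (Finset.range (degreeAnswer G u)).Nonempty := by simpa using hd.ne'
  have hne' : (Finset.range ((Expr.var 25).eval σ [])).Nonempty := by
    rwa [Expr.eval_var, h25]
  rw [neighborDist, dif_pos hne, ← PMF.bind_pure_comp]
  have hrnd := Tri.rnd (G := G) (nbr := nbr) (X := X) (x := 26) (e := .var 25) (σ := σ)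
    (Q := fun i σ' => i < degreeAnswer G u ∧ σ' = σ.upd 26 i) hW
    (by rw [Expr.ok_var]; decide) hne'
    (fun i hi => ⟨by rwa [Expr.eval_var, h25] at hi, rfl⟩)
  have hdist : PMF.uniformOfFinset (Finset.range ((Expr.var 25).eval σ [])) hne' =
      PMF.uniformOfFinset (Finset.range (degreeAnswer G u)) hne := by
    congr 2
  refine Tri.seq_tb (hrnd.of_eq hdist) ?_
  rintro i σ' ⟨hi, rfl⟩
  have hin : i < n := hi.trans_le (degreeAnswer_le u)
  have hun := mul_add_lt_sq hu hin
  have hlt := neighborAnswer_lt (G := G) (nbr := nbr) hw.n_pos u i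
  have hpos : 0 < degreeAnswer G (neighborAnswer G nbr u i) :=
    degreeAnswer_pos_of_pairAnswer (u := u) (by rw [pairAnswer_neighborAnswer hu hi]; decide)
  refine Tri.ifc_tb hW (by rw [Expr.ok_var]; decide) (fun h => ?_) (fun h => ?_)
  · simp only [Expr.eval_var, State.upd_reg] at h
    rw [if_neg (by decide), hr.flag_eq] at h
    refine Tri.asg hW (by decide) ?_ ?_
    · rw [Expr.ok_mem]
      refine ok_cell hw (by simp [hr.base_eq]) (by decide) ?_ ?_
      · simp only [Expr.ok_add, Expr.ok_mul, Expr.ok_var, Expr.eval_mul, Expr.eval_var]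
        refine ⟨⟨by decide, by decide, ?_⟩, by decide, ?_⟩
        · simp only [State.upd_reg, Nat.reduceEqDiff, if_false, h23, hr.n_eq,
            OfNat.zero_ne_ofNat]
          omega
        · simp only [State.upd_reg, Nat.reduceEqDiff, if_false, if_true, h23, hr.n_eq,
            OfNat.zero_ne_ofNat]
          omega
      · simpa [Expr.eval_add, Expr.eval_mul, Expr.eval_var, h23, hr.n_eq]
    · have : (Expr.mem (.cell 4 (.var 23 * .var 0 + .var 26))).eval (σ.upd 26 i) [] =
          neighborAnswer G nbr u i := by
        rw [Expr.eval_mem, eval_cell (k := k) (by simp [hr.base_eq])]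
        simp [Expr.eval_add, Expr.eval_mul, Expr.eval_var, h23, hr.n_eq,
          (hm.stored h).neighbor u hu i hi]
      rw [this]
      refine ⟨⟨fun r hr => ?_, rfl, by simp⟩, by simp, hlt, hpos⟩
      simp at hr
      simp [hr]
  · simp only [Expr.eval_var, State.upd_reg] at h
    rw [if_neg (by decide), hr.flag_eq] at h
    refine Tri.neighbor (by decide) (by decide) ?_ ?_
    · have := neighborAnswer_lt (G := G) (nbr := nbr) hw.n_pos ((σ.upd 26 i).reg 23)
        ((σ.upd 26 i).reg 26)
      omega
    · have : neighborAnswer G nbr ((σ.upd 26 i).reg 23) ((σ.upd 26 i).reg 26) =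
          neighborAnswer G nbr u i := by simp [h23]
      rw [this]
      refine ⟨⟨fun r hr => ?_, rfl, by simp [h]⟩, by simp, hlt, hpos⟩
      simp at hr
      simp [hr]

/-- Array 3 has `2m` cells and contains each vertex as often as its degree, so a uniform cell
replaces an edge sample followed by a random bit. -/
theorem stored_map_eq_vertexDist (hE : G.edgeFinset.Nonempty) {mem : ℕ → ℕ}
    (h : Stored G nbr k mem) (hne : (Finset.range (2 * G.edgeFinset.card)).Nonempty) :
    (PMF.uniformOfFinset _ hne).map (fun x => mem (addr k 3 x)) = vertexDist G hE := by
  ext v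
  rw [map_uniformOfFinset_apply, h.source, Finset.card_range, vertexDist_apply,
    ENNReal.div_eq_inv_mul]

theorem lt_of_degreeAnswer_pos {v : ℕ} (h : 0 < degreeAnswer G v) : v < n := by
  by_contra hc
  simp [degreeAnswer, hc] at h

/-- The two branches use different randomness but implement the same abstract distribution, so the
rest of the analysis need not distinguish them. -/
theorem tri_sampleVertex (hE : G.edgeFinset.Nonempty) (hw : WordGood G k A w)
    (hr : RegGood G k A fl σ) (hm : MemGood G nbr H fl σ.mem) :
    Tri G nbr w sampleVertex (sampleVertex.tb X) σ (vertexDist G hE) fun v σ' =>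
      Frame [23, 24, 26] (1 - fl) σ σ' ∧ σ'.reg 24 = v ∧ v < n ∧ 0 < degreeAnswer G v := by
  have hW := hw.one_lt
  have hsq := hw.square
  have hmn := two_mul_card_edgeFinset_le (G := G)
  have hmpos := hw.m_pos
  refine Tri.ifc_tb hW (by rw [Expr.ok_var]; decide) (fun h => ?_) (fun h => ?_)
  · rw [Expr.eval_var, hr.flag_eq] at h
    have hst := hm.stored h
    have hev : (Expr.var 1 + Expr.var 1).eval σ [] = 2 * G.edgeFinset.card := by
      rw [Expr.eval_add, Expr.eval_var, hr.m_eq, two_mul]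
    have hne : (Finset.range (2 * G.edgeFinset.card)).Nonempty := by
      rw [Finset.nonempty_range_iff]; omega
    have hne' : (Finset.range ((Expr.var 1 + Expr.var 1).eval σ [])).Nonempty := by rwa [hev]
    rw [← stored_map_eq_vertexDist hE hst hne, ← PMF.bind_pure_comp]
    have hrnd := Tri.rnd (G := G) (nbr := nbr) (X := X) (x := 26) (e := .var 1 + .var 1) (σ := σ)
      (Q := fun i σ' => i < 2 * G.edgeFinset.card ∧ σ' = σ.upd 26 i) hW
      (by
        simp only [Expr.ok_add, Expr.ok_var, Expr.eval_var, hr.m_eq]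
        exact ⟨by decide, by decide, by omega⟩) hne'
      (fun i hi => ⟨by rwa [hev] at hi, rfl⟩)
    have hdist : PMF.uniformOfFinset (Finset.range ((Expr.var 1 + Expr.var 1).eval σ [])) hne' =
        PMF.uniformOfFinset (Finset.range (2 * G.edgeFinset.card)) hne := by
      congr 2
    refine Tri.seq_tb (hrnd.of_eq hdist) ?_
    rintro i σ' ⟨hi, rfl⟩
    have hpos : 0 < degreeAnswer G (σ.mem (addr k 3 i)) := by
      rw [← hst.source, Finset.card_pos]
      exact ⟨i, by simpa using hi⟩
    refine Tri.asg hW (by decide) ?_ ?_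
    · rw [Expr.ok_mem]
      refine ok_cell hw (by simp [hr.base_eq]) (by decide) (by rw [Expr.ok_var]; decide) ?_
      simp only [Expr.eval_var, State.upd_reg, if_true]
      omega
    · rw [Expr.eval_mem, eval_cell (k := k) (by simp [hr.base_eq])]
      simp only [Expr.eval_var, State.upd_reg, if_true, State.upd_mem]
      refine ⟨⟨fun r hr => ?_, rfl, by simp⟩, by simp, lt_of_degreeAnswer_pos hpos, hpos⟩
      simp at hr
      simp [hr]
  · rw [Expr.eval_var, hr.flag_eq] at h
    rw [vertexDist]
    refine Tri.seq_tb (Q := fun e σ' => e ∈ G.edgeFinset ∧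
      σ' = ((σ.addq 1).upd 24 (e.inf : Fin n)).upd 23 (e.sup : Fin n))
      (Tri.edgeSample (by nlinarith) hE fun e he => ⟨he, rfl⟩) ?_
    rintro e σ' ⟨he, rfl⟩
    rw [← PMF.bind_pure_comp]
    refine Tri.seq_tb (Tri.rnd (Q := fun i σ' => σ' =
      (((σ.addq 1).upd 24 (e.inf : Fin n)).upd 23 (e.sup : Fin n)).upd 26 i) hW
      (by rw [Expr.ok_lit]; omega) (by simp [Expr.eval]) (fun i hi => rfl)) ?_
    rintro i σ' rfl
    have hends : 0 < degreeAnswer G (e.inf : Fin n) ∧ 0 < degreeAnswer G (e.sup : Fin n) := by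
      rw [degreeAnswer_fin, degreeAnswer_fin, G.degree_pos_iff_exists_adj,
        G.degree_pos_iff_exists_adj]
      induction e with
      | _ a b =>
        have hab : G.Adj a b := by simpa using he
        simp only [Sym2.inf_mk, Sym2.sup_mk]
        rcases le_total a b with h | h
        · simp only [inf_eq_left.2 h, sup_eq_right.2 h]
          exact ⟨⟨_, hab⟩, ⟨_, hab.symm⟩⟩
        · simp only [inf_eq_right.2 h, sup_eq_left.2 h]
          exact ⟨⟨_, hab.symm⟩, ⟨_, hab⟩⟩
    refine Tri.ifc_tb hW (by rw [Expr.ok_var]; decide) (fun h' => ?_) (fun h' => ?_)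
    · simp only [Expr.eval_var, State.upd_reg, if_true] at h'
      refine Tri.asg hW (by decide) (by rw [Expr.ok_var]; decide) ?_
      simp only [if_neg h']
      refine ⟨⟨fun r hr => ?_, rfl, by simp [h]⟩, by simp [Expr.eval_var], Fin.isLt _, hends.2⟩
      simp at hr
      simp [hr]
    · simp only [Expr.eval_var, State.upd_reg, if_true] at h'
      refine Tri.skip ?_
      simp only [if_pos h']
      refine ⟨⟨fun r hr => ?_, rfl, by simp [h]⟩, by simp, Fin.isLt _, hends.1⟩
      simp at hr
      simp [hr]

end Primitives

/-! ### Sampling the map and checking it -/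

open SubgraphCount.Expr in
/-- Choose the image of the vertex in register 21. -/
def stageProg : Prog :=
  .seq (.rnd 22 (var 5)) (.seq
    (.ifc (lt (var 22) (var 21) * mem (var 21 * var 5 + var 22))
      (.seq (.asg 23 (mem (cell 0 (var 22)))) (.seq (.asg 25 (mem (cell 1 (var 22))))
        sampleNeighbor))
      sampleVertex)
    (.seq getDegree (.seq (.sto (cell 0 (var 21)) (var 24)) (.sto (cell 1 (var 21)) (var 25)))))

open SubgraphCount.Expr in
/-- Check one pair of vertices. -/
def checkProg : Prog :=
  .seq (.asg 23 (mem (cell 0 (var 22 / var 5)))) (.seq (.asg 24 (mem (cell 0 (var 22 % var 5))))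
    (.seq getPair (.asg 27 (var 27 + ((lit 1 - var 26) * mem (var 22) +
      (lit 1 - eq (var 22 / var 5) (var 22 % var 5)) * eq (var 23) (var 24))))))

section Trial

variable {n k : ℕ} {G : SimpleGraph (Fin n)} [DecidableRel G.Adj]
  {nbr : ∀ v : Fin n, Fin (G.degree v) ≃ G.neighborSet v}
  {H : SimpleGraph (Fin k)} [DecidableRel H.Adj] {w X A fl : ℕ} {σ σ' σ'' : State}

theorem Frame.trans {S T : List ℕ} {c d : ℕ} (h : Frame S c σ σ') (h' : Frame T d σ' σ'') :
    Frame (S ++ T) (c + d) σ σ'' := by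
  refine ⟨fun r hr => ?_, h'.mem.trans h.mem, ?_⟩
  · rw [List.mem_append, not_or] at hr
    exact (h'.reg r hr.2).trans (h.reg r hr.1)
  · have h1 := h.queries
    have h2 := h'.queries
    omega

theorem Frame.upd (σ : State) (x v : ℕ) : Frame [x] 0 σ (σ.upd x v) := by
  refine ⟨fun r hr => ?_, rfl, by simp⟩
  simp at hr
  simp [hr]

theorem Frame.reg_lt {S : List ℕ} {c b : ℕ} (h : Frame S c σ σ') (hS : ∀ x ∈ S, b ≤ x) :
    ∀ r < b, σ'.reg r = σ.reg r :=
  fun r hr => h.reg r fun hm => absurd (hS r hm) (by omega)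

theorem RegGood.congr (h : RegGood G k A fl σ) (h' : ∀ r < 20, σ'.reg r = σ.reg r) :
    RegGood G k A fl σ' :=
  ⟨(h' 0 (by omega)).trans h.n_eq, (h' 1 (by omega)).trans h.m_eq, (h' 5 (by omega)).trans h.k_eq,
    (h' 6 (by omega)).trans h.base_eq, (h' 11 (by omega)).trans h.acc_eq,
    (h' 13 (by omega)).trans h.flag_eq⟩

/-- The images in `l` and their degrees are stored in the first two arrays. -/
def Holds (G : SimpleGraph (Fin n)) [DecidableRel G.Adj] (k : ℕ) (l : List ℕ) (mem : ℕ → ℕ) :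
    Prop :=
  ∀ j < l.length, l.getD j 0 < n ∧ 0 < degreeAnswer G (l.getD j 0) ∧
    mem (addr k 0 j) = l.getD j 0 ∧ mem (addr k 1 j) = degreeAnswer G (l.getD j 0)

/-- The situation before the choice of the image of vertex `i`. -/
structure StageInv (G : SimpleGraph (Fin n)) [DecidableRel G.Adj]
    (nbr : ∀ v : Fin n, Fin (G.degree v) ≃ G.neighborSet v)
    (H : SimpleGraph (Fin k)) [DecidableRel H.Adj] (fl : ℕ) (σ₀ : State) (i : ℕ) (l : List ℕ)
    (σ : State) : Prop where
  index : σ.reg 21 = i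
  reg : ∀ r < 21, σ.reg r = σ₀.reg r
  mem : MemGood G nbr H fl σ.mem
  length : l.length = i
  holds : Holds G k l σ.mem
  queries : σ.queries ≤ σ₀.queries + i * (2 * (1 - fl))

/-- A stage makes at most two queries: one for the image and one for its degree. -/
theorem tri_stageProg (hE : G.edgeFinset.Nonempty) (hk : (Finset.range k).Nonempty)
    (hw : WordGood G k A w) {σ₀ : State} (hr₀ : RegGood G k A fl σ₀) {i : ℕ} (hi : i < k)
    {l : List ℕ} (h : StageInv G nbr H fl σ₀ i l σ) :
    Tri G nbr w stageProg (stageProg.tb X) σ ((stage G nbr H hE hk i l).map fun v => l ++ [v])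
      fun l' σ' => σ'.reg 21 = i ∧ StageInv G nbr H fl σ₀ (i + 1) l' (σ'.upd 21 (i + 1)) := by
  have hW := hw.one_lt
  have hsq := hw.square
  have hkk := hw.k_sq_le
  have hkn := hw.k_le
  have hnn : n ≤ n * n := Nat.le_mul_self n
  have hr : RegGood G k A fl σ := hr₀.congr fun r hr => h.reg r (by omega)
  rw [stage, PMF.map_bind]
  have hev : (Expr.var 5).eval σ [] = k := by rw [Expr.eval_var, hr.k_eq]
  have hne' : (Finset.range ((Expr.var 5).eval σ [])).Nonempty := by rwa [hev]
  have hrnd := Tri.rnd (G := G) (nbr := nbr) (X := X) (x := 22) (e := .var 5) (σ := σ)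
    (Q := fun j σ' => j < k ∧ σ' = σ.upd 22 j) hW (by rw [Expr.ok_var]; decide) hne'
    (fun j hj => ⟨by rwa [hev] at hj, rfl⟩)
  have hdist : PMF.uniformOfFinset (Finset.range ((Expr.var 5).eval σ [])) hne' =
      PMF.uniformOfFinset (Finset.range k) hk := by congr 2
  refine Tri.seq_tb (hrnd.of_eq hdist) ?_
  rintro j σ₁ ⟨hj, rfl⟩
  rw [← PMF.bind_pure_comp]
  have hij := mul_add_lt_sq hi hj
  have h6 : (σ.upd 22 j).reg 6 = k * k := by simp [hr.base_eq]
  -- The conjunction is computed as the product of two numbers in `{0, 1}`.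
  have hcond : (Expr.lt (.var 22) (.var 21) * .mem (.var 21 * .var 5 + .var 22)).eval
      (σ.upd 22 j) [] = (if j < i then 1 else 0) * pairAnswer H i j := by
    simp only [Expr.eval_mul, Expr.eval_lt, Expr.eval_var, Expr.eval_mem, Expr.eval_add]
    simp [h.index, hr.k_eq, h.mem.mem_pattern hi hj]
  have hcok : (Expr.lt (.var 22) (.var 21) * .mem (.var 21 * .var 5 + .var 22)).Ok (2 ^ w) X
      (σ.upd 22 j) [] := by
    rw [Expr.ok_mul, ← Expr.eval_mul, hcond]
    simp only [Expr.ok_lt, Expr.ok_mem, Expr.ok_add, Expr.ok_mul, Expr.ok_var, Expr.eval_var,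
      Expr.eval_mul]
    refine ⟨⟨by decide, by decide⟩, ⟨⟨by decide, by decide, ?_⟩, by decide, ?_⟩, ?_⟩
    · simp [h.index, hr.k_eq]; omega
    · simp [h.index, hr.k_eq]; omega
    · have := pairAnswer_le_one (G := H) i j
      split_ifs <;> omega
  have hr₁ : RegGood G k A fl (σ.upd 22 j) :=
    hr.congr ((Frame.upd σ 22 j).reg_lt (by decide))
  -- Both ways of choosing the image meet in this postcondition, which also keeps the positivity of
  -- the degree for `Holds`.
  refine Tri.seq_tb (Q := fun v σ' => Frame [22, 23, 24, 25, 26] (1 - fl) σ σ' ∧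
    σ'.reg 24 = v ∧ v < n ∧ 0 < degreeAnswer G v) ?_ ?_
  · refine Tri.ifc_tb hW hcok (fun hc => ?_) (fun hc => ?_)
    · rw [hcond] at hc
      have hlt : j < i := by
        by_contra hc'
        simp [hc'] at hc
      have hH : pairAnswer H i j ≠ 0 := by
        intro hc'
        simp [hc'] at hc
      rw [if_pos ⟨hlt, hH⟩]
      obtain ⟨g1, g2, g3, g4⟩ := h.holds j (by rw [h.length]; exact hlt)
      have e0 : (Expr.mem (.cell 0 (.var 22))).eval (σ.upd 22 j) [] = l.getD j 0 := by
        rw [Expr.eval_mem, eval_cell h6]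
        simpa [Expr.eval_var] using g3
      refine Tri.asg_seq hW (by decide) ?_ ?_
      · rw [Expr.ok_mem]
        refine ok_cell hw h6 (by decide) (by rw [Expr.ok_var]; decide) ?_
        simp only [Expr.eval_var, State.upd_reg, if_true]
        omega
      rw [e0]
      have h6' : ((σ.upd 22 j).upd 23 (l.getD j 0)).reg 6 = k * k := by simp [hr.base_eq]
      have e1 : (Expr.mem (.cell 1 (.var 22))).eval ((σ.upd 22 j).upd 23 (l.getD j 0)) [] =
          degreeAnswer G (l.getD j 0) := by
        rw [Expr.eval_mem, eval_cell h6']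
        simpa [Expr.eval_var] using g4
      refine Tri.asg_seq hW (by decide) ?_ ?_
      · rw [Expr.ok_mem]
        refine ok_cell hw h6' (by decide) (by rw [Expr.ok_var]; decide) ?_
        simp [Expr.eval_var]
        omega
      rw [e1]
      have hF := ((Frame.upd σ 22 j).trans (Frame.upd _ 23 (l.getD j 0))).trans
        (Frame.upd _ 25 (degreeAnswer G (l.getD j 0)))
      refine (tri_sampleNeighbor (X := X) (H := H) hw (hr.congr (hF.reg_lt (by decide))) h.mem
        g1 (by simp) (by simp) g2).conseq ?_
      rintro v σ' ⟨hF', e, e', e''⟩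
      refine ⟨⟨fun r hr => ?_, ?_, ?_⟩, e, e', e''⟩
      · exact (hF.trans hF').reg r (by simp at hr ⊢; tauto)
      · exact (hF.trans hF').mem
      · have := (hF.trans hF').queries
        omega
    · rw [hcond] at hc
      rw [if_neg]
      · refine (tri_sampleVertex (X := X) (H := H) hE hw hr₁ h.mem).conseq ?_
        rintro v σ' ⟨hF', e, e', e''⟩
        have hF := (Frame.upd σ 22 j).trans hF'
        refine ⟨⟨fun r hr => ?_, hF.mem, ?_⟩, e, e', e''⟩
        · exact hF.reg r (by simp at hr ⊢; tauto)
        · have := hF.queries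
          omega
      · rintro ⟨hlt, hH⟩
        simp [hlt] at hc
        exact hH hc
  · rintro v σ₂ ⟨hF, h24, hv, hdv⟩
    have hr₂ : RegGood G k A fl σ₂ := hr.congr (hF.reg_lt (by decide))
    have hm₂ : MemGood G nbr H fl σ₂.mem := by rw [hF.mem]; exact h.mem
    refine Tri.seq_det_tb (tri_getDegree hw hr₂ hm₂ hv h24) ?_
    rintro σ₃ ⟨hF', h25⟩
    have hF₃ := hF.trans hF'
    have hr₃ : RegGood G k A fl σ₃ := hr.congr (hF₃.reg_lt (by decide))
    have h21 : σ₃.reg 21 = i := (hF₃.reg 21 (by decide)).trans h.index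
    have h24' : σ₃.reg 24 = v := (hF'.reg 24 (by decide)).trans h24
    have hok0 : (Expr.cell 0 (.var 21)).Ok (2 ^ w) X σ₃ [] :=
      ok_cell hw hr₃.base_eq (by decide) (by rw [Expr.ok_var]; decide)
        (by rw [Expr.eval_var, h21]; omega)
    refine Tri.sto_seq hW hok0 (by rw [Expr.ok_var]; decide) ?_
    rw [eval_cell hr₃.base_eq, Expr.eval_var, Expr.eval_var, h21, h24']
    set σ₄ := σ₃.put (addr k 0 i) v with hσ₄
    have h6 : σ₄.reg 6 = k * k := hr₃.base_eq
    have h21' : σ₄.reg 21 = i := h21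
    refine Tri.sto hW ?_ (by rw [Expr.ok_var]; decide) ?_
    · exact ok_cell hw h6 (by decide) (by rw [Expr.ok_var]; decide)
        (by rw [Expr.eval_var, h21']; omega)
    · rw [eval_cell h6, Expr.eval_var, Expr.eval_var, h21', show σ₄.reg 25 = _ from h25]
      have hm₃ : MemGood G nbr H fl σ₃.mem := by rw [hF₃.mem]; exact h.mem
      refine ⟨h21', by simp, ?_, ?_, by simp [h.length], ?_, ?_⟩
      · intro r hr
        rw [State.upd_reg, if_neg (by omega)]
        exact (hF₃.reg_lt (b := 21) (by decide) r hr).trans (h.reg r hr)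
      · exact (hm₃.put (by decide) i v).put (by decide) i (degreeAnswer G v)
      · intro j' hj'
        rw [List.length_append, List.length_singleton, h.length] at hj'
        simp only [State.upd_mem, State.put_mem, hσ₄]
        rcases Nat.lt_succ_iff_lt_or_eq.1 hj' with hlt | rfl
        · obtain ⟨g1, g2, g3, g4⟩ := h.holds j' (by rw [h.length]; exact hlt)
          rw [List.getD_append _ _ _ _ (by rw [h.length]; exact hlt)]
          refine ⟨g1, g2, ?_, ?_⟩
          · rw [if_neg (by rw [addr_inj] <;> omega), if_neg (by rw [addr_inj] <;> omega), hF₃.mem, g3]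
          · rw [if_neg (by rw [addr_inj] <;> omega), if_neg (by rw [addr_inj] <;> omega), hF₃.mem, g4]
        · rw [List.getD_append_right _ _ _ _ h.length.le, h.length, Nat.sub_self]
          refine ⟨hv, hdv, ?_, ?_⟩
          · rw [if_neg (by rw [addr_inj] <;> omega), if_pos rfl]
            rfl
          · rw [if_pos rfl]
            rfl
      · have h1 := hF₃.queries
        have h2 := h.queries
        have e := add_one_mul i (2 * (1 - fl))
        simp only [State.upd_queries, State.put_queries, hσ₄]
        omega

/-- The summands of `violations`. -/
def violation (G : SimpleGraph (Fin n)) [DecidableRel G.Adj] (H : SimpleGraph (Fin k))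
    [DecidableRel H.Adj] (l : List ℕ) (t : ℕ) : ℕ :=
  (1 - pairAnswer G (l.getD (t / k) 0) (l.getD (t % k) 0)) * pairAnswer H (t / k) (t % k) +
    (1 - if t / k = t % k then 1 else 0) * if l.getD (t / k) 0 = l.getD (t % k) 0 then 1 else 0

theorem violation_le_two (l : List ℕ) (t : ℕ) : violation G H l t ≤ 2 := by
  unfold violation
  have h1 := pairAnswer_le_one (G := H) (t / k) (t % k)
  have h2 : (1 - pairAnswer G (l.getD (t / k) 0) (l.getD (t % k) 0)) * pairAnswer H (t / k) (t % k)
      ≤ 1 * 1 := Nat.mul_le_mul (Nat.sub_le _ _) h1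
  split_ifs <;> omega

/-- The situation before the check of pair `t`. -/
structure CheckInv (G : SimpleGraph (Fin n)) [DecidableRel G.Adj]
    (nbr : ∀ v : Fin n, Fin (G.degree v) ≃ G.neighborSet v)
    (H : SimpleGraph (Fin k)) [DecidableRel H.Adj] (fl : ℕ) (σ₀ : State) (l : List ℕ) (t : ℕ)
    (σ : State) : Prop where
  index : σ.reg 22 = t
  reg : ∀ r < 21, σ.reg r = σ₀.reg r
  sum : σ.reg 27 = ∑ x ∈ Finset.range t, violation G H l x
  mem : MemGood G nbr H fl σ.mem
  holds : Holds G k l σ.mem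
  queries : σ.queries ≤ σ₀.queries + k * (2 * (1 - fl)) + t * (1 - fl)

theorem tri_checkProg (hw : WordGood G k A w) {σ₀ : State} (hr₀ : RegGood G k A fl σ₀)
    {l : List ℕ} (hl : l.length = k) {t : ℕ} (ht : t < k * k)
    (h : CheckInv G nbr H fl σ₀ l t σ) :
    Tri G nbr w checkProg (checkProg.tb X) σ (PMF.pure ()) fun _ σ' => σ'.reg 22 = t ∧
      CheckInv G nbr H fl σ₀ l (t + 1) (σ'.upd 22 (t + 1)) := by
  have hW := hw.one_lt
  have hsq := hw.square
  have hkk := hw.k_sq_le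
  have hkn := hw.k_le
  have hk0 := hw.k_pos
  have hnn : n ≤ n * n := Nat.le_mul_self n
  have hr : RegGood G k A fl σ := hr₀.congr fun r hr => h.reg r (by omega)
  have h1 : t / k < k := Nat.div_lt_of_lt_mul ht
  have h2 : t % k < k := Nat.mod_lt _ hk0
  obtain ⟨a1, a2, a3, a4⟩ := h.holds (t / k) (by omega)
  obtain ⟨b1, b2, b3, b4⟩ := h.holds (t % k) (by omega)
  have e0 : (Expr.mem (.cell 0 (.var 22 / .var 5))).eval σ [] = l.getD (t / k) 0 := by
    rw [Expr.eval_mem, eval_cell hr.base_eq, Expr.eval_div, Expr.eval_var, Expr.eval_var, h.index,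
      hr.k_eq, a3]
  refine Tri.asg_seq hW (by decide) ?_ ?_
  · rw [Expr.ok_mem]
    refine ok_cell hw hr.base_eq (by decide) ?_ ?_
    · simp only [Expr.ok_div, Expr.ok_var]
      exact ⟨by decide, by decide⟩
    · rw [Expr.eval_div, Expr.eval_var, Expr.eval_var, h.index, hr.k_eq]
      omega
  rw [e0]
  have h6 : (σ.upd 23 (l.getD (t / k) 0)).reg 6 = k * k := by simp [hr.base_eq]
  have h5 : (σ.upd 23 (l.getD (t / k) 0)).reg 5 = k := by simp [hr.k_eq]
  have h22 : (σ.upd 23 (l.getD (t / k) 0)).reg 22 = t := by simp [h.index]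
  have e1 : (Expr.mem (.cell 0 (.var 22 % .var 5))).eval (σ.upd 23 (l.getD (t / k) 0)) [] =
      l.getD (t % k) 0 := by
    rw [Expr.eval_mem, eval_cell h6, Expr.eval_mod, Expr.eval_var, Expr.eval_var, h22, h5,
      State.upd_mem, b3]
  refine Tri.asg_seq hW (by decide) ?_ ?_
  · rw [Expr.ok_mem]
    refine ok_cell hw h6 (by decide) ?_ ?_
    · simp only [Expr.ok_mod, Expr.ok_var]
      exact ⟨by decide, by decide⟩
    · rw [Expr.eval_mod, Expr.eval_var, Expr.eval_var, h22, h5]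
      omega
  rw [e1]
  have hF := (Frame.upd σ 23 (l.getD (t / k) 0)).trans (Frame.upd _ 24 (l.getD (t % k) 0))
  set σ₁ := (σ.upd 23 (l.getD (t / k) 0)).upd 24 (l.getD (t % k) 0) with hσ₁
  refine Tri.seq_det_tb (tri_getPair (H := H) (u := l.getD (t / k) 0) (v := l.getD (t % k) 0) hw
    (hr.congr (hF.reg_lt (by decide))) (by rw [hF.mem]; exact h.mem) a1 b1 (by simp [hσ₁])
    (by simp [hσ₁])) ?_
  rintro σ₂ ⟨hF', h26⟩
  have hF₂ := hF.trans hF'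
  have h23 : σ₂.reg 23 = l.getD (t / k) 0 := (hF'.reg 23 (by decide)).trans (by simp [hσ₁])
  have h24 : σ₂.reg 24 = l.getD (t % k) 0 := (hF'.reg 24 (by decide)).trans (by simp [hσ₁])
  have h22' : σ₂.reg 22 = t := (hF₂.reg 22 (by decide)).trans h.index
  have h27' : σ₂.reg 27 = ∑ x ∈ Finset.range t, violation G H l x :=
    (hF₂.reg 27 (by decide)).trans h.sum
  have h5' : σ₂.reg 5 = k := (hF₂.reg 5 (by decide)).trans hr.k_eq
  have hmt : σ₂.mem t = pairAnswer H (t / k) (t % k) := by rw [hF₂.mem, h.mem.pattern t ht]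
  have hval : (Expr.var 27 + ((Expr.lit 1 - .var 26) * .mem (.var 22) +
      (.lit 1 - .eq (.var 22 / .var 5) (.var 22 % .var 5)) * .eq (.var 23) (.var 24))).eval σ₂ [] =
      ∑ x ∈ Finset.range (t + 1), violation G H l x := by
    simp only [Expr.eval_add, Expr.eval_mul, Expr.eval_sub, Expr.eval_var, Expr.eval_lit,
      Expr.eval_mem, Expr.eval_eq, Expr.eval_div, Expr.eval_mod, h22', h23, h24, h26, h27', h5',
      hmt, Finset.sum_range_succ, violation]
  -- Each pair adds at most 2, so the counter stays at most `2 * k * k` and fits into a word.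
  have hsum : ∑ x ∈ Finset.range (t + 1), violation G H l x ≤ (t + 1) * 2 := by
    have := Finset.sum_le_card_nsmul (Finset.range (t + 1)) (violation G H l) 2
      fun x _ => violation_le_two l x
    simpa using this
  rw [Finset.sum_range_succ] at hsum
  have hviol : violation G H l t ≤ 2 := violation_le_two l t
  refine Tri.asg hW (by decide) ?_ ?_
  · have hp := pairAnswer_le_one (G := H) (t / k) (t % k)
    have hpm : (1 - pairAnswer G (l.getD (t / k) 0) (l.getD (t % k) 0)) *
        pairAnswer H (t / k) (t % k) ≤ 1 * 1 := Nat.mul_le_mul (Nat.sub_le _ _) hp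
    simp only [Expr.ok_add, Expr.ok_mul, Expr.ok_sub, Expr.ok_var, Expr.ok_lit,
      Expr.ok_mem, Expr.ok_eq, Expr.ok_div, Expr.ok_mod, Expr.eval_add, Expr.eval_mul,
      Expr.eval_sub, Expr.eval_var, Expr.eval_lit, Expr.eval_mem, Expr.eval_eq, Expr.eval_div,
      Expr.eval_mod, h22', h23, h24, h26, h27', h5', hmt]
    refine ⟨by decide, ⟨⟨⟨hW, by decide⟩, by decide, by omega⟩, ⟨⟨hW, ⟨by decide, by decide⟩,
      by decide, by decide⟩, ⟨by decide, by decide⟩, ?_⟩, ?_⟩, ?_⟩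
    · split_ifs <;> omega
    · rw [← violation]
      omega
    · rw [← violation]
      omega
  · rw [hval]
    refine ⟨by simp [h22'], by simp, ?_, by simp, ?_, ?_, ?_⟩
    · intro r hr
      simp only [State.upd_reg]
      rw [if_neg (by omega), if_neg (by omega)]
      exact (hF₂.reg_lt (b := 21) (by decide) r hr).trans (h.reg r hr)
    · simp only [State.upd_mem]
      rw [hF₂.mem]
      exact h.mem
    · simp only [State.upd_mem]
      rw [hF₂.mem]
      exact h.holds
    · have h1 := hF₂.queries
      have h2 := h.queries
      have e := add_one_mul t (1 - fl)
      simp only [State.upd_queries]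
      omega

end Trial

/-! ### Exact rejection sampling and a complete trial -/

open SubgraphCount.Expr in
/-- The common denominator of the probabilities. -/
def denomExpr : Expr := iter (var 5) (var 1 + var 1) (loc 0 * mem (cell 1 (loc 1)))

open SubgraphCount.Expr in
/-- A summand of `stageNum`, for `i` in `loc 3` and `j` in `loc 1`. -/
def stageTermExpr : Expr :=
  lt (loc 1) (loc 3) * mem (loc 3 * var 5 + loc 1) * (var 25 / mem (cell 1 (loc 1))) +
    (lit 1 - lt (loc 1) (loc 3) * mem (loc 3 * var 5 + loc 1)) *
      (var 25 / (var 1 + var 1) * mem (cell 1 (loc 3)))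

open SubgraphCount.Expr in
/-- The product of all `stageNum`. -/
def numExpr : Expr := iter (var 5) (lit 1) (loc 0 * iter (var 5) (lit 0) (loc 0 + stageTermExpr))

open SubgraphCount.Expr in
/-- Accept or reject the sampled map, and count the acceptances in register 15. -/
def acceptProg : Prog :=
  .seq (.asg 25 denomExpr) (.seq (.asg 26 (var 11 * numExpr))
    (.seq (.asg 24 (iter (var 5) (lit 1) (loc 0 * var 25))) (.seq (.rnd 28 (var 26))
      (.asg 15 (var 15 + eq (var 27) (lit 0) * lt (var 28) (var 24))))))

open SubgraphCount.Expr in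
/-- One trial. -/
def trialProg : Prog :=
  .seq (.forc 21 (var 5) stageProg) (.seq (.asg 27 (lit 0))
    (.seq (.forc 22 (var 5 * var 5) checkProg) acceptProg))

section Acceptance

variable {n k : ℕ} {G : SimpleGraph (Fin n)} [DecidableRel G.Adj]
  {nbr : ∀ v : Fin n, Fin (G.degree v) ≃ G.neighborSet v}
  {H : SimpleGraph (Fin k)} [DecidableRel H.Adj] {w X A fl : ℕ} {σ : State} {l : List ℕ}

/-- `Ok` has a condition for every intermediate accumulator, so all partial products have to be
known, not only the final value. -/
theorem denomExpr_partial (hr : RegGood G k A fl σ) (hl : l.length = k)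
    (hh : Holds G k l σ.mem) {i : ℕ} (hi : i ≤ k) :
    iterate (fun i acc => (Expr.loc 0 * .mem (.cell 1 (.loc 1))).eval σ (acc :: i :: []))
      ((Expr.var 1 + .var 1).eval σ []) i =
    2 * G.edgeFinset.card * ∏ j ∈ Finset.range i, degreeAnswer G (l.getD j 0) := by
  rw [Expr.eval_add, Expr.eval_var, hr.m_eq, ← two_mul, ← iterate_mul]
  refine iterate_congr fun j hj acc => ?_
  rw [Expr.eval_mul, Expr.eval_mem, eval_cell hr.base_eq]
  simp only [Expr.eval_loc, List.getD_cons_zero, List.getD_cons_succ]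
  rw [(hh j (by omega)).2.2.2]

theorem denomExpr_eval (hr : RegGood G k A fl σ) (hl : l.length = k)
    (hh : Holds G k l σ.mem) : denomExpr.eval σ [] = commonDenom (k := k) G l := by
  rw [denomExpr, Expr.eval_iter, denomExpr_partial hr hl hh]
  · rw [Expr.eval_var, hr.k_eq]
    rfl
  · rw [Expr.eval_var, hr.k_eq]

theorem partialDenom_le (hw : WordGood G k A w) {i : ℕ} (hi : i ≤ k) :
    2 * G.edgeFinset.card * ∏ j ∈ Finset.range i, degreeAnswer G (l.getD j 0) ≤
      2 * G.edgeFinset.card * n ^ k := by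
  refine Nat.mul_le_mul_left _ ?_
  calc ∏ j ∈ Finset.range i, degreeAnswer G (l.getD j 0) ≤ ∏ _j ∈ Finset.range i, n :=
        Finset.prod_le_prod' fun j _ => degreeAnswer_le _
    _ = n ^ i := by simp
    _ ≤ n ^ k := Nat.pow_le_pow_right hw.n_pos hi

theorem WordGood.pos (hw : WordGood G k A w) :
    0 < k * (2 * G.edgeFinset.card * n ^ k) := by
  have := hw.n_pos
  have := hw.m_pos
  have := hw.k_pos
  positivity

theorem WordGood.pow_lt (hw : WordGood G k A w) (hA : 0 < A) {i : ℕ} (hi : i ≤ k) :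
    (k * (2 * G.edgeFinset.card * n ^ k)) ^ i < 2 ^ w :=
  calc (k * (2 * G.edgeFinset.card * n ^ k)) ^ i ≤ (k * (2 * G.edgeFinset.card * n ^ k)) ^ k :=
        Nat.pow_le_pow_right hw.pos hi
    _ ≤ A * (k * (2 * G.edgeFinset.card * n ^ k)) ^ k := Nat.le_mul_of_pos_left _ hA
    _ < 2 ^ w := hw.power

theorem WordGood.denom_lt (hw : WordGood G k A w) (hA : 0 < A) :
    2 * G.edgeFinset.card * n ^ k < 2 ^ w := by
  have h1 := hw.pow_lt hA (i := 1) hw.k_pos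
  rw [pow_one] at h1
  exact lt_of_le_of_lt (Nat.le_mul_of_pos_left _ hw.k_pos) h1

theorem denomExpr_ok (hw : WordGood G k A w) (hA : 0 < A) (hr : RegGood G k A fl σ)
    (hl : l.length = k) (hh : Holds G k l σ.mem) (hX : k ≤ X) :
    denomExpr.Ok (2 ^ w) X σ [] := by
  have hlt := hw.denom_lt hA
  have hmn := two_mul_card_edgeFinset_le (G := G)
  have hsq := hw.square
  have hkn := hw.k_le
  have hnn : n ≤ n * n := Nat.le_mul_self n
  rw [denomExpr, Expr.ok_iter, Expr.eval_var, hr.k_eq]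
  refine ⟨by rw [Expr.ok_var]; decide, ?_, hX, fun i hi => ?_⟩
  · rw [Expr.ok_add, Expr.eval_var, hr.m_eq, Expr.ok_var]
    exact ⟨by decide, by decide, by omega⟩
  · rw [denomExpr_partial hr hl hh hi.le, Expr.ok_mul, Expr.ok_mem, Expr.eval_mem,
      eval_cell hr.base_eq]
    simp only [Expr.eval_loc, List.getD_cons_zero, List.getD_cons_succ, Expr.ok_loc,
      List.length_cons, List.length_nil]
    refine ⟨by decide, ?_, ?_⟩
    · refine ok_cell hw hr.base_eq (by decide) ?_ ?_
      · rw [Expr.ok_loc]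
        simp
      · simp only [Expr.eval_loc, List.getD_cons_zero, List.getD_cons_succ]
        omega
    · rw [(hh i (by omega)).2.2.2, mul_assoc, ← Finset.prod_range_succ]
      exact (partialDenom_le hw hi).trans_lt hlt

/-- The summands of `stageNum`. -/
def stageTerm (G : SimpleGraph (Fin n)) [DecidableRel G.Adj] (H : SimpleGraph (Fin k))
    [DecidableRel H.Adj] (l : List ℕ) (i j : ℕ) : ℕ :=
  if j < i ∧ pairAnswer H i j ≠ 0 then
    commonDenom (k := k) G l / degreeAnswer G (l.getD j 0)
  else commonDenom (k := k) G l / (2 * G.edgeFinset.card) * degreeAnswer G (l.getD i 0)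

/-- In the second case, `d ≤ 2m` is what keeps the term below the common denominator. -/
theorem stageTerm_le (l : List ℕ) (i j : ℕ) :
    stageTerm G H l i j ≤ commonDenom (k := k) G l := by
  unfold stageTerm
  split_ifs
  · exact Nat.div_le_self _ _
  · calc commonDenom (k := k) G l / (2 * G.edgeFinset.card) * degreeAnswer G (l.getD i 0) ≤
        commonDenom (k := k) G l / (2 * G.edgeFinset.card) * (2 * G.edgeFinset.card) :=
          Nat.mul_le_mul_left _ (degreeAnswer_le_two_mul _)
      _ ≤ _ := Nat.div_mul_le_self _ _

/-- The case distinction of `stageTerm` is computed without branching, as `c * x + (1 - c) * y` with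
`c` in `{0, 1}`. The bound variables are the inner accumulator `a`, the index `j`, the outer
accumulator `b` and the index `i`. -/
theorem stageTermExpr_spec (hw : WordGood G k A w) (hA : 0 < A) (hr : RegGood G k A fl σ)
    (hm : MemGood G nbr H fl σ.mem) (hl : l.length = k) (hh : Holds G k l σ.mem)
    (h25 : σ.reg 25 = commonDenom (k := k) G l) {i j : ℕ} (hi : i < k) (hj : j < k) (a b : ℕ) :
    stageTermExpr.eval σ [a, j, b, i] = stageTerm G H l i j ∧
      stageTermExpr.Ok (2 ^ w) X σ [a, j, b, i] := by
  have hlt := hw.denom_lt hA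
  have hW := hw.one_lt
  have hmn := two_mul_card_edgeFinset_le (G := G)
  have hsq := hw.square
  have hkn := hw.k_le
  have hkk := hw.k_sq_le
  have hnn : n ≤ n * n := Nat.le_mul_self n
  have hij := mul_add_lt_sq hi hj
  have hB : commonDenom (k := k) G l < 2 ^ w := (partialDenom_le hw le_rfl).trans_lt hlt
  have hp := pairAnswer_le_one (G := H) i j
  have t1 : commonDenom (k := k) G l / degreeAnswer G (l.getD j 0) ≤ commonDenom (k := k) G l :=
    Nat.div_le_self _ _
  have t2 : commonDenom (k := k) G l / (2 * G.edgeFinset.card) * degreeAnswer G (l.getD i 0) ≤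
      commonDenom (k := k) G l :=
    (Nat.mul_le_mul_left _ (degreeAnswer_le_two_mul _)).trans (Nat.div_mul_le_self _ _)
  have hpat : σ.mem (i * k + j) = pairAnswer H i j := hm.mem_pattern hi hj
  have hci : (Expr.cell 1 (.loc 3)).Ok (2 ^ w) X σ [a, j, b, i] := by
    refine ok_cell hw hr.base_eq (by decide) ?_ ?_
    · rw [Expr.ok_loc]; simp
    · simp only [Expr.eval_loc, List.getD_cons_zero, List.getD_cons_succ]; omega
  have hcj : (Expr.cell 1 (.loc 1)).Ok (2 ^ w) X σ [a, j, b, i] := by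
    refine ok_cell hw hr.base_eq (by decide) ?_ ?_
    · rw [Expr.ok_loc]; simp
    · simp only [Expr.eval_loc, List.getD_cons_zero, List.getD_cons_succ]; omega
  have gi := (hh i (by omega)).2.2.2
  have gj := (hh j (by omega)).2.2.2
  have hc : (if j < i then 1 else 0) * pairAnswer H i j = 1 ∧ (j < i ∧ pairAnswer H i j ≠ 0) ∨
      (if j < i then 1 else 0) * pairAnswer H i j = 0 ∧ ¬ (j < i ∧ pairAnswer H i j ≠ 0) := by
    split_ifs with h
    · simp only [one_mul, h, true_and]
      omega
    · simp [h]
  simp only [stageTermExpr, Expr.eval_add, Expr.eval_mul, Expr.eval_sub, Expr.eval_div,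
    Expr.eval_lt, Expr.eval_mem, eval_cell hr.base_eq, Expr.eval_loc, Expr.eval_var, Expr.eval_lit,
    Expr.ok_add, Expr.ok_mul, Expr.ok_sub, Expr.ok_div, Expr.ok_lt, Expr.ok_mem, Expr.ok_loc,
    Expr.ok_var, Expr.ok_lit, List.getD_cons_zero, List.getD_cons_succ, hr.k_eq, hr.m_eq, hpat, gi,
    gj, h25, ← two_mul, List.length_cons, List.length_nil, stageTerm]
  refine ⟨?_, ⟨⟨⟨by decide, by decide⟩, ⟨⟨by decide, by decide, by omega⟩, by decide, by omega⟩,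
    ?_⟩, ⟨by decide, hcj⟩, ?_⟩, ⟨⟨hW, ⟨by decide, by decide⟩, ⟨⟨by decide, by decide, by omega⟩,
    by decide, by omega⟩, ?_⟩, ⟨⟨by decide, by decide, by decide, by omega⟩, hci, by omega⟩, ?_⟩,
    ?_⟩
  · rcases hc with ⟨e, e'⟩ | ⟨e, e'⟩
    · rw [e, if_pos e']; simp
    · rw [e, if_neg e']; simp
  all_goals
    rcases hc with ⟨e, e'⟩ | ⟨e, e'⟩ <;> rw [e] <;> omega

theorem stageSum_partial (hw : WordGood G k A w) (hA : 0 < A) (hr : RegGood G k A fl σ)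
    (hm : MemGood G nbr H fl σ.mem) (hl : l.length = k) (hh : Holds G k l σ.mem)
    (h25 : σ.reg 25 = commonDenom (k := k) G l) {i : ℕ} (hi : i < k) (b : ℕ) {j : ℕ} (hj : j ≤ k) :
    iterate (fun j acc => (Expr.loc 0 + stageTermExpr).eval σ (acc :: j :: [b, i]))
      ((Expr.lit 0).eval σ [b, i]) j = ∑ j ∈ Finset.range j, stageTerm G H l i j := by
  rw [← zero_add (∑ j ∈ Finset.range j, _), ← iterate_add]
  refine iterate_congr fun j' hj' acc => ?_
  rw [Expr.eval_add, (stageTermExpr_spec (X := 0) hw hA hr hm hl hh h25 hi (by omega) acc b).1]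
  rfl

theorem stageSum_le (hw : WordGood G k A w) (l : List ℕ) (i : ℕ) {j : ℕ} (hj : j ≤ k) :
    ∑ j ∈ Finset.range j, stageTerm G H l i j ≤ k * (2 * G.edgeFinset.card * n ^ k) := by
  calc ∑ j ∈ Finset.range j, stageTerm G H l i j ≤
        ∑ _j ∈ Finset.range j, 2 * G.edgeFinset.card * n ^ k :=
          Finset.sum_le_sum fun j _ => (stageTerm_le l i j).trans (partialDenom_le hw le_rfl)
    _ = j * (2 * G.edgeFinset.card * n ^ k) := by simp
    _ ≤ _ := Nat.mul_le_mul_right _ hj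

theorem stageSum_spec (hw : WordGood G k A w) (hA : 0 < A) (hr : RegGood G k A fl σ)
    (hm : MemGood G nbr H fl σ.mem) (hl : l.length = k) (hh : Holds G k l σ.mem)
    (h25 : σ.reg 25 = commonDenom (k := k) G l) (hX : k ≤ X) {i : ℕ} (hi : i < k) (b : ℕ) :
    (Expr.iter (.var 5) (.lit 0) (.loc 0 + stageTermExpr)).eval σ [b, i] = stageNum G H l i ∧
    (Expr.iter (.var 5) (.lit 0) (.loc 0 + stageTermExpr)).Ok (2 ^ w) X σ [b, i] := by
  have hW := hw.one_lt
  constructor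
  · rw [Expr.eval_iter, stageSum_partial hw hA hr hm hl hh h25 hi]
    · rw [Expr.eval_var, hr.k_eq]
      rfl
    · rw [Expr.eval_var, hr.k_eq]
  · rw [Expr.ok_iter, Expr.eval_var, hr.k_eq, Expr.ok_var, Expr.ok_lit]
    refine ⟨by decide, by omega, hX, fun j hj => ?_⟩
    rw [stageSum_partial hw hA hr hm hl hh h25 hi b hj.le, Expr.ok_add]
    obtain ⟨h1, h2⟩ := stageTermExpr_spec (X := X) hw hA hr hm hl hh h25 hi hj
      (∑ j ∈ Finset.range j, stageTerm G H l i j) b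
    refine ⟨by rw [Expr.ok_loc]; simp, h2, ?_⟩
    rw [h1, Expr.eval_loc, List.getD_cons_zero, ← Finset.sum_range_succ]
    have := hw.pow_lt hA (i := 1) hw.k_pos
    rw [pow_one] at this
    exact (stageSum_le hw l i hj).trans_lt this

theorem numExpr_partial (hw : WordGood G k A w) (hA : 0 < A) (hr : RegGood G k A fl σ)
    (hm : MemGood G nbr H fl σ.mem) (hl : l.length = k) (hh : Holds G k l σ.mem)
    (h25 : σ.reg 25 = commonDenom (k := k) G l) (hX : k ≤ X) {i : ℕ} (hi : i ≤ k) :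
    iterate (fun i acc => (Expr.loc 0 * .iter (.var 5) (.lit 0) (.loc 0 + stageTermExpr)).eval σ
      (acc :: i :: [])) ((Expr.lit 1).eval σ []) i = ∏ i ∈ Finset.range i, stageNum G H l i := by
  rw [← one_mul (∏ i ∈ Finset.range i, _), ← iterate_mul]
  refine iterate_congr fun i' hi' acc => ?_
  rw [Expr.eval_mul, (stageSum_spec hw hA hr hm hl hh h25 hX (by omega) acc).1]
  rfl

theorem prod_stageNum_le (hw : WordGood G k A w) (l : List ℕ) (i : ℕ) :
    ∏ i ∈ Finset.range i, stageNum G H l i ≤ (k * (2 * G.edgeFinset.card * n ^ k)) ^ i := by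
  calc ∏ i ∈ Finset.range i, stageNum G H l i ≤
        ∏ _i ∈ Finset.range i, k * (2 * G.edgeFinset.card * n ^ k) :=
          Finset.prod_le_prod' fun i _ => stageSum_le hw l i le_rfl
    _ = _ := by simp

theorem numExpr_spec (hw : WordGood G k A w) (hA : 0 < A) (hr : RegGood G k A fl σ)
    (hm : MemGood G nbr H fl σ.mem) (hl : l.length = k) (hh : Holds G k l σ.mem)
    (h25 : σ.reg 25 = commonDenom (k := k) G l) (hX : k ≤ X) :
    (Expr.var 11 * numExpr).eval σ [] = A * ∏ i ∈ Finset.range k, stageNum G H l i ∧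
    (Expr.var 11 * numExpr).Ok (2 ^ w) X σ [] := by
  have hW := hw.one_lt
  have hev : numExpr.eval σ [] = ∏ i ∈ Finset.range k, stageNum G H l i := by
    rw [numExpr, Expr.eval_iter, numExpr_partial hw hA hr hm hl hh h25 hX]
    · rw [Expr.eval_var, hr.k_eq]
    · rw [Expr.eval_var, hr.k_eq]
  refine ⟨by rw [Expr.eval_mul, hev, Expr.eval_var, hr.acc_eq], ?_⟩
  rw [Expr.ok_mul, hev, Expr.ok_var, Expr.eval_var, hr.acc_eq]
  refine ⟨by decide, ?_, (Nat.mul_le_mul_left A (prod_stageNum_le hw l k)).trans_lt hw.power⟩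
  rw [numExpr, Expr.ok_iter, Expr.eval_var, hr.k_eq, Expr.ok_var, Expr.ok_lit]
  refine ⟨by decide, by omega, hX, fun i hi => ?_⟩
  rw [numExpr_partial hw hA hr hm hl hh h25 hX hi.le, Expr.ok_mul]
  obtain ⟨h1, h2⟩ := stageSum_spec hw hA hr hm hl hh h25 hX hi
    (∏ i ∈ Finset.range i, stageNum G H l i)
  refine ⟨by rw [Expr.ok_loc]; simp, h2, ?_⟩
  rw [h1, Expr.eval_loc, List.getD_cons_zero, ← Finset.prod_range_succ]
  exact (prod_stageNum_le hw l (i + 1)).trans_lt (hw.pow_lt hA hi)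

theorem powExpr_spec (hW : 1 < 2 ^ w) {x y c e : ℕ} (hx : x < numVars) (hy : y < numVars)
    (hc : σ.reg x = c) (he : σ.reg y = e) (hX : e ≤ X) (hlt : ∀ i ≤ e, c ^ i < 2 ^ w)
    (L : List ℕ) :
    (Expr.iter (.var y) (.lit 1) (.loc 0 * .var x)).eval σ L = c ^ e ∧
    (Expr.iter (.var y) (.lit 1) (.loc 0 * .var x)).Ok (2 ^ w) X σ L := by
  have hpart : ∀ i, iterate (fun i acc => (Expr.loc 0 * .var x).eval σ (acc :: i :: L))
      ((Expr.lit 1).eval σ L) i = c ^ i := by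
    intro i
    rw [← one_mul (c ^ i), ← Finset.prod_const_one (s := Finset.range i)]
    have := iterate_mul (fun _ => c) 1 i
    rw [Finset.prod_const, Finset.card_range] at this
    rw [Finset.prod_const_one, ← this]
    refine iterate_congr fun i' _ acc => ?_
    rw [Expr.eval_mul, Expr.eval_loc, Expr.eval_var, hc, List.getD_cons_zero]
  refine ⟨by rw [Expr.eval_iter, hpart, Expr.eval_var, he], ?_⟩
  rw [Expr.ok_iter, Expr.eval_var, he, Expr.ok_var, Expr.ok_lit]
  refine ⟨hy, hW, hX, fun i hi => ?_⟩
  rw [hpart, Expr.ok_mul, Expr.ok_loc, Expr.ok_var, Expr.eval_loc, Expr.eval_var, hc,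
    List.getD_cons_zero, ← pow_succ]
  exact ⟨by simp, hx, hlt _ hi⟩

/-- The summand with `j = i` always belongs to the edge sample and is positive. Hence the range of
the random number in the rejection step is nonempty, also for maps that are not embeddings. -/
theorem stageNum_pos (hE : G.edgeFinset.Nonempty) (hl : l.length = k) {mem : ℕ → ℕ}
    (hh : Holds G k l mem) {i : ℕ} (hi : i < k) : 0 < stageNum G H l i := by
  have hm := hE.card_pos
  have hpos : 0 < commonDenom (k := k) G l := commonDenom_pos hE fun j hj => (hh j (by omega)).2.1
  refine Finset.sum_pos' (fun _ _ => Nat.zero_le _) ⟨i, Finset.mem_range.2 hi, ?_⟩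
  rw [if_neg (by simp)]
  refine Nat.mul_pos (Nat.div_pos ?_ (by omega)) (hh i (by omega)).2.1
  exact Nat.le_of_dvd hpos (Dvd.intro _ rfl)

theorem tri_acceptProg (hE : G.edgeFinset.Nonempty) (hw : WordGood G k A w) (hA : 0 < A)
    (hr : RegGood G k A fl σ) (hm : MemGood G nbr H fl σ.mem) (hl : l.length = k)
    (hh : Holds G k l σ.mem) (h27 : σ.reg 27 = violations G H l) (h15 : σ.reg 15 + 1 < 2 ^ w)
    (hX : k ≤ X) :
    Tri G nbr w acceptProg (acceptProg.tb X) σ (acceptance G H A l) fun b σ' =>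
      σ'.reg 15 = σ.reg 15 + b.toNat ∧ Frame [25, 26, 24, 28, 15] 0 σ σ' := by
  have hW := hw.one_lt
  have hpos : 0 < A * ∏ i ∈ Finset.range k, stageNum G H l i :=
    Nat.mul_pos hA (Finset.prod_pos fun i hi => stageNum_pos hE hl hh (Finset.mem_range.1 hi))
  have hne : (Finset.range (A * ∏ i ∈ Finset.range k, stageNum G H l i)).Nonempty := by
    rw [Finset.nonempty_range_iff]
    exact hpos.ne'
  refine Tri.asg_seq hW (by decide) (denomExpr_ok hw hA hr hl hh hX) ?_
  rw [denomExpr_eval hr hl hh]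
  have F₁ := Frame.upd σ 25 (commonDenom (k := k) G l)
  set σ₁ := σ.upd 25 (commonDenom (k := k) G l) with hσ₁
  have hr₁ : RegGood G k A fl σ₁ := hr.congr (F₁.reg_lt (by decide))
  obtain ⟨n1, n2⟩ := numExpr_spec (X := X) (σ := σ₁) hw hA hr₁ hm hl hh (by simp [hσ₁]) hX
  refine Tri.asg_seq hW (by decide) n2 ?_
  rw [n1]
  have F₂ := F₁.trans (Frame.upd σ₁ 26 (A * ∏ i ∈ Finset.range k, stageNum G H l i))
  set σ₂ := σ₁.upd 26 (A * ∏ i ∈ Finset.range k, stageNum G H l i) with hσ₂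
  obtain ⟨d1, d2⟩ := powExpr_spec (σ := σ₂) (X := X) (x := 25) (y := 5)
    (c := commonDenom (k := k) G l) (e := k) hW (by decide) (by decide) (by simp [hσ₂, hσ₁])
    (by simp [hσ₂, hσ₁, hr.k_eq]) hX (fun i hi => by
      refine lt_of_le_of_lt (Nat.pow_le_pow_left ?_ i) (hw.pow_lt hA hi)
      exact (partialDenom_le hw le_rfl).trans (Nat.le_mul_of_pos_left _ hw.k_pos)) []
  refine Tri.asg_seq hW (by decide) d2 ?_
  rw [d1]
  have F₃ := F₂.trans (Frame.upd σ₂ 24 (commonDenom (k := k) G l ^ k))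
  set σ₃ := σ₂.upd 24 (commonDenom (k := k) G l ^ k) with hσ₃
  have h26 : (Expr.var 26).eval σ₃ [] = A * ∏ i ∈ Finset.range k, stageNum G H l i := by
    rw [Expr.eval_var]
    simp [hσ₃, hσ₂]
  have hne' : (Finset.range ((Expr.var 26).eval σ₃ [])).Nonempty := by rwa [h26]
  have hrnd := Tri.rnd (G := G) (nbr := nbr) (X := X) (x := 28) (e := .var 26) (σ := σ₃)
    (Q := fun x σ' => σ' = σ₃.upd 28 x) hW (by rw [Expr.ok_var]; decide) hne' (fun x _ => rfl)
  have hdist : PMF.uniformOfFinset (Finset.range ((Expr.var 26).eval σ₃ [])) hne' =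
      PMF.uniformOfFinset _ hne := by congr 2
  rw [acceptance, dif_pos hne, ← PMF.bind_pure_comp]
  refine Tri.seq_tb (hrnd.of_eq hdist) ?_
  rintro x σ₄ rfl
  have F₄ := F₃.trans (Frame.upd σ₃ 28 x)
  set σ₄ := σ₃.upd 28 x with hσ₄
  have g27 : σ₄.reg 27 = violations G H l := (F₄.reg 27 (by decide)).trans h27
  have g15 : σ₄.reg 15 = σ.reg 15 := F₄.reg 15 (by decide)
  have g24 : σ₄.reg 24 = commonDenom (k := k) G l ^ k := by simp [hσ₄, hσ₃]
  have g28 : σ₄.reg 28 = x := by simp [hσ₄]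
  refine Tri.asg hW (by decide) ?_ ?_
  · simp only [Expr.ok_add, Expr.ok_mul, Expr.ok_eq, Expr.ok_lt, Expr.ok_var, Expr.ok_lit,
      Expr.eval_mul, Expr.eval_eq, Expr.eval_lt, Expr.eval_var, Expr.eval_lit, g15, g27, g24, g28]
    refine ⟨by decide, ⟨⟨by decide, by omega⟩, ⟨by decide, by decide⟩, ?_⟩, ?_⟩
    · split_ifs <;> omega
    · split_ifs <;> omega
  · simp only [Expr.eval_add, Expr.eval_mul, Expr.eval_eq, Expr.eval_lt, Expr.eval_var,
      Expr.eval_lit, g15, g27, g24, g28]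
    refine ⟨?_, F₄.trans (Frame.upd σ₄ 15 _)⟩
    rw [State.upd_reg, if_pos rfl]
    by_cases h1 : violations G H l = 0 <;> by_cases h2 : x < commonDenom (k := k) G l ^ k <;>
      simp [h1, h2]

/-- The `k` stages make at most two queries each and the `k * k` checks at most one each; the
decision uses only the stored degrees. -/
theorem tri_trialProg (hE : G.edgeFinset.Nonempty) (hk : (Finset.range k).Nonempty)
    (hw : WordGood G k A w) (hA : 0 < A) (hr : RegGood G k A fl σ)
    (hm : MemGood G nbr H fl σ.mem) (h15 : σ.reg 15 + 1 < 2 ^ w) (hX : k * k ≤ X) :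
    Tri G nbr w trialProg (trialProg.tb X) σ (trialDist G nbr H hE hk A) fun b σ' =>
      σ'.reg 15 = σ.reg 15 + b.toNat ∧ (∀ r < 21, r ≠ 15 → σ'.reg r = σ.reg r) ∧
      MemGood G nbr H fl σ'.mem ∧ σ'.queries ≤ σ.queries + (2 * k + k * k) * (1 - fl) := by
  have hW := hw.one_lt
  have hsq := hw.square
  have hkn := hw.k_le
  have hkk := hw.k_sq_le
  have hnn : n ≤ n * n := Nat.le_mul_self n
  have hkX : k ≤ X := (Nat.le_mul_self k).trans hX
  refine Tri.seq_tb (Tri.forc_tb hW k (fun i l => (stage G nbr H hE hk i l).map fun v => l ++ [v])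
    (StageInv G nbr H fl σ) (by decide) (by omega) hkX ?_ ?_ ?_) ?_
  · intro i _ l σ' h
    refine ⟨h.index, by rw [Expr.ok_var]; decide, ?_⟩
    rw [Expr.eval_var, h.reg 5 (by omega), hr.k_eq]
  · intro i hi l σ' h
    exact tri_stageProg hE hk hw hr hi h
  · refine ⟨by simp, fun r hr => ?_, hm, rfl, ?_, by simp⟩
    · rw [State.upd_reg, if_neg (by omega)]
    · intro j hj
      simp at hj
  · intro l σ₁ h₁
    refine Tri.asg_seq hW (by decide) (by rw [Expr.ok_lit]; omega) ?_
    rw [Expr.eval_lit]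
    have h0 : CheckInv G nbr H fl σ l 0 ((σ₁.upd 27 0).upd 22 0) := by
      refine ⟨by simp, fun r hr => ?_, by simp, h₁.mem, h₁.holds, ?_⟩
      · simp only [State.upd_reg]
        rw [if_neg (by omega), if_neg (by omega), h₁.reg r hr]
      · simpa using h₁.queries
    refine Tri.seq_det_tb (Tri.forc_det hW (k * k) (CheckInv G nbr H fl σ l) (by decide)
      (by omega) hX ?_ ?_ h0) ?_
    · intro t _ σ' h
      have e5 : σ'.reg 5 = k := (h.reg 5 (by omega)).trans hr.k_eq
      refine ⟨h.index, ?_, by rw [Expr.eval_mul, Expr.eval_var, e5]⟩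
      rw [Expr.ok_mul, Expr.ok_var, Expr.eval_var, e5]
      exact ⟨by decide, by decide, by omega⟩
    · intro t ht σ' h
      exact tri_checkProg hw hr h₁.length ht h
    · intro σ₂ h₂
      have e15 : σ₂.reg 15 = σ.reg 15 := h₂.reg 15 (by omega)
      refine (tri_acceptProg hE hw hA (hr.congr fun r hr => h₂.reg r (by omega)) h₂.mem h₁.length
        h₂.holds h₂.sum (by rw [e15]; exact h15) hkX).conseq ?_
      rintro b σ₃ ⟨g, F⟩
      refine ⟨by rw [g, e15], fun r hr hne => ?_, by rw [F.mem]; exact h₂.mem, ?_⟩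
      · rw [F.reg r (by simp; omega), h₂.reg r hr]
      · have q1 := F.queries
        have q2 := h₂.queries
        have e : (2 * k + k * k) * (1 - fl) = k * (2 * (1 - fl)) + k * k * (1 - fl) := by ring
        omega

end Acceptance

/-! ### Constants of the pattern by exhaustive search -/

namespace Expr

/-- The expression uses only registers in `S` and at most `d` free bound variables. -/
def closed (S : List ℕ) : ℕ → Expr → Bool
  | _, lit _ => true
  | _, var x => decide (x ∈ S) && decide (x < numVars)
  | d, loc j => decide (j < d)
  | d, mem e => e.closed S d
  | d, bin _ a b => a.closed S d && b.closed S d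
  | d, iter N z b => N.closed S d && z.closed S d && b.closed S (d + 2)

/-- This transfers bounds from one reference state to all states with the same pattern, so that the
word size needed for the pattern constants depends on `H` alone. -/
theorem eval_congr {S : List ℕ} {σ σ' : State} (hS : ∀ r ∈ S, σ.reg r = σ'.reg r)
    (hm : σ.mem = σ'.mem) (e : Expr) : ∀ l, e.closed S l.length → e.eval σ l = e.eval σ' l := by
  induction e with
  | lit c => exact fun _ _ => rfl
  | var x =>
    intro l h
    simp only [closed, Bool.and_eq_true, decide_eq_true_eq] at h
    exact hS x h.1
  | loc j => exact fun _ _ => rfl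
  | mem e ih =>
    intro l h
    rw [eval_mem, eval_mem, ih l h, hm]
  | bin o a b iha ihb =>
    intro l h
    simp only [closed, Bool.and_eq_true] at h
    simp only [eval, iha l h.1, ihb l h.2]
  | iter N z b ihN ihz ihb =>
    intro l h
    simp only [closed, Bool.and_eq_true] at h
    rw [eval_iter, eval_iter, ihN l h.1.1, ihz l h.1.2]
    exact iterate_congr fun i _ acc => ihb _ h.2

/-- With large enough words nothing overflows. -/
theorem exists_ok {S : List ℕ} (σ₀ : State) (e : Expr) : ∀ l : List ℕ, e.closed S l.length →
    ∃ B, ∀ W X σ, B ≤ W → B ≤ X → (∀ r ∈ S, σ.reg r = σ₀.reg r) → σ.mem = σ₀.mem →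
      e.Ok W X σ l := by
  induction e with
  | lit c => exact fun _ _ => ⟨c + 1, fun W X σ hW _ _ _ => hW⟩
  | var x =>
    intro l h
    simp only [closed, Bool.and_eq_true, decide_eq_true_eq] at h
    exact ⟨0, fun W X σ _ _ _ _ => h.2⟩
  | loc j => exact fun l h => ⟨0, fun W X σ _ _ _ _ => by
      rw [ok_loc]
      simpa [closed] using h⟩
  | mem e ih => exact ih
  | bin o a b iha ihb =>
    intro l h
    simp only [closed, Bool.and_eq_true] at h
    obtain ⟨B₁, h₁⟩ := iha l h.1
    obtain ⟨B₂, h₂⟩ := ihb l h.2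
    refine ⟨B₁ + B₂ + (a.eval σ₀ l + b.eval σ₀ l + a.eval σ₀ l * b.eval σ₀ l + 1),
      fun W X σ hW hX hS hm => ⟨h₁ W X σ (by omega) (by omega) hS hm,
        h₂ W X σ (by omega) (by omega) hS hm, ?_⟩⟩
    rw [eval_congr hS hm a l h.1, eval_congr hS hm b l h.2]
    cases o
    case add => simp only [Op.Fits]; omega
    case mul => simp only [Op.Fits]; omega
    all_goals trivial
  | iter N z b ihN ihz ihb =>
    intro l h
    have hcl := h
    simp only [closed, Bool.and_eq_true] at h
    obtain ⟨B₁, h₁⟩ := ihN l h.1.1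
    obtain ⟨B₂, h₂⟩ := ihz l h.1.2
    -- Each round has its own bound; as there are finitely many rounds in the reference state, their
    -- sum serves for all.
    choose B hB using fun i : ℕ => ihb
      (iterate (fun i acc => b.eval σ₀ (acc :: i :: l)) (z.eval σ₀ l) i :: i :: l) h.2
    refine ⟨B₁ + B₂ + N.eval σ₀ l + ∑ i ∈ Finset.range (N.eval σ₀ l), B i,
      fun W X σ hW hX hS hm => ⟨h₁ W X σ (by omega) (by omega) hS hm,
        h₂ W X σ (by omega) (by omega) hS hm, ?_, fun i hi => ?_⟩⟩
    · rw [eval_congr hS hm N l h.1.1]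
      omega
    · rw [eval_congr hS hm N l h.1.1] at hi
      have hle := Finset.single_le_sum (fun i _ => Nat.zero_le (B i)) (Finset.mem_range.2 hi)
      rw [eval_congr hS hm z l h.1.2, iterate_congr fun j _ acc =>
        eval_congr hS hm b (acc :: j :: l) h.2]
      exact hB i W X σ (by omega) (by omega) hS hm

/-- Digit `i` of `c` in base `b`, for closed expressions `b`. -/
def digit (b c i : Expr) : Expr := c / iter i (lit 1) (loc 0 * b) % b

/-- The number `k` of vertices of the pattern to the power `k`. -/
def mapsExpr : Expr := iter (var 5) (lit 1) (loc 0 * var 5)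

/-- The maximum of `excess` over all sets, which are encoded in binary. -/
def coverExpr : Expr :=
  iter (iter (var 5) (lit 1) (loc 0 * lit 2)) (lit 0)
    (loc 0 + (iter (var 5) (lit 0) (loc 0 + (lit 1 + digit (lit 2) (loc 3) (loc 1) -
      lt (lit 0) (iter (var 5) (lit 0)
        (loc 0 + digit (lit 2) (loc 5) (loc 1) * mem (loc 3 * var 5 + loc 1))))) - loc 0))

/-- The number of automorphisms of the pattern; maps are encoded in base `k`. -/
def autExpr : Expr :=
  iter mapsExpr (lit 0) (loc 0 + eq (lit 0) (iter (var 5 * var 5) (lit 0) (loc 0 +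
    ((lit 1 - eq (mem (digit (var 5) (loc 3) (loc 1 / var 5) * var 5 +
        digit (var 5) (loc 3) (loc 1 % var 5))) (mem (loc 1))) +
      (lit 1 - eq (loc 1 / var 5) (loc 1 % var 5)) *
        eq (digit (var 5) (loc 3) (loc 1 / var 5)) (digit (var 5) (loc 3) (loc 1 % var 5))))))

theorem closed_mapsExpr : mapsExpr.closed [5] 0 := by decide
theorem closed_coverExpr : coverExpr.closed [5] 0 := by decide
theorem closed_autExpr : autExpr.closed [5] 0 := by decide

theorem iterate_pow (c e : ℕ) : iterate (fun _ acc => acc * c) 1 e = c ^ e := by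
  rw [iterate_mul (fun _ => c)]
  simp

theorem eval_digit_lit (σ : State) (b : ℕ) (c i : Expr) (l : List ℕ) :
    (digit (lit b) c i).eval σ l = c.eval σ l / b ^ i.eval σ l % b := by
  rw [digit, eval_mod, eval_div, eval_iter, eval_lit, eval_lit, ← iterate_pow]
  rfl

theorem eval_digit_var (σ : State) (x : ℕ) (c i : Expr) (l : List ℕ) :
    (digit (var x) c i).eval σ l = c.eval σ l / σ.reg x ^ i.eval σ l % σ.reg x := by
  rw [digit, eval_mod, eval_div, eval_iter, eval_lit, eval_var, ← iterate_pow]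
  rfl

theorem eval_mapsExpr (σ : State) {k : ℕ} (h5 : σ.reg 5 = k) (l : List ℕ) :
    mapsExpr.eval σ l = k ^ k := by
  rw [mapsExpr, eval_iter, eval_var, h5, eval_lit, ← iterate_pow k k]
  exact iterate_congr fun i _ acc => by rw [eval_mul, eval_var, h5]; rfl

end Expr

/-- With truncated subtraction, `acc + (x - acc)` is the maximum of `acc` and `x`. -/
theorem iterate_max (f : ℕ → ℕ) (N : ℕ) :
    iterate (fun i acc => acc + (f i - acc)) 0 N = (Finset.range N).sup f := by
  induction N with
  | zero => rfl
  | succ N ih =>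
    rw [iterate, ih, Finset.range_add_one, Finset.sup_insert]
    omega

section Static

variable {k : ℕ} {H : SimpleGraph (Fin k)} [DecidableRel H.Adj] {σ : State}

/-- The binary digits of `c` are the indicator of a set, and a vertex lies in the neighborhood of
the set if and only if its sum of adjacencies to the set is positive. -/
theorem excess_eq_sum (c : Fin (2 ^ k)) :
    excess H (Finset.univ.filter fun v => finFunctionFinEquiv.symm c v = 1) =
      ∑ v ∈ Finset.range k, (1 + (c : ℕ) / 2 ^ v % 2 -
        if 0 < ∑ u ∈ Finset.range k, (c : ℕ) / 2 ^ u % 2 * pairAnswer H v u then 1 else 0) := by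
  have hbit : ∀ v, (if finFunctionFinEquiv.symm c v = 1 then 1 else 0) =
      (c : ℕ) / 2 ^ (v : ℕ) % 2 := by
    intro v
    have h := finFunctionFinEquiv_symm_apply_val c v
    rw [← h]
    have : ∀ x : Fin 2, (if x = 1 then 1 else 0) = (x : ℕ) := by decide
    exact this _
  rw [excess, Finset.sum_range]
  refine Finset.sum_congr rfl fun v _ => ?_
  congr 2
  · rw [← hbit v]
    simp
  · rw [Finset.sum_range, pos_iff_ne_zero, Ne, Finset.sum_eq_zero_iff, not_forall, eq_iff_iff]
    refine exists_congr fun u => ?_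
    rw [← hbit u]
    simp [pairAnswer_fin, and_comm]

theorem sup_excess :
    (Finset.range (2 ^ k)).sup (fun c => ∑ v ∈ Finset.range k, (1 + c / 2 ^ v % 2 -
        if 0 < ∑ u ∈ Finset.range k, c / 2 ^ u % 2 * pairAnswer H v u then 1 else 0)) =
      coverNum H := by
  refine le_antisymm (Finset.sup_le fun c hc => ?_) (Finset.sup_le fun S _ => ?_)
  · have := excess_eq_sum (H := H) ⟨c, Finset.mem_range.1 hc⟩
    rw [← this]
    exact excess_le_coverNum H _
  · have := excess_eq_sum (H := H) (finFunctionFinEquiv fun v => if v ∈ S then 1 else 0)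
    rw [Equiv.symm_apply_apply] at this
    have hS : (Finset.univ.filter fun v : Fin k => (if v ∈ S then (1 : Fin 2) else 0) = 1) = S := by
      ext v
      by_cases hv : v ∈ S <;> simp [hv]
    rw [hS] at this
    rw [this]
    exact Finset.le_sup (f := fun c : ℕ => ∑ v ∈ Finset.range k, (1 + c / 2 ^ v % 2 -
        if 0 < ∑ u ∈ Finset.range k, c / 2 ^ u % 2 * pairAnswer H v u then 1 else 0))
      (Finset.mem_range.2 (Fin.isLt _))

theorem eval_coverExpr (h5 : σ.reg 5 = k)
    (hp : ∀ i < k, ∀ j < k, σ.mem (i * k + j) = pairAnswer H i j) :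
    Expr.coverExpr.eval σ [] = coverNum H := by
  have h2 : (Expr.iter (.var 5) (.lit 1) (.loc 0 * .lit 2)).eval σ [] = 2 ^ k := by
    rw [Expr.eval_iter, Expr.eval_var, h5, ← Expr.iterate_pow 2 k]
    rfl
  rw [Expr.coverExpr, Expr.eval_iter, h2, Expr.eval_lit, ← sup_excess, ← iterate_max]
  refine iterate_congr fun c _ acc => ?_
  rw [Expr.eval_add, Expr.eval_sub, Expr.eval_loc, List.getD_cons_zero]
  congr 2
  rw [Expr.eval_iter, Expr.eval_var, h5, Expr.eval_lit, ← zero_add (∑ v ∈ Finset.range k, _),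
    ← iterate_add]
  refine iterate_congr fun v hv acc' => ?_
  rw [Expr.eval_add, Expr.eval_loc, List.getD_cons_zero, Expr.eval_sub, Expr.eval_add,
    Expr.eval_digit_lit, Expr.eval_lt]
  have hin : (Expr.iter (.var 5) (.lit 0) (.loc 0 + .digit (.lit 2) (.loc 5) (.loc 1) *
      .mem (.loc 3 * .var 5 + .loc 1))).eval σ [acc', v, acc, c] =
      ∑ u ∈ Finset.range k, c / 2 ^ u % 2 * pairAnswer H v u := by
    rw [Expr.eval_iter, Expr.eval_var, h5, Expr.eval_lit, ← zero_add (∑ u ∈ Finset.range k, _),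
      ← iterate_add]
    refine iterate_congr fun u hu acc'' => ?_
    rw [Expr.eval_add, Expr.eval_mul, Expr.eval_digit_lit, Expr.eval_mem, Expr.eval_add,
      Expr.eval_mul, Expr.eval_var, h5]
    simp only [Expr.eval_loc, List.getD_cons_zero, List.getD_cons_succ]
    rw [hp v hv u hu]
  rw [hin]
  rfl

/-- The digits of `c` in base `k` run through all maps; a map is counted if no pair of vertices
violates injectivity or the equivalence of adjacency. -/
theorem card_automorphisms (hk : 0 < k) :
    (automorphisms H).card = ∑ c ∈ Finset.range (k ^ k),
      if 0 = ∑ t ∈ Finset.range (k * k), ((1 - if pairAnswer H (c / k ^ (t / k) % k)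
        (c / k ^ (t % k) % k) = pairAnswer H (t / k) (t % k) then 1 else 0) +
        (1 - if t / k = t % k then 1 else 0) *
          if c / k ^ (t / k) % k = c / k ^ (t % k) % k then 1 else 0) then 1 else 0 := by
  rw [automorphisms, Finset.card_filter, Finset.sum_range,
    ← Equiv.sum_comp (finFunctionFinEquiv (m := k) (n := k))]
  refine Finset.sum_congr rfl fun f _ => ?_
  have hd : ∀ i : ℕ, ∀ hi : i < k,
      (finFunctionFinEquiv f : ℕ) / k ^ i % k = f ⟨i, hi⟩ := by
    intro i hi
    have := finFunctionFinEquiv_symm_apply_val (finFunctionFinEquiv f) ⟨i, hi⟩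
    rw [Equiv.symm_apply_apply] at this
    exact this.symm
  congr 1
  rw [eq_iff_iff, eq_comm (a := 0), Finset.sum_eq_zero_iff]
  have hterm : ∀ i j : Fin k, (((1 - if pairAnswer H (f i) (f j) = pairAnswer H i j then 1 else 0) +
      (1 - if (i : ℕ) = j then 1 else 0) * if ((f i : Fin k) : ℕ) = f j then 1 else 0) = 0) ↔
      ((H.Adj i j ↔ H.Adj (f i) (f j)) ∧ (f i = f j → i = j)) := by
    intro i j
    simp only [pairAnswer_fin, ← Fin.ext_iff]
    by_cases h1 : H.Adj i j <;> by_cases h2 : H.Adj (f i) (f j) <;> by_cases h3 : i = j <;>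
      by_cases h4 : f i = f j <;> simp [h1, h2, h3, h4]
  constructor
  · rintro ⟨hinj, hadj⟩ t ht
    have h1 : t / k < k := Nat.div_lt_of_lt_mul (Finset.mem_range.1 ht)
    have h2 : t % k < k := Nat.mod_lt _ hk
    rw [hd _ h1, hd _ h2]
    exact (hterm ⟨_, h1⟩ ⟨_, h2⟩).2 ⟨hadj _ _, fun h => hinj h⟩
  · intro h
    have h' : ∀ i j : Fin k, (H.Adj i j ↔ H.Adj (f i) (f j)) ∧ (f i = f j → i = j) := by
      intro i j
      have := h (i * k + j) (Finset.mem_range.2 (mul_add_lt_sq i.isLt j.isLt))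
      have e1 : (i * k + j : ℕ) / k = i := by
        rw [mul_comm, Nat.mul_add_div hk, Nat.div_eq_of_lt j.isLt, add_zero]
      have e2 : (i * k + j : ℕ) % k = j := by
        rw [mul_comm, Nat.mul_add_mod, Nat.mod_eq_of_lt j.isLt]
      rw [e1, e2, hd _ i.isLt, hd _ j.isLt] at this
      exact (hterm i j).1 this
    exact ⟨fun i j hij => (h' i j).2 hij, fun i j => (h' i j).1⟩

theorem eval_autExpr (hk : 0 < k) (h5 : σ.reg 5 = k)
    (hp : ∀ i < k, ∀ j < k, σ.mem (i * k + j) = pairAnswer H i j) :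
    Expr.autExpr.eval σ [] = (automorphisms H).card := by
  rw [Expr.autExpr, Expr.eval_iter, Expr.eval_mapsExpr σ h5, Expr.eval_lit, card_automorphisms hk,
    ← zero_add (∑ c ∈ Finset.range (k ^ k), _), ← iterate_add]
  refine iterate_congr fun c _ acc => ?_
  rw [Expr.eval_add, Expr.eval_loc, List.getD_cons_zero, Expr.eval_eq, Expr.eval_lit,
    Expr.eval_iter, Expr.eval_mul, Expr.eval_var, h5, Expr.eval_lit,
    ← zero_add (∑ t ∈ Finset.range (k * k), _), ← iterate_add]
  congr 3
  refine iterate_congr fun t ht acc' => ?_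
  have hm : ∀ x, x % k < k := fun x => Nat.mod_lt _ hk
  have ht' : σ.mem t = pairAnswer H (t / k) (t % k) := by
    rw [← hp _ (Nat.div_lt_of_lt_mul ht) _ (hm t), Nat.div_add_mod']
  simp only [Expr.eval_add, Expr.eval_mul, Expr.eval_sub, Expr.eval_eq, Expr.eval_mem,
    Expr.eval_digit_var, Expr.eval_div, Expr.eval_mod, Expr.eval_var, Expr.eval_lit,
    Expr.eval_loc, List.getD_cons_zero, List.getD_cons_succ, h5]
  rw [hp _ (hm _) _ (hm _), ht']

end Static

/-! ### Setting the parameters -/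

open SubgraphCount.Expr in
/-- Compute the quantities that depend only on the pattern. -/
def patternProg : Prog :=
  .seq (.asg 6 (var 5 * var 5)) (.seq (.asg 7 coverExpr) (.seq (.asg 14 autExpr)
    (.asg 17 mapsExpr)))

open SubgraphCount.Expr in
/-- One round of `scaleProg`. -/
def scaleStep : Prog :=
  .seq (.asg 8 (var 8 * (lit 1 + lt (var 8 * var 8) (var 1 + var 1))))
    (.seq (.asg 9 (var 9 + lit 1)) (.asg 10 (var 10 + var 10)))

open SubgraphCount.Expr in
/-- Compute `side` and `level`. -/
def scaleProg : Prog :=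
  .seq (.asg 8 (lit 1)) (.seq (.asg 9 (lit 1)) (.seq (.asg 10 (lit 1))
    (.whl (lt (var 10) (var 0)) scaleStep)))

open SubgraphCount.Expr in
/-- Compute the number of trials. -/
def paramProg (a : ℕ) : Prog :=
  .seq (.asg 11 (iter (var 7) (lit 1) (loc 0 * var 8))) (.seq (.asg 16 (var 17 * var 11))
    (.asg 12 (lit (4 * (a + 1)) * var 16 * var 9 * (var 4 * var 4) / (var 2 * (var 3 * var 3)) +
      lit 1)))

/-- The values of register 8 during `scaleProg`. -/
def sideUpTo (m : ℕ) : ℕ → ℕ := iterate (fun _ s => s * (1 + if s * s < m + m then 1 else 0)) 1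

/-- A number whose square is at least `2 m` and at most `8 m`. -/
def side (m n : ℕ) : ℕ := sideUpTo m (Nat.clog 2 n)

/-- The binary logarithm of `2 n`, rounded up. -/
def level (n : ℕ) : ℕ := Nat.clog 2 n + 1

/-- The reciprocal of the probability that a trial finds a given embedding. -/
def weight {k : ℕ} (H : SimpleGraph (Fin k)) [DecidableRel H.Adj] (m n : ℕ) : ℕ :=
  k ^ k * side m n ^ coverNum H

/-- The number of trials. -/
def trials {k : ℕ} (H : SimpleGraph (Fin k)) [DecidableRel H.Adj] (a n m h num den : ℕ) : ℕ :=
  4 * (a + 1) * weight H m n * level n * (den * den) / (h * (num * num)) + 1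

/-- The value doubles while its square is below `2m`. A doubling multiplies the square by 4, so it
stays at most `8m`; a value that has stopped doubling has a square of at least `2m`. This replaces
the extraction of a square root. -/
theorem sideUpTo_spec {m : ℕ} (hm : 0 < m) (i : ℕ) :
    0 < sideUpTo m i ∧ sideUpTo m i * sideUpTo m i ≤ 8 * m ∧
      (sideUpTo m i = 2 ^ i ∨ 2 * m ≤ sideUpTo m i * sideUpTo m i) := by
  induction i with
  | zero => exact ⟨one_pos, by change 1 * 1 ≤ _; omega, Or.inl rfl⟩
  | succ i ih =>
    obtain ⟨h1, h2, h3⟩ := ih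
    have e : sideUpTo m (i + 1) =
      sideUpTo m i * (1 + if sideUpTo m i * sideUpTo m i < m + m then 1 else 0) := rfl
    rw [e]
    split_ifs with h
    · refine ⟨by omega, ?_, Or.inl ?_⟩
      · have : sideUpTo m i * (1 + 1) * (sideUpTo m i * (1 + 1)) =
          4 * (sideUpTo m i * sideUpTo m i) := by ring
        omega
      · rcases h3 with h3 | h3
        · rw [h3, pow_succ]
        · omega
    · rw [add_zero, mul_one]
      exact ⟨h1, h2, Or.inr (by omega)⟩

section Setup

variable {n k : ℕ} {G : SimpleGraph (Fin n)} [DecidableRel G.Adj]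
  {nbr : ∀ v : Fin n, Fin (G.degree v) ≃ G.neighborSet v}
  {H : SimpleGraph (Fin k)} [DecidableRel H.Adj] {w X : ℕ} {σ : State}

/-- If the value never stopped doubling, it is a power of two that is at least `n`, and `n * n ≥
2m`. -/
theorem le_side_sq {m : ℕ} (hm : 0 < m) (h : 2 * m ≤ n * n) : 2 * m ≤ side m n ^ 2 := by
  rw [sq]
  rcases (sideUpTo_spec hm (Nat.clog 2 n)).2.2 with h' | h'
  · rw [side, h']
    have := Nat.le_pow_clog one_lt_two n
    exact h.trans (Nat.mul_le_mul this this)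
  · exact h'

/-- The bound `B`, for both words and loops, is chosen before `G`: it depends only on the pattern
stored in the reference state `σ₀`. -/
theorem tri_patternProg (hk : 0 < k) {σ₀ : State} (h5₀ : σ₀.reg 5 = k)
    (hp : ∀ i < k, ∀ j < k, σ₀.mem (i * k + j) = pairAnswer H i j) :
    ∃ B, ∀ {n : ℕ} {G : SimpleGraph (Fin n)} [DecidableRel G.Adj]
      {nbr : ∀ v : Fin n, Fin (G.degree v) ≃ G.neighborSet v} {w : ℕ} {σ : State}, B < 2 ^ w →
      σ.reg 5 = k → σ.mem = σ₀.mem →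
      Tri G nbr w patternProg (patternProg.tb B) σ (PMF.pure ()) fun _ σ' =>
        Frame [6, 7, 14, 17] 0 σ σ' ∧ σ'.reg 6 = k * k ∧ σ'.reg 7 = coverNum H ∧
        σ'.reg 14 = (automorphisms H).card ∧ σ'.reg 17 = k ^ k := by
  obtain ⟨B₁, h₁⟩ := Expr.exists_ok σ₀ (.var 5 * .var 5) [] (S := [5]) (by decide)
  obtain ⟨B₂, h₂⟩ := Expr.exists_ok σ₀ _ [] Expr.closed_coverExpr
  obtain ⟨B₃, h₃⟩ := Expr.exists_ok σ₀ _ [] Expr.closed_autExpr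
  obtain ⟨B₄, h₄⟩ := Expr.exists_ok σ₀ _ [] Expr.closed_mapsExpr
  refine ⟨B₁ + B₂ + B₃ + B₄ + 1, fun {n G _ nbr w σ} hB h5 hm => ?_⟩
  have hW : 1 < 2 ^ w := by omega
  have hS : ∀ {σ' : State}, σ'.reg 5 = k → ∀ r ∈ [5], σ'.reg r = σ₀.reg r := by
    intro σ' h r hr
    rw [List.mem_singleton.1 hr, h, h5₀]
  refine Tri.asg_seq hW (by decide) (h₁ _ _ _ (by omega) (by omega) (hS h5) hm) ?_
  have F₁ := Frame.upd σ 6 ((Expr.var 5 * .var 5).eval σ [])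
  set σ₁ := σ.upd 6 ((Expr.var 5 * .var 5).eval σ []) with hσ₁
  have h51 : σ₁.reg 5 = k := (F₁.reg 5 (by decide)).trans h5
  have hm1 : σ₁.mem = σ₀.mem := F₁.mem.trans hm
  refine Tri.asg_seq hW (by decide) (h₂ _ _ _ (by omega) (by omega) (hS h51) hm1) ?_
  have F₂ := F₁.trans (Frame.upd σ₁ 7 (Expr.coverExpr.eval σ₁ []))
  set σ₂ := σ₁.upd 7 (Expr.coverExpr.eval σ₁ []) with hσ₂
  have h52 : σ₂.reg 5 = k := (F₂.reg 5 (by decide)).trans h5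
  have hm2 : σ₂.mem = σ₀.mem := F₂.mem.trans hm
  refine Tri.asg_seq hW (by decide) (h₃ _ _ _ (by omega) (by omega) (hS h52) hm2) ?_
  have F₃ := F₂.trans (Frame.upd σ₂ 14 (Expr.autExpr.eval σ₂ []))
  set σ₃ := σ₂.upd 14 (Expr.autExpr.eval σ₂ []) with hσ₃
  have h53 : σ₃.reg 5 = k := (F₃.reg 5 (by decide)).trans h5
  have hm3 : σ₃.mem = σ₀.mem := F₃.mem.trans hm
  refine Tri.asg hW (by decide) (h₄ _ _ _ (by omega) (by omega) (hS h53) hm3) ?_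
  refine ⟨F₃.trans (Frame.upd σ₃ 17 _), ?_, ?_, ?_, ?_⟩
  · simp [hσ₃, hσ₂, hσ₁, Expr.eval_mul, Expr.eval_var, h5]
  · simp only [hσ₃, hσ₂, State.upd_reg]
    exact eval_coverExpr h51 (by rwa [hm1])
  · simp only [hσ₃, State.upd_reg]
    exact eval_autExpr hk h52 (by rwa [hm2])
  · simp only [State.upd_reg]
    exact Expr.eval_mapsExpr σ₃ h53 []

/-- The loop stops when register 10, which holds `2 ^ i`, reaches `n`. It makes `Nat.clog 2 n`
rounds, hence the factor `level n` in the running time. -/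
theorem tri_scaleProg {m : ℕ} (hm : 0 < m) (hmn : 2 * m ≤ n * n) (hw : 9 * (n * n) + 9 < 2 ^ w)
    (h0 : σ.reg 0 = n) (h1 : σ.reg 1 = m) :
    Tri G nbr w scaleProg (scaleProg.tb 1 * level n) σ (PMF.pure ()) fun _ σ' =>
      Frame [8, 9, 10] 0 σ σ' ∧ σ'.reg 8 = side m n ∧ σ'.reg 9 = level n := by
  have hW : 1 < 2 ^ w := by omega
  have hnn : n ≤ n * n := Nat.le_mul_self n
  set σ₁ := ((σ.upd 8 1).upd 9 1).upd 10 1 with hσ₁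
  have F₁ : Frame [8, 9, 10] 0 σ σ₁ := by
    refine ⟨fun r hr => ?_, rfl, by simp [hσ₁]⟩
    simp at hr
    simp [hσ₁, hr]
  have hwhl := Tri.whl (G := G) (nbr := nbr) (X := 1) (σ := σ₁) (e := .lt (.var 10) (.var 0))
    (p := scaleStep) (a := ()) hW (Nat.clog 2 n) (fun _ => scaleStep.tb 1)
    (fun _ _ => PMF.pure ())
    (fun i _ σ' => Frame [8, 9, 10] 0 σ σ' ∧ σ'.reg 8 = sideUpTo m i ∧ σ'.reg 9 = i + 1 ∧
      σ'.reg 10 = 2 ^ i) ?_ ?_ ⟨F₁, by simp [hσ₁, sideUpTo, iterate], by simp [hσ₁],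
        by simp [hσ₁]⟩
  · rw [chain_pure] at hwhl
    obtain ⟨t, ht, hwhl⟩ : ∃ t, t = _ ∧ Tri G nbr w _ t σ₁ (PMF.pure ()) _ := ⟨_, rfl, hwhl⟩
    refine Tri.mono (t := 1 + (Prog.asg 8 (.lit 1)).tb 1 + (1 + (Prog.asg 9 (.lit 1)).tb 1 +
      (1 + (Prog.asg 10 (.lit 1)).tb 1 + t))) ?_ ?_
    · refine Tri.seq_det (Tri.asg hW (by decide) (by rw [Expr.ok_lit]; omega)
        (Q := fun _ σ' => σ' = σ.upd 8 1) rfl) ?_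
      rintro _ rfl
      refine Tri.seq_det (Tri.asg hW (by decide) (by rw [Expr.ok_lit]; omega)
        (Q := fun _ σ' => σ' = (σ.upd 8 1).upd 9 1) rfl) ?_
      rintro _ rfl
      refine Tri.seq_det (Tri.asg hW (by decide) (by rw [Expr.ok_lit]; omega)
        (Q := fun _ σ' => σ' = σ₁) rfl) ?_
      rintro _ rfl
      exact hwhl.conseq fun _ σ' h => ⟨h.1, h.2.1, h.2.2.1⟩
    · rw [ht]
      simp only [scaleProg, Prog.whl, Prog.tb, level, Finset.sum_const, Finset.card_range,
        smul_eq_mul]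
      generalize Nat.clog 2 n = N
      ring_nf
      omega
  · rintro i hi - σ' ⟨F, g8, g9, g10⟩
    have hin : 2 ^ i < n := Nat.pow_lt_of_lt_clog hi
    have hii : i < 2 ^ i := Nat.lt_two_pow_self
    have e0 : σ'.reg 0 = n := (F.reg 0 (by decide)).trans h0
    have e1 : σ'.reg 1 = m := (F.reg 1 (by decide)).trans h1
    obtain ⟨s1, s2, s3⟩ := sideUpTo_spec hm i
    obtain ⟨t1, t2, t3⟩ := sideUpTo_spec hm (i + 1)
    have es : sideUpTo m (i + 1) =
      sideUpTo m i * (1 + if sideUpTo m i * sideUpTo m i < m + m then 1 else 0) := rfl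
    have t4 : sideUpTo m (i + 1) ≤ sideUpTo m (i + 1) * sideUpTo m (i + 1) := Nat.le_mul_self _
    refine ⟨?_, ?_, ?_⟩
    · rw [Expr.ok_lt, Expr.ok_var, Expr.ok_var]
      exact ⟨by decide, by decide⟩
    · rw [Expr.eval_lt, Expr.eval_var, Expr.eval_var, g10, e0, if_pos hin]
      exact one_ne_zero
    · refine Tri.asg_seq hW (by decide) ?_ ?_
      · simp only [Expr.ok_mul, Expr.ok_add, Expr.ok_lt, Expr.ok_var, Expr.ok_lit, Expr.eval_add,
          Expr.eval_lt, Expr.eval_mul, Expr.eval_var, Expr.eval_lit, g8, e1]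
        refine ⟨by decide, ⟨hW, ⟨⟨by decide, by decide, by omega⟩, by decide, by decide,
          by omega⟩, ?_⟩, ?_⟩
        · split_ifs <;> omega
        · rw [← es]
          omega
      have ev : (Expr.var 8 * (.lit 1 + .lt (.var 8 * .var 8) (.var 1 + .var 1))).eval σ' [] =
          sideUpTo m (i + 1) := by
        simp only [Expr.eval_add, Expr.eval_lt, Expr.eval_mul, Expr.eval_var, Expr.eval_lit, g8,
          e1]
        rfl
      rw [ev]
      have F' := F.trans (Frame.upd σ' 8 (sideUpTo m (i + 1)))
      refine Tri.asg_seq hW (by decide) ?_ ?_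
      · simp only [Expr.ok_add, Expr.ok_var, Expr.ok_lit, Expr.eval_var, Expr.eval_lit]
        refine ⟨by decide, hW, ?_⟩
        simp [g9]
        omega
      refine Tri.asg hW (by decide) ?_ ?_
      · simp only [Expr.ok_add, Expr.ok_var, Expr.eval_var]
        refine ⟨by decide, by decide, ?_⟩
        simp [g10]
        omega
      · refine ⟨⟨fun r hr => ?_, ?_, ?_⟩, ?_, ?_, ?_⟩
        · have := F.reg r hr
          simp at hr
          simp [hr, this]
        · simpa using F.mem
        · simpa using F.queries
        · simp
        · simp [Expr.eval_add, Expr.eval_var, Expr.eval_lit, g9]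
        · simp [Expr.eval_add, Expr.eval_var, g10]
          ring
  · rintro - σ' ⟨F, g8, g9, g10⟩
    have e0 : σ'.reg 0 = n := (F.reg 0 (by decide)).trans h0
    refine ⟨?_, ?_⟩
    · rw [Expr.ok_lt, Expr.ok_var, Expr.ok_var]
      exact ⟨by decide, by decide⟩
    · rw [Expr.eval_lt, Expr.eval_var, Expr.eval_var, g10, e0, if_neg]
      exact not_lt.2 (Nat.le_pow_clog one_lt_two n)

theorem tri_paramProg {a m h num den : ℕ} (hk : 0 < k) (hm : 0 < m) (hden : 0 < den)
    (hw : 4 * (a + 1) * weight H m n * level n * (den * den) + 1 < 2 ^ w)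
    (hw' : h * (num * num) < 2 ^ w) (hX : coverNum H ≤ X) (hh : 0 < h)
    (h2 : σ.reg 2 = h) (h3 : σ.reg 3 = num) (h4 : σ.reg 4 = den)
    (h7 : σ.reg 7 = coverNum H) (h8 : σ.reg 8 = side m n) (h9 : σ.reg 9 = level n)
    (h17 : σ.reg 17 = k ^ k) :
    Tri G nbr w (paramProg a) ((paramProg a).tb X) σ (PMF.pure ()) fun _ σ' =>
      Frame [11, 16, 12] 0 σ σ' ∧ σ'.reg 11 = side m n ^ coverNum H ∧
      σ'.reg 16 = weight H m n ∧ σ'.reg 12 = trials H a n m h num den := by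
  have hs : 0 < side m n := (sideUpTo_spec hm _).1
  have hkk : 0 < k ^ k := pow_pos hk k
  have hA : 0 < side m n ^ coverNum H := pow_pos hs _
  have hM : 0 < weight H m n := Nat.mul_pos hkk hA
  have hL : 0 < level n := Nat.succ_pos _
  have hd : 0 < den * den := Nat.mul_pos hden hden
  -- All factors are positive, so every intermediate product of the evaluation is below the final
  -- bounds `hw` and `hw'`.
  have b1 : 4 * (a + 1) * weight H m n * level n ≤
    4 * (a + 1) * weight H m n * level n * (den * den) := Nat.le_mul_of_pos_right _ hd
  have b2 : 4 * (a + 1) * weight H m n ≤ 4 * (a + 1) * weight H m n * level n :=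
    Nat.le_mul_of_pos_right _ hL
  have b3 : 4 * (a + 1) ≤ 4 * (a + 1) * weight H m n := Nat.le_mul_of_pos_right _ hM
  have b4 : weight H m n ≤ 4 * (a + 1) * weight H m n := Nat.le_mul_of_pos_left _ (by omega)
  have b5 : side m n ^ coverNum H ≤ weight H m n := Nat.le_mul_of_pos_left _ hkk
  have b6 : den * den ≤ 4 * (a + 1) * weight H m n * level n * (den * den) :=
    Nat.le_mul_of_pos_left _ (by positivity)
  have b7 : num * num ≤ h * (num * num) := Nat.le_mul_of_pos_left _ hh
  have hW : 1 < 2 ^ w := by omega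
  obtain ⟨d1, d2⟩ := powExpr_spec (σ := σ) (X := X) hW (by decide) (by decide) h8 h7 hX
    (fun i hi => lt_of_le_of_lt (Nat.pow_le_pow_right hs hi) (by omega)) []
  refine Tri.asg_seq hW (by decide) d2 ?_
  rw [d1]
  have F₁ := Frame.upd σ 11 (side m n ^ coverNum H)
  set σ₁ := σ.upd 11 (side m n ^ coverNum H) with hσ₁
  have e17 : σ₁.reg 17 = k ^ k := (F₁.reg 17 (by decide)).trans h17
  have e11 : σ₁.reg 11 = side m n ^ coverNum H := by simp [hσ₁]
  refine Tri.asg_seq hW (by decide) ?_ ?_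
  · rw [Expr.ok_mul, Expr.ok_var, Expr.ok_var, Expr.eval_var, Expr.eval_var, e17, e11]
    refine ⟨by decide, by decide, ?_⟩
    rw [← weight]
    omega
  rw [Expr.eval_mul, Expr.eval_var, Expr.eval_var, e17, e11, ← weight]
  have F₂ := F₁.trans (Frame.upd σ₁ 16 (weight H m n))
  set σ₂ := σ₁.upd 16 (weight H m n) with hσ₂
  have g2 : σ₂.reg 2 = h := (F₂.reg 2 (by decide)).trans h2
  have g3 : σ₂.reg 3 = num := (F₂.reg 3 (by decide)).trans h3
  have g4 : σ₂.reg 4 = den := (F₂.reg 4 (by decide)).trans h4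
  have g9 : σ₂.reg 9 = level n := (F₂.reg 9 (by decide)).trans h9
  have g16 : σ₂.reg 16 = weight H m n := by simp [hσ₂]
  refine Tri.asg hW (by decide) ?_ ?_
  · simp only [Expr.ok_add, Expr.ok_mul, Expr.ok_div, Expr.ok_var, Expr.ok_lit, Expr.eval_mul,
      Expr.eval_div, Expr.eval_var, Expr.eval_lit, g2, g3, g4, g9, g16]
    refine ⟨⟨⟨⟨⟨by omega, by decide, by omega⟩, by decide, by omega⟩,
      ⟨by decide, by decide, by omega⟩, by omega⟩, by decide, ⟨by decide, by decide, by omega⟩,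
      hw'⟩, hW, ?_⟩
    have := Nat.div_le_self (4 * (a + 1) * weight H m n * level n * (den * den)) (h * (num * num))
    omega
  · refine ⟨F₂.trans (Frame.upd σ₂ 12 _), by simp [hσ₂, hσ₁], by simp [hσ₂], ?_⟩
    simp only [State.upd_reg, if_true, Expr.eval_add, Expr.eval_mul, Expr.eval_div, Expr.eval_var,
      Expr.eval_lit, g2, g3, g4, g9, g16, trials]

end Setup

/-! ### Reading the graph into memory -/

open SubgraphCount.Expr in
/-- Read one entry of an adjacency list. -/
def readNeighbor : Prog :=
  .seq (.instr (.neighbor 24 21 22)) (.seq (.sto (cell 4 (var 21 * var 0 + var 22)) (var 24))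
    (.seq (.sto (cell 5 (var 21 * var 0 + var 24)) (lit 1)) (.seq (.sto (cell 3 (var 23)) (var 21))
      (.asg 23 (var 23 + lit 1)))))

open SubgraphCount.Expr in
/-- Read the degree and the neighbors of a vertex. -/
def readVertex : Prog :=
  .seq (.instr (.degree 25 21)) (.seq (.sto (cell 2 (var 21)) (var 25))
    (.forc 22 (var 25) readNeighbor))

open SubgraphCount.Expr in
/-- Read the whole graph into memory. -/
def readProg : Prog :=
  .seq (.asg 23 (lit 0)) (.seq (.forc 21 (var 0) readVertex) (.asg 13 (lit 1)))

section ForLoop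

variable {n : ℕ} {G : SimpleGraph (Fin n)} [DecidableRel G.Adj]
  {nbr : ∀ v : Fin n, Fin (G.degree v) ≃ G.neighborSet v} {w : ℕ} {α : Type} {σ : State}

/-- The overhead of a round is constant because the bound is a register, while the cost of the body
may depend on the round. This allows reading time to be summed over the degrees. -/
theorem Tri.forc_sum (hW : 1 < 2 ^ w) {x : ℕ} {y : ℕ} {p : Prog} (N : ℕ) (t : ℕ → ℕ)
    (κ : ℕ → α → PMF α) (Inv : ℕ → α → State → Prop) (hx : x < numVars) (hy : y < numVars)
    (hN : N < 2 ^ w)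
    (hinv : ∀ i ≤ N, ∀ a σ, Inv i a σ → σ.reg x = i ∧ σ.reg y = N)
    (hstep : ∀ i < N, ∀ a σ, Inv i a σ → Tri G nbr w p (t i) σ (κ i a)
      fun b σ' => σ'.reg x = i ∧ Inv (i + 1) b (σ'.upd x (i + 1)))
    {a : α} (h0 : Inv 0 a (σ.upd x 0)) :
    Tri G nbr w (.forc x (.var y) p)
      ((Prog.forc x (.var y) .skip).tb 1 * (N + 1 + ∑ i ∈ Finset.range N, t i)) σ
      (chain κ 0 N a) (Inv N) := by
  refine (Tri.forc (X := 1) hW N t κ Inv hx hN (fun i hi a σ h => ⟨(hinv i hi a σ h).1,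
    (Expr.ok_var _ _ _ _ _).2 hy,
    (hinv i hi a σ h).2⟩) hstep h0).mono ?_
  have e : ∑ i ∈ Finset.range N, (2 + (1 + t i +
      (Prog.asg x (.bin .add (.var x) (.lit 1))).tb 1) +
      ((Expr.bin .lt (.var x) (.var y)).code numVars []).tb 1) =
      N * (3 + (Prog.asg x (.bin .add (.var x) (.lit 1))).tb 1 +
      ((Expr.bin .lt (.var x) (.var y)).code numVars []).tb 1) + ∑ i ∈ Finset.range N, t i := by
    rw [← smul_eq_mul, ← Finset.card_range N, ← Finset.sum_const, Finset.card_range,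
      ← Finset.sum_add_distrib]
    exact Finset.sum_congr rfl fun i _ => by omega
  rw [e]
  simp only [Prog.forc, Prog.whl, Prog.tb]
  generalize (Prog.asg x (.bin .add (.var x) (.lit 1))).tb 1 = a₁
  generalize ((Expr.bin .lt (.var x) (.var y)).code numVars []).tb 1 = a₂
  generalize (Prog.asg x (.lit 0)).tb 1 = a₃
  generalize ∑ i ∈ Finset.range N, t i = S
  ring_nf
  have : 0 ≤ S * a₁ + S * a₂ + S * a₃ + N * a₃ := Nat.zero_le _
  omega

end ForLoop

theorem mul_add_inj {n a b i j : ℕ} (hi : i < n) (hj : j < n) :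
    a * n + i = b * n + j ↔ a = b ∧ i = j := by
  refine ⟨fun h => ?_, fun h => by rw [h.1, h.2]⟩
  have h1 : a = b := by
    have := congrArg (· / n) h
    simpa [mul_comm _ n, Nat.mul_add_div (show n > 0 by omega), Nat.div_eq_of_lt hi,
      Nat.div_eq_of_lt hj] using this
  subst h1
  exact ⟨rfl, by omega⟩

section Read

variable {n k : ℕ} {G : SimpleGraph (Fin n)} [DecidableRel G.Adj]
  {nbr : ∀ v : Fin n, Fin (G.degree v) ≃ G.neighborSet v}
  {H : SimpleGraph (Fin k)} [DecidableRel H.Adj] {w A fl : ℕ} {σ : State}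

/-- The adjacency lists of the vertices below `v` and the first `i` entries of the list of `v`
have been read, and the degrees of the vertices below `d`. -/
structure ReadMem (G : SimpleGraph (Fin n)) [DecidableRel G.Adj]
    (nbr : ∀ v : Fin n, Fin (G.degree v) ≃ G.neighborSet v)
    (H : SimpleGraph (Fin k)) [DecidableRel H.Adj] (d v i : ℕ) (mem : ℕ → ℕ) : Prop where
  pattern : ∀ x < k * k, mem x = pairAnswer H (x / k) (x % k)
  degree : ∀ u < d, mem (addr k 2 u) = degreeAnswer G u
  neighbor : ∀ u < n, ∀ j < degreeAnswer G u, u < v ∨ u = v ∧ j < i →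
    mem (addr k 4 (u * n + j)) = neighborAnswer G nbr u j
  pair : ∀ u < n, ∀ x < n, mem (addr k 5 (u * n + x)) =
    if ∃ j < degreeAnswer G u, (u < v ∨ u = v ∧ j < i) ∧ neighborAnswer G nbr u j = x then 1 else 0
  source : ∀ x, ((Finset.range (∑ u ∈ Finset.range v, degreeAnswer G u + i)).filter
    fun y => mem (addr k 3 y) = x).card = if x < v then degreeAnswer G x else if x = v then i else 0

theorem ReadMem.degree_step {v : ℕ} {mem : ℕ → ℕ} (h : ReadMem G nbr H v v 0 mem) :
    ReadMem G nbr H (v + 1) v 0 (Function.update mem (addr k 2 v) (degreeAnswer G v)) := by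
  have hne : ∀ a i, a ≠ 2 → a < 8 → addr k a i ≠ addr k 2 v := by
    intro a i ha ha'
    rw [Ne, addr_inj ha' (by omega)]
    tauto
  refine ⟨fun x hx => ?_, fun u hu => ?_, fun u hu j hj hl => ?_, fun u hu x hx => ?_,
    fun x => ?_⟩
  · rw [Function.update_of_ne (by unfold addr; omega), h.pattern x hx]
  · rcases Nat.lt_succ_iff_lt_or_eq.1 hu with hu | rfl
    · rw [Function.update_of_ne, h.degree u hu]
      rw [Ne, addr_inj (by omega) (by omega)]
      omega
    · rw [Function.update_self]
  · rw [Function.update_of_ne (hne _ _ (by omega) (by omega)), h.neighbor u hu j hj hl]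
  · rw [Function.update_of_ne (hne _ _ (by omega) (by omega)), h.pair u hu x hx]
  · simp only [Function.update_of_ne (hne 3 _ (by omega) (by omega))]
    exact h.source x

/-- The three writes go to the arrays 4, 5 and 3. As the arrays are disjoint, each field is affected
by at most one of them. -/
theorem ReadMem.neighbor_step {d v i : ℕ} {mem : ℕ → ℕ} (hv : v < n) (hi : i < degreeAnswer G v)
    (h : ReadMem G nbr H d v i mem) :
    ReadMem G nbr H d v (i + 1) (Function.update (Function.update (Function.update mem
      (addr k 4 (v * n + i)) (neighborAnswer G nbr v i))
      (addr k 5 (v * n + neighborAnswer G nbr v i)) 1)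
      (addr k 3 (∑ u ∈ Finset.range v, degreeAnswer G u + i)) v) := by
  have hin : i < n := hi.trans_le (degreeAnswer_le v)
  have hun := neighborAnswer_lt (G := G) (nbr := nbr) (by omega) v i
  have hne : ∀ a i b j, a ≠ b → a < 8 → b < 8 → addr k a i ≠ addr k b j := by
    intro a i b j hab ha hb
    rw [Ne, addr_inj ha hb]
    tauto
  have hlow : ∀ x < k * k, ∀ a i, x ≠ addr k a i := by
    intro x hx a i
    unfold addr
    omega
  refine ⟨fun x hx => ?_, fun u hu => ?_, fun u hu j hj hl => ?_, fun u hu x hx => ?_,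
    fun x => ?_⟩
  · rw [Function.update_of_ne (hlow x hx _ _), Function.update_of_ne (hlow x hx _ _),
      Function.update_of_ne (hlow x hx _ _), h.pattern x hx]
  · rw [Function.update_of_ne (hne _ _ _ _ (by omega) (by omega) (by omega)),
      Function.update_of_ne (hne _ _ _ _ (by omega) (by omega) (by omega)),
      Function.update_of_ne (hne _ _ _ _ (by omega) (by omega) (by omega)), h.degree u hu]
  · rw [Function.update_of_ne (hne _ _ _ _ (by omega) (by omega) (by omega)),
      Function.update_of_ne (hne _ _ _ _ (by omega) (by omega) (by omega)),
      Function.update_apply]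
    have hjn : j < n := hj.trans_le (degreeAnswer_le u)
    have hiff : addr k 4 (u * n + j) = addr k 4 (v * n + i) ↔ u = v ∧ j = i := by
      rw [addr_inj (by omega) (by omega), mul_add_inj hjn hin, eq_self, true_and]
    by_cases e : u = v ∧ j = i
    · rw [if_pos (hiff.2 e), e.1, e.2]
    · rw [if_neg fun h => e (hiff.1 h), h.neighbor u hu j hj (by omega)]
  · rw [Function.update_of_ne (hne _ _ _ _ (by omega) (by omega) (by omega)),
      Function.update_apply, Function.update_of_ne (hne _ _ _ _ (by omega) (by omega) (by omega)),
      h.pair u hu x hx]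
    have hiff : addr k 5 (u * n + x) = addr k 5 (v * n + neighborAnswer G nbr v i) ↔
        u = v ∧ x = neighborAnswer G nbr v i := by
      rw [addr_inj (by omega) (by omega), mul_add_inj hx hun, eq_self, true_and]
    by_cases e : u = v ∧ x = neighborAnswer G nbr v i
    · obtain ⟨rfl, rfl⟩ := e
      rw [if_pos rfl, if_pos ⟨i, hi, Or.inr ⟨rfl, Nat.lt_succ_self i⟩, rfl⟩]
    · rw [if_neg fun h => e (hiff.1 h)]
      congr 1
      rw [eq_iff_iff]
      refine exists_congr fun j => and_congr_right fun hj => and_congr_left fun hx => ?_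
      constructor
      · omega
      · rintro (hl | ⟨rfl, hl⟩)
        · exact Or.inl hl
        · rcases Nat.lt_succ_iff_lt_or_eq.1 hl with hl | rfl
          · exact Or.inr ⟨rfl, hl⟩
          · exact absurd ⟨rfl, hx.symm⟩ e
  -- The pointer addresses the cell just behind those in use, so the new range gains one cell, which
  -- contains `v`, and the older cells are untouched.
  · rw [← add_assoc, Finset.range_add_one, Finset.filter_insert, Function.update_self]
    have hcong : (Finset.range (∑ u ∈ Finset.range v, degreeAnswer G u + i)).filter (fun y =>
        Function.update (Function.update (Function.update mem
          (addr k 4 (v * n + i)) (neighborAnswer G nbr v i))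
          (addr k 5 (v * n + neighborAnswer G nbr v i)) 1)
          (addr k 3 (∑ u ∈ Finset.range v, degreeAnswer G u + i)) v (addr k 3 y) = x) =
        (Finset.range (∑ u ∈ Finset.range v, degreeAnswer G u + i)).filter
          fun y => mem (addr k 3 y) = x := by
      refine Finset.filter_congr fun y hy => ?_
      rw [Function.update_of_ne, Function.update_of_ne (hne _ _ _ _ (by omega) (by omega)
        (by omega)), Function.update_of_ne (hne _ _ _ _ (by omega) (by omega) (by omega))]
      rw [Ne, addr_inj (by omega) (by omega)]
      have := Finset.mem_range.1 hy
      omega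
    rw [hcong]
    by_cases e : v = x
    · subst e
      rw [if_pos rfl, Finset.card_insert_of_notMem (by simp), h.source]
      simp
    · rw [if_neg e, h.source, if_neg (show ¬ x = v from fun h => e h.symm),
        if_neg (show ¬ x = v from fun h => e h.symm)]

/-- A completely read list of `v` is the same as an empty initial segment of the list of `v + 1`. -/
theorem ReadMem.next {v : ℕ} {mem : ℕ → ℕ} (h : ReadMem G nbr H (v + 1) v (degreeAnswer G v) mem) :
    ReadMem G nbr H (v + 1) (v + 1) 0 mem := by
  refine ⟨h.pattern, h.degree, fun u hu j hj hl => ?_, fun u hu x hx => ?_, fun x => ?_⟩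
  · refine h.neighbor u hu j hj ?_
    by_cases e : u = v
    · exact Or.inr ⟨e, e ▸ hj⟩
    · omega
  · rw [h.pair u hu x hx]
    congr 1
    rw [eq_iff_iff]
    refine exists_congr fun j => and_congr_right fun hj => and_congr_left fun hx => ?_
    constructor
    · omega
    · intro h
      by_cases e : u = v
      · exact Or.inr ⟨e, e ▸ hj⟩
      · omega
  · rw [add_zero, Finset.sum_range_succ, h.source x]
    by_cases e : x = v
    · subst e
      simp
    · by_cases e' : x < v
      · rw [if_pos e', if_pos (by omega)]
      · rw [if_neg e', if_neg e, if_neg (by omega)]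
        split_ifs <;> rfl

theorem sum_degreeAnswer : ∑ u ∈ Finset.range n, degreeAnswer G u = 2 * G.edgeFinset.card := by
  rw [Finset.sum_range, ← G.sum_degrees_eq_twice_card_edges]
  exact Finset.sum_congr rfl fun v _ => degreeAnswer_fin v

theorem exists_neighborAnswer_iff {u x : ℕ} (hu : u < n) (hx : x < n) :
    (∃ j < degreeAnswer G u, neighborAnswer G nbr u j = x) ↔ G.Adj ⟨u, hu⟩ ⟨x, hx⟩ := by
  constructor
  · rintro ⟨j, hj, rfl⟩
    have := pairAnswer_neighborAnswer (nbr := nbr) hu hj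
    by_contra hc
    simp [pairAnswer, hc] at this
  · intro h
    set j := (nbr ⟨u, hu⟩).symm ⟨⟨x, hx⟩, h⟩ with hj
    refine ⟨j, by simp [degreeAnswer, hu], ?_⟩
    simp [neighborAnswer, hu, hj]

/-- Once all lists have been read, a cell of array 5 is marked exactly if some entry of a list
accounts for it, which is adjacency. -/
theorem ReadMem.memGood {mem : ℕ → ℕ} (h : ReadMem G nbr H n n 0 mem) :
    MemGood G nbr H fl mem := by
  refine ⟨h.pattern, fun _ => ⟨h.degree, fun v hv i hi => h.neighbor v hv i hi (Or.inl hv),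
    fun u hu x hx => ?_, fun v => ?_⟩⟩
  · rw [h.pair u hu x hx]
    have := exists_neighborAnswer_iff (G := G) (nbr := nbr) hu hx
    simp only [hu, true_or, true_and, this]
    simp [pairAnswer, hu, hx]
  · have := h.source v
    rw [add_zero, sum_degreeAnswer] at this
    rw [this]
    split_ifs with h1 h2
    · rfl
    · simp [degreeAnswer, h2]
    · simp [degreeAnswer, h1]

/-- The situation while the graph is being read. -/
structure ReadInv (G : SimpleGraph (Fin n)) [DecidableRel G.Adj]
    (nbr : ∀ v : Fin n, Fin (G.degree v) ≃ G.neighborSet v)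
    (H : SimpleGraph (Fin k)) [DecidableRel H.Adj] (σ₀ : State) (d v i : ℕ) (σ : State) :
    Prop where
  vertex : σ.reg 21 = v
  pointer : σ.reg 23 = ∑ u ∈ Finset.range v, degreeAnswer G u + i
  reg : ∀ r < 20, σ.reg r = σ₀.reg r
  mem : ReadMem G nbr H d v i σ.mem
  queries : σ.queries ≤ σ₀.queries + d + (∑ u ∈ Finset.range v, degreeAnswer G u + i)

theorem sum_add_lt {v i : ℕ} (hv : v < n) (hi : i < degreeAnswer G v) :
    ∑ u ∈ Finset.range v, degreeAnswer G u + i < n * n := by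
  have h1 : ∑ u ∈ Finset.range (v + 1), degreeAnswer G u ≤ ∑ u ∈ Finset.range n, degreeAnswer G u :=
    Finset.sum_le_sum_of_subset (Finset.range_subset_range.2 hv)
  rw [Finset.sum_range_succ, sum_degreeAnswer] at h1
  have := two_mul_card_edgeFinset_le (G := G)
  omega

theorem tri_readNeighbor (hw : WordGood G k A w) {σ₀ : State} (hr₀ : RegGood G k A fl σ₀)
    {v i : ℕ} (hv : v < n) (hi : i < degreeAnswer G v)
    (h : σ.reg 22 = i ∧ σ.reg 25 = degreeAnswer G v ∧ ReadInv G nbr H σ₀ (v + 1) v i σ) :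
    Tri G nbr w readNeighbor (readNeighbor.tb 0) σ (PMF.pure ()) fun _ σ' =>
      σ'.reg 22 = i ∧ (σ'.upd 22 (i + 1)).reg 22 = i + 1 ∧
      (σ'.upd 22 (i + 1)).reg 25 = degreeAnswer G v ∧
      ReadInv G nbr H σ₀ (v + 1) v (i + 1) (σ'.upd 22 (i + 1)) := by
  obtain ⟨h22, h25, h⟩ := h
  have hW := hw.one_lt
  have hsq := hw.square
  have hnn : n ≤ n * n := Nat.le_mul_self n
  have hr : RegGood G k A fl σ := hr₀.congr h.reg
  have hin : i < n := hi.trans_le (degreeAnswer_le v)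
  have hun := neighborAnswer_lt (G := G) (nbr := nbr) (by omega) v i
  have hvi := mul_add_lt_sq hv hin
  have hvu := mul_add_lt_sq hv hun
  have hptr := sum_add_lt hv hi
  refine Tri.seq_det_tb (Q := fun _ σ' => σ' = (σ.addq 1).upd 24 (neighborAnswer G nbr v i))
    (Tri.neighbor (by decide) (by decide) (by rw [h.vertex, h22]; omega)
      (by rw [h.vertex, h22])) ?_
  rintro _ rfl
  set σ₁ := (σ.addq 1).upd 24 (neighborAnswer G nbr v i) with hσ₁
  have e21 : σ₁.reg 21 = v := by simp [hσ₁, h.vertex]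
  have e0 : σ₁.reg 0 = n := by simp [hσ₁, hr.n_eq]
  have e22 : σ₁.reg 22 = i := by simp [hσ₁, h22]
  have e23 : σ₁.reg 23 = ∑ u ∈ Finset.range v, degreeAnswer G u + i := by simp [hσ₁, h.pointer]
  have e24 : σ₁.reg 24 = neighborAnswer G nbr v i := by simp [hσ₁]
  have e6 : σ₁.reg 6 = k * k := by simp [hσ₁, hr.base_eq]
  refine Tri.sto_seq hW (ok_cell hw e6 (by decide) ?_ ?_) (by rw [Expr.ok_var]; decide) ?_
  · simp only [Expr.ok_add, Expr.ok_mul, Expr.ok_var, Expr.eval_mul, Expr.eval_var, e21, e0, e22]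
    exact ⟨⟨by decide, by decide, by omega⟩, by decide, by omega⟩
  · simpa only [Expr.eval_add, Expr.eval_mul, Expr.eval_var, e21, e0, e22]
  rw [eval_cell e6]
  simp only [Expr.eval_add, Expr.eval_mul, Expr.eval_var, e21, e0, e22, e24]
  set σ₂ := σ₁.put (addr k 4 (v * n + i)) (neighborAnswer G nbr v i) with hσ₂
  have f : ∀ r, σ₂.reg r = σ₁.reg r := fun r => rfl
  refine Tri.sto_seq hW (ok_cell hw ((f 6).trans e6) (by decide) ?_ ?_) (by rw [Expr.ok_lit]; omega)
    ?_
  · simp only [Expr.ok_add, Expr.ok_mul, Expr.ok_var, Expr.eval_mul, Expr.eval_var, f, e21, e0, e24]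
    exact ⟨⟨by decide, by decide, by omega⟩, by decide, by omega⟩
  · simpa only [Expr.eval_add, Expr.eval_mul, Expr.eval_var, f, e21, e0, e24]
  rw [eval_cell ((f 6).trans e6)]
  simp only [Expr.eval_add, Expr.eval_mul, Expr.eval_var, Expr.eval_lit, f, e21, e0, e24]
  set σ₃ := σ₂.put (addr k 5 (v * n + neighborAnswer G nbr v i)) 1 with hσ₃
  have f' : ∀ r, σ₃.reg r = σ₁.reg r := fun r => rfl
  refine Tri.sto_seq hW (ok_cell hw ((f' 6).trans e6) (by decide) (by rw [Expr.ok_var]; decide) ?_)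
    (by rw [Expr.ok_var]; decide) ?_
  · rwa [Expr.eval_var, f', e23]
  rw [eval_cell ((f' 6).trans e6)]
  simp only [Expr.eval_var, f', e23, e21]
  set σ₄ := σ₃.put (addr k 3 (∑ u ∈ Finset.range v, degreeAnswer G u + i)) v with hσ₄
  have f'' : ∀ r, σ₄.reg r = σ₁.reg r := fun r => rfl
  refine Tri.asg hW (by decide) ?_ ?_
  · simp only [Expr.ok_add, Expr.ok_var, Expr.ok_lit, Expr.eval_var, Expr.eval_lit, f'', e23]
    exact ⟨by decide, hW, by omega⟩
  · simp only [Expr.eval_add, Expr.eval_var, Expr.eval_lit, f'', e23]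
    refine ⟨by simp [f'', e22], by simp, ?_, by simp [f'', e21], by simp [add_assoc], ?_, ?_, ?_⟩
    · simp [f'', hσ₁, h25]
    · intro r hr
      simp only [State.upd_reg]
      rw [if_neg (by omega), if_neg (by omega), f'', hσ₁, State.upd_reg, if_neg (by omega),
        State.addq_reg, h.reg r hr]
    · exact h.mem.neighbor_step hv hi
    · have := h.queries
      simp only [State.upd_queries, hσ₄, hσ₃, hσ₂, hσ₁, State.put_queries, State.addq_queries]
      omega

/-- The time for reading a vertex with `d` neighbors. -/
def readCost (d : ℕ) : ℕ :=
  1 + 1 + (1 + (Prog.sto (.cell 2 (.var 21)) (.var 25)).tb 0 +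
    (Prog.forc 22 (.var 25) .skip).tb 1 * (d + 1 + d * readNeighbor.tb 0))

theorem tri_readVertex (hw : WordGood G k A w) {σ₀ : State} (hr₀ : RegGood G k A fl σ₀)
    {v : ℕ} (hv : v < n) (h : ReadInv G nbr H σ₀ v v 0 σ) :
    Tri G nbr w readVertex (readCost (degreeAnswer G v)) σ (PMF.pure ()) fun _ σ' =>
      σ'.reg 21 = v ∧ ReadInv G nbr H σ₀ (v + 1) (v + 1) 0 (σ'.upd 21 (v + 1)) := by
  have hW := hw.one_lt
  have hsq := hw.square
  have hnn : n ≤ n * n := Nat.le_mul_self n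
  have hr : RegGood G k A fl σ := hr₀.congr h.reg
  have hd := degreeAnswer_le (G := G) v
  refine Tri.seq_det (Q := fun _ σ' => σ' = (σ.addq 1).upd 25 (degreeAnswer G v))
    (Tri.degree (by decide) (by rw [h.vertex]; omega) (by rw [h.vertex])) ?_
  rintro _ rfl
  set σ₁ := (σ.addq 1).upd 25 (degreeAnswer G v) with hσ₁
  have e21 : σ₁.reg 21 = v := by simp [hσ₁, h.vertex]
  have e25 : σ₁.reg 25 = degreeAnswer G v := by simp [hσ₁]
  have e6 : σ₁.reg 6 = k * k := by simp [hσ₁, hr.base_eq]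
  refine Tri.seq_det (Q := fun _ σ' => σ' = σ₁.put (addr k 2 v) (degreeAnswer G v))
    (Tri.sto hW (ok_cell hw e6 (by decide) (by rw [Expr.ok_var]; decide) ?_)
      (by rw [Expr.ok_var]; decide) ?_) ?_
  · rw [Expr.eval_var, e21]
    omega
  · rw [eval_cell e6, Expr.eval_var, Expr.eval_var, e21, e25]
  rintro _ rfl
  set σ₂ := σ₁.put (addr k 2 v) (degreeAnswer G v) with hσ₂
  have hloop := Tri.forc_sum (G := G) (nbr := nbr) (σ := σ₂) (x := 22) (y := 25)
    (p := readNeighbor) (a := ()) hW (degreeAnswer G v) (fun _ => readNeighbor.tb 0)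
    (fun _ _ => PMF.pure ()) (fun i _ σ' => σ'.reg 22 = i ∧ σ'.reg 25 = degreeAnswer G v ∧
      ReadInv G nbr H σ₀ (v + 1) v i σ') (by decide) (by decide) (by omega)
    (fun i _ _ σ' h => ⟨h.1, h.2.1⟩)
    (fun i hi _ σ' h => tri_readNeighbor hw hr₀ hv hi h) ?_
  · rw [chain_pure, Finset.sum_const, Finset.card_range, smul_eq_mul] at hloop
    refine hloop.conseq ?_
    rintro - σ' ⟨-, -, h'⟩
    refine ⟨h'.vertex, by simp, ?_, fun r hr => ?_, h'.mem.next, ?_⟩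
    · simp [h'.pointer, Finset.sum_range_succ]
    · rw [State.upd_reg, if_neg (by omega), h'.reg r hr]
    · have := h'.queries
      rw [Finset.sum_range_succ, State.upd_queries]
      omega
  · refine ⟨by simp, by simp [hσ₂, e25], by simp [hσ₂, e21], ?_, fun r hr => ?_, ?_, ?_⟩
    · simp [hσ₂, hσ₁, h.pointer]
    · rw [State.upd_reg, if_neg (by omega), hσ₂, State.put_reg, hσ₁, State.upd_reg,
        if_neg (by omega), State.addq_reg, h.reg r hr]
    · exact h.mem.degree_step
    · have := h.queries
      simp only [State.upd_queries, hσ₂, State.put_queries, hσ₁, State.addq_queries]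
      omega

/-- The adjacency matrix of `G` is never cleared; its zeros come from the initial contents of the
memory behind the pattern. -/
theorem ReadMem.initial {mem : ℕ → ℕ} (h : ∀ x, mem x = if x < k * k then
    pairAnswer H (x / k) (x % k) else 0) : ReadMem G nbr H 0 0 0 mem := by
  refine ⟨fun x hx => by rw [h, if_pos hx], by simp, by simp, fun u hu x hx => ?_, by simp⟩
  rw [h, if_neg (by unfold addr; omega)]
  simp

/-- The constant `D` is chosen before everything else, so it depends neither on the graph nor on the
pattern. -/
theorem tri_readProg : ∃ D, ∀ {n : ℕ} {G : SimpleGraph (Fin n)} [DecidableRel G.Adj]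
    {nbr : ∀ v : Fin n, Fin (G.degree v) ≃ G.neighborSet v} {k : ℕ}
    {H : SimpleGraph (Fin k)} [DecidableRel H.Adj] {w A fl : ℕ} {σ : State},
    WordGood G k A w → RegGood G k A fl σ →
    (∀ x, σ.mem x = if x < k * k then pairAnswer H (x / k) (x % k) else 0) →
    Tri G nbr w readProg (D * (n + G.edgeFinset.card)) σ (PMF.pure ()) fun _ σ' =>
      (∀ r < 20, r ≠ 13 → σ'.reg r = σ.reg r) ∧ σ'.reg 13 = 1 ∧ MemGood G nbr H 1 σ'.mem ∧
      σ'.queries ≤ σ.queries + (n + 2 * G.edgeFinset.card) := by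
  refine ⟨1 + (Prog.asg 23 (.lit 0)).tb 0 + (1 + ((Prog.forc 21 (.var 0) .skip).tb 1 *
    (2 + readCost 0 + 2 * readCost 1)) + (Prog.asg 13 (.lit 1)).tb 0), ?_⟩
  intro n G _ nbr k H _ w A fl σ hw hr hm
  have hW := hw.one_lt
  have hsq := hw.square
  have hn := hw.n_pos
  have hnn : n ≤ n * n := Nat.le_mul_self n
  refine Tri.mono (t := 1 + (Prog.asg 23 (.lit 0)).tb 0 + (1 + ((Prog.forc 21 (.var 0) .skip).tb 1 *
    (n + 1 + ∑ v ∈ Finset.range n, readCost (degreeAnswer G v))) +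
    (Prog.asg 13 (.lit 1)).tb 0)) ?_ ?_
  · refine Tri.seq_det (Q := fun _ σ' => σ' = σ.upd 23 0)
      (Tri.asg hW (by decide) (by rw [Expr.ok_lit]; omega) rfl) ?_
    rintro _ rfl
    have hloop := Tri.forc_sum (G := G) (nbr := nbr) (σ := σ.upd 23 0) (x := 21) (y := 0)
      (p := readVertex) (a := ()) hW n (fun v => readCost (degreeAnswer G v))
      (fun _ _ => PMF.pure ()) (fun v _ σ' => ReadInv G nbr H σ v v 0 σ') (by decide) (by decide)
      (by omega) (fun v _ _ σ' h => ⟨h.vertex, (h.reg 0 (by omega)).trans hr.n_eq⟩)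
      (fun v hv _ σ' h => tri_readVertex hw hr hv h) ?_
    · rw [chain_pure] at hloop
      refine Tri.seq_det hloop fun σ' h => ?_
      refine Tri.asg hW (by decide) (by rw [Expr.ok_lit]; omega) ?_
      refine ⟨fun r hr hne => ?_, by simp [Expr.eval_lit], h.mem.memGood, ?_⟩
      · rw [State.upd_reg, if_neg hne, h.reg r hr]
      · have := h.queries
        rw [sum_degreeAnswer] at this
        rw [State.upd_queries]
        omega
    · refine ⟨by simp, by simp, fun r hr => ?_, ReadMem.initial hm, by simp⟩
      simp only [State.upd_reg]
      rw [if_neg (by omega), if_neg (by omega)]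
  -- The cost of a vertex is affine in its degree, and the degrees sum to `2m`.
  · have hc : ∀ d, readCost d = readCost 0 + d * (readCost 1 - readCost 0) := by
      intro d
      have : readCost 1 - readCost 0 =
          (Prog.forc 22 (.var 25) .skip).tb 1 * (1 + readNeighbor.tb 0) := by
        rw [Nat.sub_eq_iff_eq_add] <;> simp only [readCost] <;> ring_nf
        omega
      rw [this]
      simp only [readCost]
      ring
    have hsum : ∑ v ∈ Finset.range n, readCost (degreeAnswer G v) ≤
        (readCost 0 + 2 * readCost 1) * (n + G.edgeFinset.card) := by
      rw [Finset.sum_congr rfl fun v _ => hc _, Finset.sum_add_distrib, ← Finset.sum_mul,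
        sum_degreeAnswer, Finset.sum_const, Finset.card_range, smul_eq_mul]
      calc n * readCost 0 + 2 * G.edgeFinset.card * (readCost 1 - readCost 0) ≤
          n * readCost 0 + 2 * G.edgeFinset.card * readCost 1 :=
            Nat.add_le_add_left (Nat.mul_le_mul_left _ (Nat.sub_le _ _)) _
        _ ≤ n * readCost 0 + 2 * G.edgeFinset.card * readCost 1 +
            (G.edgeFinset.card * readCost 0 + 2 * n * readCost 1) := Nat.le_add_right _ _
        _ = _ := by ring
    have h1 : n + 1 + ∑ v ∈ Finset.range n, readCost (degreeAnswer G v) ≤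
        (2 + readCost 0 + 2 * readCost 1) * (n + G.edgeFinset.card) := by
      have : (2 + readCost 0 + 2 * readCost 1) * (n + G.edgeFinset.card) =
        2 * (n + G.edgeFinset.card) + (readCost 0 + 2 * readCost 1) * (n + G.edgeFinset.card) := by
          ring
      omega
    have h2 := Nat.mul_le_mul_left ((Prog.forc 21 (.var 0) .skip).tb 1) h1
    have h3 : ∀ c : ℕ, c ≤ c * (n + G.edgeFinset.card) :=
      fun c => Nat.le_mul_of_pos_right c (by omega)
    have h4 := h3 (1 + (Prog.asg 23 (.lit 0)).tb 0 + (1 + (Prog.asg 13 (.lit 1)).tb 0))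
    rw [← mul_assoc] at h2
    have e : (1 + (Prog.asg 23 (.lit 0)).tb 0 + (1 + ((Prog.forc 21 (.var 0) .skip).tb 1 *
      (2 + readCost 0 + 2 * readCost 1)) + (Prog.asg 13 (.lit 1)).tb 0)) *
      (n + G.edgeFinset.card) = (1 + (Prog.asg 23 (.lit 0)).tb 0 +
        (1 + (Prog.asg 13 (.lit 1)).tb 0)) * (n + G.edgeFinset.card) +
        (Prog.forc 21 (.var 0) .skip).tb 1 * (2 + readCost 0 + 2 * readCost 1) *
        (n + G.edgeFinset.card) := by ring
    omega

end Read

/-! ### The complete algorithm -/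

open SubgraphCount.Expr in
/-- The algorithm. -/
def estimateProg (a : ℕ) : Prog :=
  .seq patternProg (.seq scaleProg (.seq (paramProg a)
    (.seq (.ifc (lt (var 12) (var 0 + var 1)) .skip readProg) (.seq (.forc 20 (var 12) trialProg)
      (.seq (.asg 0 (var 15 * var 16)) (.asg 1 (var 12 * var 14)))))))

/-- Words are large enough for `estimateProg`. -/
structure SizeGood {n k : ℕ} (G : SimpleGraph (Fin n)) [DecidableRel G.Adj]
    (H : SimpleGraph (Fin k)) [DecidableRel H.Adj] (a h num den w : ℕ) : Prop where
  trial : WordGood G k (side G.edgeFinset.card n ^ coverNum H) w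
  den_pos : 0 < den
  h_pos : 0 < h
  ratio : 4 * (a + 1) * weight H G.edgeFinset.card n * level n * (den * den) + 1 < 2 ^ w
  divisor : h * (num * num) < 2 ^ w
  trials_lt : trials H a n G.edgeFinset.card h num den + 1 < 2 ^ w
  numerator : trials H a n G.edgeFinset.card h num den * weight H G.edgeFinset.card n < 2 ^ w
  denominator : trials H a n G.edgeFinset.card h num den * (automorphisms H).card < 2 ^ w
  level_le : level n ≤ trials H a n G.edgeFinset.card h num den

section Main

variable {n k : ℕ} {G : SimpleGraph (Fin n)} [DecidableRel G.Adj]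
  {nbr : ∀ v : Fin n, Fin (G.degree v) ≃ G.neighborSet v}
  {H : SimpleGraph (Fin k)} [DecidableRel H.Adj] {w X A fl : ℕ} {σ : State}

/-- The situation before trial `i`, with `c` acceptances so far. -/
structure LoopInv (G : SimpleGraph (Fin n)) [DecidableRel G.Adj]
    (nbr : ∀ v : Fin n, Fin (G.degree v) ≃ G.neighborSet v)
    (H : SimpleGraph (Fin k)) [DecidableRel H.Adj] (fl : ℕ) (σ₀ : State) (i c : ℕ) (σ : State) :
    Prop where
  index : σ.reg 20 = i
  count : σ.reg 15 = c
  count_le : c ≤ i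
  reg : ∀ r < 20, r ≠ 15 → σ.reg r = σ₀.reg r
  mem : MemGood G nbr H fl σ.mem
  queries : σ.queries ≤ σ₀.queries + i * ((2 * k + k * k) * (1 - fl))

/-- The counter of acceptances never exceeds the number of rounds, so `N + 1 < 2 ^ w` keeps it from
overflowing. -/
theorem tri_trials (hE : G.edgeFinset.Nonempty) (hk : (Finset.range k).Nonempty)
    (hw : WordGood G k A w) (hA : 0 < A) {N : ℕ} (hN : N + 1 < 2 ^ w) (hr : RegGood G k A fl σ)
    (hm : MemGood G nbr H fl σ.mem) (h12 : σ.reg 12 = N) (h15 : σ.reg 15 = 0) :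
    Tri G nbr w (.forc 20 (.var 12) trialProg) ((Prog.forc 20 (.var 12) .skip).tb 1 *
      (N + 1 + N * trialProg.tb (k * k))) σ (successes (trialDist G nbr H hE hk A) N)
      (LoopInv G nbr H fl σ N) := by
  have := Tri.forc_sum (G := G) (nbr := nbr) (σ := σ) (x := 20) (y := 12) (p := trialProg) (a := 0)
    hw.one_lt N (fun _ => trialProg.tb (k * k))
    (fun _ c => (trialDist G nbr H hE hk A).map fun b => c + b.toNat)
    (LoopInv G nbr H fl σ) (by decide) (by decide) (by omega)
    (fun i _ c σ' h => ⟨h.index, (h.reg 12 (by omega) (by omega)).trans h12⟩) ?_ ?_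
  · rwa [Finset.sum_const, Finset.card_range, smul_eq_mul] at this
  · intro i hi c σ' h
    have hc := h.count_le
    have hr' : RegGood G k A fl σ' :=
      ⟨(h.reg 0 (by omega) (by omega)).trans hr.n_eq, (h.reg 1 (by omega) (by omega)).trans hr.m_eq,
        (h.reg 5 (by omega) (by omega)).trans hr.k_eq,
        (h.reg 6 (by omega) (by omega)).trans hr.base_eq,
        (h.reg 11 (by omega) (by omega)).trans hr.acc_eq,
        (h.reg 13 (by omega) (by omega)).trans hr.flag_eq⟩
    refine (tri_trialProg hE hk hw hA hr' h.mem (by rw [h.count]; omega) le_rfl).map _ ?_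
    rintro b σ'' ⟨g1, g2, g3, g4⟩
    refine ⟨(g2 20 (by omega) (by omega)).trans h.index, by simp, ?_, ?_, ?_, g3, ?_⟩
    · simp [g1, h.count]
    · have := Bool.toNat_le b
      omega
    · intro r hr hne
      rw [State.upd_reg, if_neg (by omega), g2 r (by omega) hne, h.reg r hr hne]
    · have := h.queries
      rw [State.upd_queries, add_one_mul]
      omega
  · refine ⟨by simp, by simp [h15], le_rfl, fun r hr _ => ?_, hm, by simp⟩
    rw [State.upd_reg, if_neg (by omega)]

/-- Reading the graph takes time at most a constant times `n + m` and is done only if this is at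
most `N`. So the total time is of order `N` in both cases, and either the trials make all the
queries or the reading does. -/
theorem exists_tri_estimateProg (a : ℕ) (hk : 0 < k) (hkne : (Finset.range k).Nonempty) :
    ∃ B D, ∀ {n : ℕ} {G : SimpleGraph (Fin n)} [DecidableRel G.Adj]
      {nbr : ∀ v : Fin n, Fin (G.degree v) ≃ G.neighborSet v} {h w : ℕ} {ε : ℚ}
      (hE : G.edgeFinset.Nonempty), B < 2 ^ w → SizeGood G H a h ε.num.natAbs ε.den w →
      Tri G nbr w (estimateProg a) (D * trials H a n G.edgeFinset.card h ε.num.natAbs ε.den)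
        (initState H n G.edgeFinset.card h ε)
        (successes (trialDist G nbr H hE hkne (side G.edgeFinset.card n ^ coverNum H))
          (trials H a n G.edgeFinset.card h ε.num.natAbs ε.den)) fun c σ =>
        σ.reg 0 = c * weight H G.edgeFinset.card n ∧
        σ.reg 1 = trials H a n G.edgeFinset.card h ε.num.natAbs ε.den * (automorphisms H).card ∧
        (trials H a n G.edgeFinset.card h ε.num.natAbs ε.den < n + G.edgeFinset.card ∧
          σ.queries ≤ trials H a n G.edgeFinset.card h ε.num.natAbs ε.den * (2 * k + k * k) ∨
        n + G.edgeFinset.card ≤ trials H a n G.edgeFinset.card h ε.num.natAbs ε.den ∧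
          σ.queries ≤ n + 2 * G.edgeFinset.card) := by
  have hp : ∀ i < k, ∀ j < k, (initState H 0 0 0 0).mem (i * k + j) = pairAnswer H i j := by
    intro i hi j hj
    have := mul_add_lt_sq hi hj
    simp only [initState, if_pos this]
    congr 1
    · rw [mul_comm, Nat.mul_add_div hk, Nat.div_eq_of_lt hj, add_zero]
    · rw [mul_comm, Nat.mul_add_mod, Nat.mod_eq_of_lt hj]
  obtain ⟨B, hB⟩ := tri_patternProg hk (σ₀ := initState H 0 0 0 0) rfl hp
  obtain ⟨D₀, hD₀⟩ := tri_readProg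
  refine ⟨B, 20 + patternProg.tb B + scaleProg.tb 1 + (paramProg a).tb (coverNum H) +
    ((Expr.lt (.var 12) (.var 0 + .var 1)).code numVars []).tb 0 + D₀ +
    (Prog.forc 20 (.var 12) .skip).tb 1 * (2 + trialProg.tb (k * k)) +
    (Prog.asg 0 (.var 15 * .var 16)).tb 0 + (Prog.asg 1 (.var 12 * .var 14)).tb 0, ?_⟩
  intro n G _ nbr h w ε hE hBw hs
  have hW := hs.trial.one_lt
  have hsq := hs.trial.square
  have hm := hs.trial.m_pos
  have hmn := two_mul_card_edgeFinset_le (G := G)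
  have hnn : n ≤ n * n := Nat.le_mul_self n
  have hA : 0 < side G.edgeFinset.card n ^ coverNum H := pow_pos (sideUpTo_spec hm _).1 _
  have hNM := hs.numerator
  have hNA := hs.denominator
  have hNw := hs.trials_lt
  have hLN := hs.level_le
  have hN1 : 1 ≤ trials H a n G.edgeFinset.card h ε.num.natAbs ε.den := Nat.succ_pos _
  set σ := initState H n G.edgeFinset.card h ε with hσ
  set m := G.edgeFinset.card with hmdef
  set N := trials H a n m h ε.num.natAbs ε.den with hNdef
  -- The exact sum of the running times of the parts, with `D₀ * N` for the branch that may read the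
  -- graph; it is compared with `D * N` only at the end.
  refine Tri.mono (t := 1 + patternProg.tb B + (1 + scaleProg.tb 1 * level n +
    (1 + (paramProg a).tb (coverNum H) + (1 + (1 +
    ((Expr.lt (.var 12) (.var 0 + .var 1)).code numVars []).tb 0 + (1 + 1 + D₀ * N)) +
    (1 + (Prog.forc 20 (.var 12) .skip).tb 1 * (N + 1 + N * trialProg.tb (k * k)) +
    (1 + (Prog.asg 0 (.var 15 * .var 16)).tb 0 + (Prog.asg 1 (.var 12 * .var 14)).tb 0)))))) ?_ ?_
  · refine Tri.seq_det (hB hBw rfl rfl) ?_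
    rintro σ₁ ⟨F₁, p6, p7, p14, p17⟩
    refine Tri.seq_det (tri_scaleProg hm hmn hsq (F₁.reg 0 (by decide)) (F₁.reg 1 (by decide))) ?_
    rintro σ₂ ⟨F₂, p8, p9⟩
    have F₂' := F₁.trans F₂
    refine Tri.seq_det (tri_paramProg (H := H) (m := m) hk hm hs.den_pos hs.ratio hs.divisor le_rfl
      hs.h_pos (F₂'.reg 2 (by decide)) (F₂'.reg 3 (by decide)) (F₂'.reg 4 (by decide))
      ((F₂.reg 7 (by decide)).trans p7) p8 p9 ((F₂.reg 17 (by decide)).trans p17)) ?_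
    rintro σ₃ ⟨F₃, p11, p16, p12⟩
    have F := F₂'.trans F₃
    have e0 : σ₃.reg 0 = n := F.reg 0 (by decide)
    have e1 : σ₃.reg 1 = m := F.reg 1 (by decide)
    have e6 : σ₃.reg 6 = k * k :=
      (F₃.reg 6 (by decide)).trans ((F₂.reg 6 (by decide)).trans p6)
    have e14 : σ₃.reg 14 = (automorphisms H).card :=
      (F₃.reg 14 (by decide)).trans ((F₂.reg 14 (by decide)).trans p14)
    have e15 : σ₃.reg 15 = 0 := F.reg 15 (by decide)
    have e13 : σ₃.reg 13 = 0 := F.reg 13 (by decide)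
    have hr : RegGood G k (side m n ^ coverNum H) 0 σ₃ :=
      ⟨e0, e1, F.reg 5 (by decide), e6, p11, e13⟩
    have hmem : ∀ x, σ₃.mem x = if x < k * k then pairAnswer H (x / k) (x % k) else 0 := by
      rw [F.mem]
      exact fun x => rfl
    have hq : σ₃.queries = 0 := Nat.le_zero.1 F.queries
    refine Tri.seq_det (Q := fun _ σ' => (∀ r < 20, r ≠ 13 → σ'.reg r = σ₃.reg r) ∧
      MemGood G nbr H (σ'.reg 13) σ'.mem ∧ (N < n + m ∧ σ'.reg 13 = 0 ∧ σ'.queries = 0 ∨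
        n + m ≤ N ∧ σ'.reg 13 = 1 ∧ σ'.queries ≤ n + 2 * m)) ?_ ?_
    · refine Tri.ifc (X := 0) hW ?_ (fun hc => ?_) (fun hc => ?_)
      · simp only [Expr.ok_lt, Expr.ok_add, Expr.ok_var, Expr.eval_var, e0, e1]
        exact ⟨by decide, by decide, by decide, by omega⟩
      · simp only [Expr.eval_lt, Expr.eval_add, Expr.eval_var, e0, e1, p12] at hc
        have hlt : N < n + m := by
          by_contra hc'
          exact hc (if_neg hc')
        refine Tri.skip ⟨fun _ _ _ => rfl, ⟨fun x hx => ?_, fun h => absurd e13 h⟩,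
          Or.inl ⟨hlt, e13, hq⟩⟩
        rw [hmem, if_pos hx]
      · simp only [Expr.eval_lt, Expr.eval_add, Expr.eval_var, e0, e1, p12] at hc
        have hle : n + m ≤ N := by
          by_contra hc'
          rw [if_pos (not_le.1 hc')] at hc
          exact one_ne_zero hc
        refine ((hD₀ (nbr := nbr) hs.trial hr hmem).conseq ?_).mono (Nat.mul_le_mul_left _ hle)
        rintro - σ' ⟨g1, g2, g3, g4⟩
        exact ⟨g1, g2 ▸ g3, Or.inr ⟨hle, g2, by omega⟩⟩
    rintro σ₄ ⟨g1, g2, g3⟩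
    have hr₄ : RegGood G k (side m n ^ coverNum H) (σ₄.reg 13) σ₄ :=
      ⟨(g1 0 (by omega) (by omega)).trans hr.n_eq, (g1 1 (by omega) (by omega)).trans hr.m_eq,
        (g1 5 (by omega) (by omega)).trans hr.k_eq, (g1 6 (by omega) (by omega)).trans hr.base_eq,
        (g1 11 (by omega) (by omega)).trans hr.acc_eq, rfl⟩
    refine Tri.then_det (tri_trials hE hkne hs.trial hA hNw hr₄ g2
      ((g1 12 (by omega) (by omega)).trans p12) ((g1 15 (by omega) (by omega)).trans e15)) ?_
    intro c σ₅ h₅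
    have q12 : σ₅.reg 12 = N := (h₅.reg 12 (by omega) (by omega)).trans
      ((g1 12 (by omega) (by omega)).trans p12)
    have q14 : σ₅.reg 14 = (automorphisms H).card := (h₅.reg 14 (by omega) (by omega)).trans
      ((g1 14 (by omega) (by omega)).trans e14)
    have q16 : σ₅.reg 16 = weight H m n := (h₅.reg 16 (by omega) (by omega)).trans
      ((g1 16 (by omega) (by omega)).trans p16)
    have hcM : c * weight H m n ≤ N * weight H m n := Nat.mul_le_mul_right _ h₅.count_le
    refine Tri.seq_det (Q := fun _ σ' => σ' = σ₅.upd 0 (c * weight H m n))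
      (Tri.asg hW (by decide) ?_ ?_) ?_
    · simp only [Expr.ok_mul, Expr.ok_var, Expr.eval_var, h₅.count, q16]
      exact ⟨by decide, by decide, by omega⟩
    · simp only [Expr.eval_mul, Expr.eval_var, h₅.count, q16]
    rintro _ rfl
    refine Tri.asg hW (by decide) ?_ ?_
    · simp only [Expr.ok_mul, Expr.ok_var, Expr.eval_var, State.upd_reg]
      exact ⟨by decide, by decide, by simpa [q12, q14] using hNA⟩
    · refine ⟨by simp, by simp [Expr.eval_mul, Expr.eval_var, q12, q14], ?_⟩
      have hq₅ := h₅.queries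
      rcases g3 with ⟨i1, i2, i3⟩ | ⟨i1, i2, i3⟩
      · refine Or.inl ⟨i1, ?_⟩
        rw [i2, i3] at hq₅
        simpa using hq₅
      · refine Or.inr ⟨i1, ?_⟩
        rw [i2] at hq₅
        simp only [Nat.sub_self, mul_zero, add_zero] at hq₅
        exact hq₅.trans i3
  · generalize patternProg.tb B = t₁
    generalize scaleProg.tb 1 = t₂
    generalize (paramProg a).tb (coverNum H) = t₃
    generalize ((Expr.lt (.var 12) (.var 0 + .var 1)).code numVars []).tb 0 = t₄
    generalize (Prog.forc 20 (.var 12) .skip).tb 1 = t₅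
    generalize trialProg.tb (k * k) = t₆
    generalize (Prog.asg 0 (.var 15 * .var 16)).tb 0 = t₇
    generalize (Prog.asg 1 (.var 12 * .var 14)).tb 0 = t₈
    -- The logarithmic time of `scaleProg` is absorbed by the trials because `level n ≤ N`.
    have h1 := Nat.mul_le_mul_left t₂ hLN
    have h2 : t₅ * (N + 1 + N * t₆) ≤ t₅ * (2 + t₆) * N := by
      calc t₅ * (N + 1 + N * t₆) ≤ t₅ * (N + N + N * t₆) := by gcongr
        _ = _ := by ring
    have h3 : 20 + t₁ + t₃ + t₄ + t₇ + t₈ ≤ (20 + t₁ + t₃ + t₄ + t₇ + t₈) * N :=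
      Nat.le_mul_of_pos_right _ hN1
    have e : (20 + t₁ + t₂ + t₃ + t₄ + D₀ + t₅ * (2 + t₆) + t₇ + t₈) * N =
      (20 + t₁ + t₃ + t₄ + t₇ + t₈) * N + t₂ * N + D₀ * N + t₅ * (2 + t₆) * N := by ring
    omega

end Main

/-! ### Numerical bounds -/

theorem card_automorphisms_pos {W : Type*} [Fintype W] [DecidableEq W] (H : SimpleGraph W)
    [DecidableRel H.Adj] : 0 < (automorphisms H).card :=
  Finset.card_pos.2 ⟨id, by simp [automorphisms, Function.injective_id]⟩

theorem card_automorphisms_le {W : Type*} [Fintype W] [DecidableEq W] (H : SimpleGraph W)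
    [DecidableRel H.Adj] : (automorphisms H).card ≤ Fintype.card W ^ Fintype.card W := by
  refine (Finset.card_filter_le _ _).trans ?_
  simp

section Sizes

variable {n k : ℕ} {G : SimpleGraph (Fin n)} [DecidableRel G.Adj]
  {nbr : ∀ v : Fin n, Fin (G.degree v) ≃ G.neighborSet v}
  {H : SimpleGraph (Fin k)} [DecidableRel H.Adj] {w a h num den : ℕ}

theorem level_le (hn : 0 < n) : level n ≤ 2 * n := by
  have := Nat.clog_le_of_le_pow (Nat.lt_two_pow_self (n := n)).le
  unfold level
  omega

/-- Compare squares: `8m ≤ 4 * n * n`. -/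
theorem side_le {m : ℕ} (hm : 0 < m) (hmn : 2 * m ≤ n * n) : side m n ≤ 2 * n := by
  have h := (sideUpTo_spec hm (Nat.clog 2 n)).2.1
  refine Nat.mul_self_le_mul_self_iff.1 (h.trans ?_)
  have : 2 * n * (2 * n) = 4 * (n * n) := by ring
  omega

/-- Since `h ≤ W` and `num ≤ den`, the quotient in `trials` is at least `4 * (a + 1) * level n`. -/
theorem level_le_trials (hW : h ≤ weight H G.edgeFinset.card n)
    (hh : 0 < h) (hnum : 0 < num) (hlt : num ≤ den) :
    level n ≤ trials H a n G.edgeFinset.card h num den := by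
  refine le_trans ?_ (Nat.le_succ _)
  rw [Nat.le_div_iff_mul_le (by positivity)]
  calc level n * (h * (num * num)) ≤
      level n * (weight H G.edgeFinset.card n * (den * den)) := by gcongr
    _ ≤ 4 * (a + 1) * (level n * (weight H G.edgeFinset.card n * (den * den))) :=
        Nat.le_mul_of_pos_left _ (by omega)
    _ = _ := by ring

/-- All quantities are bounded by a power of `n * den`. -/
theorem exists_sizeGood (a B : ℕ) (hk : 0 < k) : ∃ C₀ : ℕ, ∀ C, C₀ ≤ C → ∀ {n : ℕ}
    {G : SimpleGraph (Fin n)} [DecidableRel G.Adj] {w h num den : ℕ}, k ≤ n → 2 ≤ n →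
    0 < G.edgeFinset.card → h ≤ weight H G.edgeFinset.card n → 0 < h → 0 < num → num ≤ den →
    (n * den) ^ C ≤ 2 ^ w → B < 2 ^ w ∧ den < 2 ^ w ∧ h < 2 ^ w ∧ SizeGood G H a h num den w := by
  set R := coverNum H with hR
  set c₁ := 4 * (a + 1) * (k ^ k * 2 ^ R) * 2 + 3 with hc₁
  set c₂ := k ^ k * 2 ^ R with hc₂
  -- Each parenthesized pair consists of the coefficient `c` and the exponent `e` of one bound of
  -- the form `c * q ^ e`; the first one is for the constant `B`, with exponent 0.
  refine ⟨(B + 1) + (18 + 2) + (c₂ + (R + (k + 2) * k)) + (c₁ + (R + 3)) +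
    (c₁ * c₂ + (R + 3 + R)) + (c₁ * k ^ k + (R + 3)), ?_⟩
  intro C hC n G _ w h num den hkn hn hm hhW hh hnum hlt hpow
  have hden : 0 < den := hnum.trans_le hlt
  set q := n * den with hq
  have hnq : n ≤ q := Nat.le_mul_of_pos_right _ hden
  have hdq : den ≤ q := Nat.le_mul_of_pos_left _ (by omega)
  have hq2 : 2 ≤ q := hn.trans hnq
  -- As `q ≥ 2`, a constant factor `c` is at most `q ^ c`, so it can be absorbed into the exponent.
  have hbig : ∀ c e, c + e ≤ C → c * q ^ e < 2 ^ w := by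
    intro c e hce
    calc c * q ^ e < 2 ^ c * q ^ e :=
          Nat.mul_lt_mul_of_pos_right Nat.lt_two_pow_self (by positivity)
      _ ≤ q ^ c * q ^ e := Nat.mul_le_mul_right _ (Nat.pow_le_pow_left hq2 c)
      _ = q ^ (c + e) := (pow_add _ _ _).symm
      _ ≤ q ^ C := Nat.pow_le_pow_right (by omega) hce
      _ ≤ 2 ^ w := hpow
  have hmn := two_mul_card_edgeFinset_le (G := G)
  set m := G.edgeFinset.card with hmdef
  have hside : side m n ^ R ≤ 2 ^ R * q ^ R := by
    rw [← mul_pow]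
    exact Nat.pow_le_pow_left ((side_le hm hmn).trans (Nat.mul_le_mul_left _ hnq)) R
  have hW : weight H m n ≤ c₂ * q ^ R := by
    rw [weight, hc₂, mul_assoc]
    exact Nat.mul_le_mul_left _ hside
  have hq3 : 1 ≤ q ^ (R + 3) := Nat.one_le_pow _ _ (by omega)
  have hnum' : 4 * (a + 1) * weight H m n * level n * (den * den) ≤
      4 * (a + 1) * (k ^ k * 2 ^ R) * 2 * q ^ (R + 3) := by
    calc 4 * (a + 1) * weight H m n * level n * (den * den) ≤
        4 * (a + 1) * (c₂ * q ^ R) * (2 * q) * (q * q) := by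
          have := (level_le (n := n) (by omega)).trans (Nat.mul_le_mul_left 2 hnq)
          gcongr
      _ = _ := by
        rw [hc₂]
        ring
  have hratio : 4 * (a + 1) * weight H m n * level n * (den * den) + 3 ≤ c₁ * q ^ (R + 3) := by
    have : c₁ * q ^ (R + 3) = 4 * (a + 1) * (k ^ k * 2 ^ R) * 2 * q ^ (R + 3) + 3 * q ^ (R + 3) := by
      rw [hc₁]
      ring
    omega
  have hT : trials H a n m h num den + 1 ≤ c₁ * q ^ (R + 3) := by
    have := Nat.div_le_self (4 * (a + 1) * weight H m n * level n * (den * den)) (h * (num * num))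
    unfold trials
    omega
  have hc₁w := hbig c₁ (R + 3) (by omega)
  have hWd : h * (num * num) ≤ 4 * (a + 1) * weight H m n * level n * (den * den) := by
    calc h * (num * num) ≤ weight H m n * (den * den) := by gcongr
      _ ≤ (4 * (a + 1) * level n) * (weight H m n * (den * den)) :=
          Nat.le_mul_of_pos_left _ (Nat.mul_pos (by omega) (Nat.succ_pos _))
      _ = _ := by ring
  have hd1 : den ≤ den * den := Nat.le_mul_self _
  have hd2 : den * den ≤ 4 * (a + 1) * weight H m n * level n * (den * den) :=
    Nat.le_mul_of_pos_left _ (Nat.mul_pos (Nat.mul_pos (by omega) (hh.trans_le hhW))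
      (Nat.succ_pos _))
  have hh1 : h ≤ h * (num * num) := Nat.le_mul_of_pos_right _ (by positivity)
  have r1 : 4 * (a + 1) * weight H m n * level n * (den * den) + 1 < 2 ^ w := by omega
  have r2 : trials H a n m h num den + 1 < 2 ^ w := by omega
  refine ⟨?_, by omega, by omega, ⟨⟨by omega, hkn, hk, hm, ?_, ?_⟩, hden, hh, r1,
    by omega, r2, ?_, ?_, level_le_trials hhW hh hnum hlt⟩⟩
  · have := hbig (B + 1) 0 (by omega)
    rw [pow_zero] at this
    omega
  · refine lt_of_le_of_lt ?_ (hbig 18 2 (by omega))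
    have h1 : n * n ≤ q * q := Nat.mul_le_mul hnq hnq
    have h2 : 1 ≤ q * q := Nat.mul_pos (by omega) (by omega)
    rw [sq]
    omega
  · refine lt_of_le_of_lt ?_ (hbig c₂ (R + (k + 2) * k) (by omega))
    calc side m n ^ R * (k * (2 * m * n ^ k)) ^ k ≤ 2 ^ R * q ^ R * (k * (q * q * q ^ k)) ^ k := by
          have h1 : 2 * m ≤ q * q := hmn.trans (Nat.mul_le_mul hnq hnq)
          gcongr
      _ = c₂ * q ^ (R + (k + 2) * k) := by
          rw [hc₂, pow_add, pow_mul, mul_pow, mul_pow, pow_add]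
          ring
  · refine lt_of_le_of_lt ?_ (hbig (c₁ * c₂) (R + 3 + R) (by omega))
    calc trials H a n m h num den * weight H m n ≤ (c₁ * q ^ (R + 3)) * (c₂ * q ^ R) :=
          Nat.mul_le_mul (by omega) hW
      _ = _ := by ring
  · refine lt_of_le_of_lt ?_ (hbig (c₁ * k ^ k) (R + 3) (by omega))
    calc trials H a n m h num den * (automorphisms H).card ≤ (c₁ * q ^ (R + 3)) * k ^ k :=
          Nat.mul_le_mul (by omega) (by simpa using card_automorphisms_le H)
      _ = _ := by ring

/-- From `s ^ 2 ≤ 8m` one gets `s ^ R ≤ (8m) ^ (R / 2)`; duality replaces the exponent `R / 2` of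
`m` by `ρ(H)`, which is allowed as `m ≥ 1`. -/
theorem weight_le (hH : ∀ v, 0 < H.degree v) {m : ℕ} (hm : 0 < m) :
    (weight H m n : ℝ) ≤ k ^ k * 8 ^ coverNum H * (m : ℝ) ^ fracEdgeCover H := by
  have hm1 : (1 : ℝ) ≤ m := by exact_mod_cast hm
  have hs : ((side m n : ℕ) : ℝ) ^ 2 ≤ 8 * m := by
    have := (sideUpTo_spec hm (Nat.clog 2 n)).2.1
    rw [sq]
    exact_mod_cast this
  have h1 : ((side m n : ℕ) : ℝ) ^ coverNum H ≤ (8 * m) ^ ((coverNum H : ℝ) / 2) := by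
    calc ((side m n : ℕ) : ℝ) ^ coverNum H = (((side m n : ℕ) : ℝ) ^ 2) ^ ((coverNum H : ℝ) / 2) := by
          rw [← Real.rpow_natCast _ 2, ← Real.rpow_mul (Nat.cast_nonneg _), ← Real.rpow_natCast]
          congr 1
          push_cast
          ring
      _ ≤ _ := Real.rpow_le_rpow (by positivity) hs (by positivity)
  have h2 : ((8 : ℝ) * m) ^ ((coverNum H : ℝ) / 2) ≤ 8 ^ coverNum H * (m : ℝ) ^ fracEdgeCover H := by
    rw [Real.mul_rpow (by norm_num) (by positivity)]
    refine mul_le_mul ?_ ?_ (by positivity) (by positivity)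
    · rw [← Real.rpow_natCast]
      refine Real.rpow_le_rpow_of_exponent_le (by norm_num) ?_
      have : (0 : ℝ) ≤ coverNum H := Nat.cast_nonneg _
      linarith
    · exact Real.rpow_le_rpow_of_exponent_le hm1 (coverNum_div_two_le H hH)
  rw [weight]
  push_cast
  rw [mul_assoc]
  exact mul_le_mul_of_nonneg_left (h1.trans h2) (by positivity)

/-- Rounding up costs at most a factor 2 inside the logarithm, and `log 2 > 1 / 2`. So `Nat.clog 2 n
≤ 4 * log n`, and the additional 1 is at most `2 * log n`. -/
theorem level_le_log (hn : 2 ≤ n) : (level n : ℝ) ≤ 6 * Real.log n := by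
  have h1 : 2 ^ (Nat.clog 2 n).pred < n := Nat.pow_pred_clog_lt_self one_lt_two hn
  have h2 : 2 ^ Nat.clog 2 n ≤ 2 * n := by
    have hpos : 0 < Nat.clog 2 n := Nat.clog_pos one_lt_two hn
    rw [← Nat.succ_pred_eq_of_pos hpos, pow_succ]
    omega
  have h3 : (2 : ℝ) ^ Nat.clog 2 n ≤ 2 * n := by exact_mod_cast h2
  have hn0 : (0 : ℝ) < n := by positivity
  have h4 := Real.log_le_log (by positivity) h3
  rw [Real.log_pow, Real.log_mul (by norm_num) hn0.ne'] at h4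
  have h5 : Real.log 2 ≤ Real.log n := Real.log_le_log (by norm_num) (by exact_mod_cast hn)
  have h6 : (0.5 : ℝ) < Real.log 2 := by
    have := Real.log_two_gt_d9
    linarith
  rw [level]
  push_cast
  have h7 : (0 : ℝ) ≤ Nat.clog 2 n := Nat.cast_nonneg _
  nlinarith

theorem trials_cast_le (hW : h ≤ weight H G.edgeFinset.card n) (hh : 0 < h) (hnum : 0 < num)
    (hlt : num ≤ den) : (trials H a n G.edgeFinset.card h num den : ℝ) ≤
      (4 * a + 5) * ((weight H G.edgeFinset.card n : ℝ) / h * (level n / ((num : ℝ) / den) ^ 2)) := by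
  have hd : (0 : ℝ) < den := by exact_mod_cast hnum.trans_le hlt
  have hn' : (0 : ℝ) < num := by exact_mod_cast hnum
  have hh' : (0 : ℝ) < h := by exact_mod_cast hh
  set W := weight H G.edgeFinset.card n
  set Y : ℝ := (W : ℝ) / h * (level n / ((num : ℝ) / den) ^ 2) with hY
  have hL : (1 : ℝ) ≤ level n := by
    have : 1 ≤ level n := Nat.succ_pos _
    exact_mod_cast this
  -- This absorbs the additional trial that comes from rounding up.
  have h1 : 1 ≤ Y := by
    have e1 : 1 ≤ (W : ℝ) / h := by
      rw [le_div_iff₀ hh', one_mul]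
      exact_mod_cast hW
    have e2 : (num : ℝ) / den ≤ 1 := by
      rw [div_le_one hd]
      exact_mod_cast hlt
    have e3 : ((num : ℝ) / den) ^ 2 ≤ 1 := pow_le_one₀ (by positivity) e2
    have e4 : 1 ≤ level n / ((num : ℝ) / den) ^ 2 := by
      rw [le_div_iff₀ (by positivity), one_mul]
      exact e3.trans hL
    calc (1 : ℝ) = 1 * 1 := by norm_num
      _ ≤ Y := mul_le_mul e1 e4 (by norm_num) (by positivity)
  have h2 : ((4 * (a + 1) * W * level n * (den * den) / (h * (num * num)) : ℕ) : ℝ) ≤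
      4 * (a + 1) * Y := by
    refine Nat.cast_div_le.trans (le_of_eq ?_)
    rw [hY]
    push_cast
    field_simp
  rw [trials, Nat.cast_add, Nat.cast_one]
  calc _ ≤ 4 * (a + 1) * Y + Y := add_le_add h2 h1
    _ = _ := by ring

/-- `trials` is chosen so that the Chernoff exponent reaches `(a + 1) * level n` already for the
smallest admissible success probability `h / W`. -/
theorem le_trials_mul {p : ℝ} (hh : 0 < h) (hnum : 0 < num) (hlt : num ≤ den)
    (hW : 0 < weight H G.edgeFinset.card n)
    (hp : (h : ℝ) / weight H G.edgeFinset.card n ≤ p) :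
    ((a : ℝ) + 1) * level n ≤
      trials H a n G.edgeFinset.card h num den * p * ((num : ℝ) / den) ^ 2 / 4 := by
  have hd : (0 : ℝ) < den := by exact_mod_cast hnum.trans_le hlt
  have hn' : (0 : ℝ) < num := by exact_mod_cast hnum
  have hh' : (0 : ℝ) < h := by exact_mod_cast hh
  set W := weight H G.edgeFinset.card n with hWdef
  have hW' : (0 : ℝ) < W := by exact_mod_cast hW
  have h1 : 4 * (a + 1) * W * level n * (den * den) ≤
      trials H a n G.edgeFinset.card h num den * (h * (num * num)) := by
    rw [trials, mul_comm _ (h * (num * num))]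
    exact (Nat.lt_mul_div_succ _ (by positivity)).le
  have h2 : (4 * (a + 1) * W * level n * (den * den) : ℝ) ≤
      trials H a n G.edgeFinset.card h num den * (h * (num * num)) := by exact_mod_cast h1
  set N := trials H a n G.edgeFinset.card h num den
  have h3 : (N : ℝ) * (h / W) * ((num : ℝ) / den) ^ 2 / 4 ≤ N * p * ((num : ℝ) / den) ^ 2 / 4 := by
    gcongr
  refine le_trans ?_ h3
  have e : (N : ℝ) * (h / W) * ((num : ℝ) / den) ^ 2 / 4 =
      (N * (h * (num * num))) / (4 * W * (den * den)) := by
    field_simp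
  rw [e, le_div_iff₀ (by positivity)]
  calc ((a : ℝ) + 1) * level n * (4 * W * (den * den)) =
      4 * (a + 1) * W * level n * (den * den) := by ring
    _ ≤ _ := h2

/-- Since `2n ≤ 2 ^ level n`, one has `exp (-level n) ≤ 1 / (2n)`. The `(a + 1)`-st power leaves a
spare factor `1 / 2`, which pays for the two tails. -/
theorem two_mul_exp_neg_le (hn : 0 < n) {x : ℝ} (hx : ((a : ℝ) + 1) * level n ≤ x) :
    2 * Real.exp (-x) ≤ 1 / (n : ℝ) ^ a := by
  have hn' : (1 : ℝ) ≤ n := by exact_mod_cast hn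
  have h1 : Real.exp (-(level n : ℝ)) ≤ 1 / (2 * n) := by
    rw [Real.exp_neg, ← one_div]
    refine one_div_le_one_div_of_le (by positivity) ?_
    have h2 : 2 * n ≤ 2 ^ level n := by
      rw [level, pow_succ, mul_comm]
      exact Nat.mul_le_mul_right _ (Nat.le_pow_clog one_lt_two n)
    calc (2 * n : ℝ) ≤ 2 ^ level n := by exact_mod_cast h2
      _ ≤ Real.exp 1 ^ level n := by
        refine pow_le_pow_left₀ (by norm_num) ?_ _
        have := Real.add_one_le_exp (1 : ℝ)
        linarith
      _ = Real.exp (level n) := by rw [← Real.exp_nat_mul, mul_one]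
  have h2 : Real.exp (-x) ≤ Real.exp (-(level n : ℝ)) ^ (a + 1) := by
    rw [← Real.exp_nat_mul]
    refine Real.exp_le_exp.2 ?_
    push_cast
    linarith
  have h3 : Real.exp (-(level n : ℝ)) ^ (a + 1) ≤ (1 / (2 * n)) ^ (a + 1) :=
    pow_le_pow_left₀ (Real.exp_nonneg _) h1 _
  have h4 : (1 / (2 * (n : ℝ))) ^ (a + 1) ≤ 1 / n ^ a * (1 / 2) := by
    rw [pow_succ, div_pow, one_pow]
    refine mul_le_mul ?_ ?_ (by positivity) (by positivity)
    · refine one_div_le_one_div_of_le (by positivity) (pow_le_pow_left₀ (by positivity) ?_ _)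
      linarith
    · refine one_div_le_one_div_of_le (by norm_num) ?_
      linarith
  linarith

end Sizes

/-! ### From the program logic to the theorem -/

theorem mem_embeddings {V W : Type*} [Fintype V] [DecidableEq V] [Fintype W] [DecidableEq W]
    {H : SimpleGraph W} {G : SimpleGraph V} [DecidableRel H.Adj] [DecidableRel G.Adj] {f : W → V} :
    f ∈ embeddings H G ↔ Function.Injective f ∧ ∀ a b, H.Adj a b → G.Adj (f a) (f b) := by
  simp [embeddings]

section Correctness

variable {n k : ℕ} {G : SimpleGraph (Fin n)} [DecidableRel G.Adj]
  {nbr : ∀ v : Fin n, Fin (G.degree v) ≃ G.neighborSet v}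
  {H : SimpleGraph (Fin k)} [DecidableRel H.Adj] {w a h num den : ℕ}

theorem initState_sim {m : ℕ} {ε : ℚ} (hW : 1 < 2 ^ w) (hn : n < 2 ^ w) (hm : m < 2 ^ w)
    (hh : h < 2 ^ w) (hnum : ε.num.natAbs < 2 ^ w) (hden : ε.den < 2 ^ w) (hk : k < 2 ^ w) :
    Sim w (initState H n m h ε) (initState H n m h ε) := by
  refine Sim.refl (fun r => ?_) fun x => ?_
  · simp only [initState]
    split <;> first | assumption | omega
  · simp only [initState]
    have := pairAnswer_le_one (G := H) (x / k) (x % k)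
    split_ifs <;> omega

/-- The final configurations of a program, in terms of the abstract distribution. -/
theorem Tri.exists_run {p : Prog} {t : ℕ} {σ : State} {ν : PMF ℕ} {Q : ℕ → State → Prop}
    (h : Tri G nbr w p t σ ν Q) (hσ : Sim w σ σ) :
    ∃ κ : PMF (ℕ × State), κ.map Prod.fst = ν ∧
      κ.map (fun x => (⟨[], x.2⟩ : Config)) = run G nbr w t ⟨[p], σ⟩ ∧
      ∀ x ∈ κ.support, ∃ σ', Sim w x.2 σ' ∧ Q x.1 σ' := by
  have := h σ hσ [] 0 ℕ PMF.pure (fun c s => ∃ σ', Sim w s σ' ∧ Q c σ')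
    (fun c s' σ' h1 h2 => HaltsWith.nil ⟨σ', h1, h2⟩) t (by omega)
  rwa [PMF.bind_pure] at this

/-- A single copy of `H` already provides an edge of `G` and enough vertices, so degenerate graphs
need no treatment by the algorithm. -/
theorem exists_adj_of_copyCount_pos (hk : 0 < k) (hH : ∀ v, 0 < H.degree v)
    (h : 0 < G.copyCount H) : k ≤ n ∧ G.edgeFinset.Nonempty := by
  have hpos : 0 < (embeddings H G).card := by
    rw [card_embeddings]
    exact Nat.mul_pos h (card_automorphisms_pos H)
  obtain ⟨f, hf⟩ := Finset.card_pos.1 hpos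
  have hf' := mem_embeddings.1 hf
  refine ⟨by simpa using Fintype.card_le_of_injective f hf'.1, ?_⟩
  obtain ⟨b, hb⟩ := (H.degree_pos_iff_exists_adj ⟨0, hk⟩).1 (hH _)
  exact ⟨s(f ⟨0, hk⟩, f b), by simpa using hf'.2 _ _ hb⟩

/-- Without isolated vertices the degree sum gives `n ≤ 2m`. -/
theorem le_three_mul_card_edgeFinset (hG : ∀ v, 0 < G.degree v) :
    n + G.edgeFinset.card ≤ 3 * G.edgeFinset.card := by
  have h1 : ∑ _v : Fin n, 1 ≤ ∑ v : Fin n, G.degree v := Finset.sum_le_sum fun v _ => hG v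
  rw [G.sum_degrees_eq_twice_card_edges] at h1
  simp at h1
  omega

/-- A count near its expectation leads to an output near the number of copies. -/
theorem output_bounds {ε N W A c t : ℝ} (hN : 0 < N) (hW : 0 < W) (hA : 0 < A)
    (h1 : (1 - ε) * (N * (t * A / W)) ≤ c) (h2 : c ≤ (1 + ε) * (N * (t * A / W))) :
    (1 - ε) * t ≤ c * W / (N * A) ∧ c * W / (N * A) ≤ (1 + ε) * t := by
  rw [le_div_iff₀ (by positivity), div_le_iff₀ (by positivity)]
  have e : ∀ x : ℝ, x * (N * (t * A / W)) * W = x * t * (N * A) := by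
    intro x
    field_simp
  constructor
  · rw [← e]
    exact mul_le_mul_of_nonneg_right h1 hW.le
  · rw [← e]
    exact mul_le_mul_of_nonneg_right h2 hW.le

end Correctness
end SubgraphCount

open SubgraphCount in
theorem mainTheorem2 (a : ℕ) :
    ∃ P : SubgraphCount.Prog,
      ∀ (k : ℕ) (H : SimpleGraph (Fin k)) [DecidableRel H.Adj],
        0 < k → (∀ v, 0 < H.degree v) →
        ∃ C : ℕ,
          ∀ (n : ℕ) (G : SimpleGraph (Fin n)) [DecidableRel G.Adj]
            (nbr : ∀ v : Fin n, Fin (G.degree v) ≃ G.neighborSet v)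
            (m h : ℕ) (ε : ℚ) (w : ℕ),
            m = G.edgeFinset.card → 0 < h → h ≤ G.copyCount H → 0 < ε → ε < 1 →
            (n * ε.den) ^ C ≤ 2 ^ w →
            ∃ T : ℕ,
              (T : ℝ) ≤ C * SubgraphCount.sampleBound m n h (SubgraphCount.fracEdgeCover H) ε ∧
              (∀ c ∈ (SubgraphCount.run G nbr w T
                  ⟨[P], SubgraphCount.initState H n m h ε⟩).support,
                c.todo = [] ∧
                (c.state.queries : ℝ) ≤ C * min ((n : ℝ) + m)
                  (SubgraphCount.sampleBound m n h (SubgraphCount.fracEdgeCover H) ε) ∧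
                ((∀ v, 0 < G.degree v) →
                  (c.state.queries : ℝ) ≤ C * min (m : ℝ)
                    (SubgraphCount.sampleBound m n h (SubgraphCount.fracEdgeCover H) ε))) ∧
              1 - 1 / (n : ℝ) ^ a ≤
                ((SubgraphCount.run G nbr w T
                  ⟨[P], SubgraphCount.initState H n m h ε⟩).toOuterMeasure
                  {c | (1 - (ε : ℝ)) * G.copyCount H ≤ c.output ∧
                    c.output ≤ (1 + (ε : ℝ)) * G.copyCount H}).toReal := by
  refine ⟨estimateProg a, fun k H _ hk hH => ?_⟩
  have hkne : (Finset.range k).Nonempty := Finset.nonempty_range_iff.2 hk.ne'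
  obtain ⟨B, D, hBD⟩ := exists_tri_estimateProg (H := H) a hk hkne
  obtain ⟨C₀, hC₀⟩ := exists_sizeGood (H := H) a B hk
  set K : ℕ := (4 * a + 5) * (k ^ k * 8 ^ coverNum H) * 6 with hK
  set Y : ℕ := 2 * k + k * k + 2 with hY
  -- The summands serve for the word size, for the running time, for the queries against `n + m` or
  -- `m`, and for the queries against `sampleBound`.
  refine ⟨C₀ + D * K + 3 * Y + Y * K, ?_⟩
  intro n G _ nbr m h ε w hm hh hle h0 h1 hpow
  subst hm
  set C := C₀ + D * K + 3 * Y + Y * K with hC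
  obtain ⟨hkn, hE⟩ := exists_adj_of_copyCount_pos hk hH (hh.trans_le hle)
  have hm : 0 < G.edgeFinset.card := hE.card_pos
  have hmn := two_mul_card_edgeFinset_le (G := G)
  have hn : 2 ≤ n := by
    by_contra hc
    have : n * n ≤ 1 * 1 := Nat.mul_le_mul (by omega) (by omega)
    omega
  set m := G.edgeFinset.card with hmdef
  have hnum : 0 < ε.num.natAbs := Int.natAbs_pos.2 (Rat.num_pos.2 h0).ne'
  have hlt : ε.num.natAbs ≤ ε.den := by
    have h2 := Rat.num_pos.2 h0
    have h3 := Rat.num_lt_denom_iff.2 h1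
    omega
  have hε : ((ε.num.natAbs : ℝ) / ε.den) = (ε : ℝ) := by
    rw [Rat.cast_def, ← Int.natAbs_of_nonneg (Rat.num_pos.2 h0).le]
    simp
  have h0' : (0 : ℝ) < ε := by exact_mod_cast h0
  have h1' : (ε : ℝ) < 1 := by exact_mod_cast h1
  set W := weight H m n with hWdef
  set p := (trialDist G nbr H hE hkne (side m n ^ coverNum H) true).toReal with hpdef
  have hp : p = (G.copyCount H : ℝ) * (automorphisms H).card / W := by
    rw [hpdef, trialDist_apply_true hE hkne hH (le_side_sq hm hmn), card_embeddings, hWdef, weight]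
    push_cast
    rfl
  have hW0 : 0 < W := Nat.mul_pos (pow_pos hk k) (pow_pos (sideUpTo_spec hm _).1 _)
  have hW0' : (0 : ℝ) < W := by exact_mod_cast hW0
  have hA0 := card_automorphisms_pos H
  have hle' : G.copyCount H ≤ G.copyCount H * (automorphisms H).card :=
    Nat.le_mul_of_pos_right _ hA0
  -- A success probability is at most 1, so the number of embeddings is at most `W`.
  have hhW : h ≤ W := by
    have h2 : p ≤ 1 := ENNReal.toReal_le_of_le_ofReal zero_le_one (by simpa using PMF.coe_le_one _ _)
    rw [hp, div_le_one hW0'] at h2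
    have h3 : G.copyCount H * (automorphisms H).card ≤ W := by exact_mod_cast h2
    omega
  obtain ⟨hB, hdw, hhw, hs⟩ := hC₀ C (by omega) hkn hn hm hhW hh hnum hlt hpow
  set N := trials H a n m h ε.num.natAbs ε.den with hNdef
  have hW := hs.trial.one_lt
  have hsq := hs.trial.square
  have hnn : n ≤ n * n := Nat.le_mul_self n
  have hN0 : (0 : ℝ) < N := by
    have : 0 < N := Nat.succ_pos _
    exact_mod_cast this
  obtain ⟨κ, k1, k2, k3⟩ := (hBD (nbr := nbr) hE hB hs).exists_run
    (initState_sim hW (by omega) (by omega) hhw (by omega) hdw (by omega))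
  set b := sampleBound m n h (fracEdgeCover H) ε with hb
  have hh' : (0 : ℝ) < h := by exact_mod_cast hh
  have hn1 : (1 : ℝ) ≤ n := by exact_mod_cast (by omega : 1 ≤ n)
  have hlog : 0 ≤ Real.log n := Real.log_nonneg hn1
  have hb0 : 0 ≤ b := by
    rw [hb, sampleBound]
    positivity
  have hNb : (N : ℝ) ≤ K * b := by
    refine (trials_cast_le hhW hh hnum hlt).trans ?_
    rw [hε, hb, sampleBound, hK]
    calc (4 * (a : ℝ) + 5) * ((W : ℝ) / h * (level n / (ε : ℝ) ^ 2)) ≤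
        (4 * a + 5) * ((k ^ k * 8 ^ coverNum H * (m : ℝ) ^ fracEdgeCover H) / h *
          (6 * Real.log n / (ε : ℝ) ^ 2)) := by
          have := weight_le (n := n) hH hm
          have := level_le_log hn
          gcongr
      _ = _ := by
        push_cast
        ring
  have hcast : ∀ x y : ℕ, x ≤ y → (x : ℝ) * b ≤ y * b := fun x y hxy =>
    mul_le_mul_of_nonneg_right (by exact_mod_cast hxy) hb0
  refine ⟨D * N, ?_, ?_, ?_⟩
  · push_cast
    calc (D : ℝ) * N ≤ D * (K * b) := by gcongr
      _ = ((D * K : ℕ) : ℝ) * b := by push_cast; ring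
      _ ≤ C * b := hcast _ _ (by omega)
  · intro c hc
    rw [← k2, PMF.support_map] at hc
    obtain ⟨x, hx, rfl⟩ := hc
    obtain ⟨σ', hsim, -, -, hq⟩ := k3 x hx
    replace hq : N < n + m ∧ σ'.queries ≤ N * (2 * k + k * k) ∨
      n + m ≤ N ∧ σ'.queries ≤ n + 2 * m := hq
    have hqueries : x.2.queries = σ'.queries := hsim.queries
    -- The comparison of `N` with `n + m` made by the program ensures that either count of queries
    -- is below both bounds.
    have q1 : x.2.queries ≤ Y * (n + m) ∧ x.2.queries ≤ Y * N := by
      rw [hqueries, hY]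
      rcases hq with ⟨i1, i2⟩ | ⟨i1, i2⟩
      · have e1 : N * (2 * k + k * k) ≤ (2 * k + k * k) * (n + m) := by
          rw [mul_comm]
          exact Nat.mul_le_mul_left _ i1.le
        have e2 := add_mul (2 * k + k * k) 2 (n + m)
        have e3 := add_mul (2 * k + k * k) 2 N
        have e4 := mul_comm N (2 * k + k * k)
        omega
      · have e2 := add_mul (2 * k + k * k) 2 (n + m)
        have e3 := add_mul (2 * k + k * k) 2 N
        omega
    have q2 : (x.2.queries : ℝ) ≤ C * b := by
      calc (x.2.queries : ℝ) ≤ ((Y * N : ℕ) : ℝ) := by exact_mod_cast q1.2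
        _ ≤ Y * (K * b) := by push_cast; gcongr
        _ = ((Y * K : ℕ) : ℝ) * b := by push_cast; ring
        _ ≤ C * b := hcast _ _ (by omega)
    have hC0 : (0 : ℝ) ≤ C := Nat.cast_nonneg _
    refine ⟨rfl, ?_, fun hG => ?_⟩
    · rw [mul_min_of_nonneg _ _ hC0]
      refine le_min ?_ q2
      have : x.2.queries ≤ C * (n + m) :=
        q1.1.trans (Nat.mul_le_mul_right _ (by omega))
      exact_mod_cast this
    · rw [mul_min_of_nonneg _ _ hC0]
      refine le_min ?_ q2
      have : x.2.queries ≤ C * m := by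
        calc x.2.queries ≤ Y * (n + m) := q1.1
          _ ≤ Y * (3 * m) := Nat.mul_le_mul_left _ (le_three_mul_card_edgeFinset hG)
          _ = 3 * Y * m := by ring
          _ ≤ C * m := Nat.mul_le_mul_right _ (by omega)
      exact_mod_cast this
  · have hchernoff := one_sub_le_toOuterMeasure_successes
      (trialDist G nbr H hE hkne (side m n ^ coverNum H)) N h0' h1'
    rw [← hpdef, ← k1, PMF.toOuterMeasure_map_apply] at hchernoff
    rw [← k2, PMF.toOuterMeasure_map_apply]
    have hp' : (h : ℝ) / W ≤ p := by
      rw [hp]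
      gcongr
      exact_mod_cast hle.trans hle'
    have hexp := two_mul_exp_neg_le (a := a) (by omega : 0 < n)
      (le_trials_mul (a := a) hh hnum hlt hW0 hp')
    rw [hε] at hexp
    refine le_trans (by linarith) (hchernoff.trans (ENNReal.toReal_mono ?_ ?_))
    · refine ne_top_of_le_ne_top ENNReal.one_ne_top ?_
      rw [← PMF.toOuterMeasure_map_apply]
      exact (MeasureTheory.OuterMeasure.mono _ (Set.subset_univ _)).trans
        ((PMF.toOuterMeasure_apply_eq_one_iff _ _).2 (Set.subset_univ _)).le
    -- Both events have been pulled back to the coupling `κ`. It suffices to compare them on its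
    -- support, where the final registers are known in terms of the abstract number of successes.
    · refine PMF.toOuterMeasure_mono _ ?_
      rintro x ⟨⟨hx1, hx2⟩, hx⟩
      obtain ⟨σ', hsim, g0, g1, -⟩ := k3 x hx
      have e0 : x.2.reg 0 = x.1 * W := (hsim.reg 0 (by decide)).trans g0
      have e1 : x.2.reg 1 = N * (automorphisms H).card := (hsim.reg 1 (by decide)).trans g1
      rw [hp] at hx1 hx2
      have := output_bounds hN0 hW0' (by exact_mod_cast hA0) hx1 hx2
      simpa only [Set.mem_preimage, Set.mem_ofPred_eq, Config.output, e0, e1, Nat.cast_mul] using this
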